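/- Let $\eta(z)=e^{\pi i z/12}\prod_{n\ge1}(1-e^{2\pi i n z})$ be the Dedekind eta function on the upper half-plane. Write $q=e^{2\pi i z}$ and $\eta_k=\eta(kz)$, and let $\left(\frac n5\right)$ be the Legendre symbol. Consider the following six cases of integers $A,B,\lambda$ and functions $t(z),f(z)$: - Case A: $(A,B,\lambda)=(7,-8,2)$, $\;t=\dfrac{\eta_1^3\eta_6^9}{\eta_2^3\eta_3^9}$, $\;f=\dfrac{\eta_2\eta_3^6}{\eta_1^2\eta_6^3}$. - Case C: $(A,B,\lambda)=(10,9,3)$, $\;t=\dfrac{\eta_1^4\eta_6^8}{\eta_2^8\eta_3^4}$, $\;f=\dfrac{\eta_2^6\eta_3}{\eta_1^3\eta_6^2}$. - Case F: $(A,B,\lambda)=(17,72,6)$, $\;t=\dfrac{\eta_1^5\eta_3\eta_4^5\eta_6^2\eta_{12}}{\eta_2^{14}}$, $\;f=\dfrac{\eta_2^{15}\eta_3^2\eta_{12}^2}{\eta_1^6\eta_4^6\eta_6^5}$. - Case E: $(A,B,\lambda)=(12,32,4)$, $\;t=\dfrac{\eta_1^4\eta_4^2\eta_8^4}{\eta_2^{10}}$,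 $\;f=\dfrac{\eta_2^{10}}{\eta_1^4\eta_4^4}$. - Case G: $(A,B,\lambda)=(0,-16,0)$, $\;t=\dfrac{\eta_2^4\eta_8^8}{\eta_4^{12}}$, $\;f=\dfrac{\eta_4^{10}}{\eta_2^4\eta_8^4}$. - Case D: $(A,B,\lambda)=(11,-1,3)$, $\;t=q\displaystyle\prod_{n\ge1}(1-q^n)^{5\left(\frac n5\right)}$, $\;f=\left(t^{-1}\dfrac{\eta_5^5}{\eta_1}\right)^{1/2}$, where the square root is the positive one on the positive imaginary axis. On the positive imaginary axis $t(z)$ is real and positive, and $t(z)^{s-1}=e^{(s-1)\log t(z)}$ with the real logarithm. Then in each of the six cases the integral $$\mathbf\Gamma(s)=\int_0^{i\infty}t(z)^{s-1}\,z\,f(z)\,dt(z)$$ along the positive imaginary axis converges absolutely for every $s\in\mathbb C$ with $\mathrm{Re}(s)>0$, and for all such $s$ $$s^2\,\mathbf\Gamma(s)=\bigl(As(s+1)+\lambda\bigr)\mathbf\Gamma(s+1)-B(s+1)^2\,\mathbf\Gamma(s+2).$$ -/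

import Mathlib

namespace BeauvilleFamily

/-- The six cases of the table, by Zagier's labels. -/
inductive Case where
  | A | C | F | E | G | D

/-- The integer `A` in `L = θ² - t (A θ(θ + 1) + λ) + B t² (θ + 1)²`. -/
def Case.coeffA : Case → ℤ
  | .A => 7
  | .C => 10
  | .F => 17
  | .E => 12
  | .G => 0
  | .D => 11

/-- The integer `B` in `L = θ² - t (A θ(θ + 1) + λ) + B t² (θ + 1)²`. -/
def Case.coeffB : Case → ℤ
  | .A => -8
  | .C => 9
  | .F => 72
  | .E => 32
  | .G => -16
  | .D => -1

/-- The integer `λ` in `L = θ² - t (A θ(θ + 1) + λ) + B t² (θ + 1)²`. -/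
def Case.coeffLambda : Case → ℤ
  | .A => 2
  | .C => 3
  | .F => 6
  | .E => 4
  | .G => 0
  | .D => 3

/-- `etaAt z k = η(k z)`, where `η` is the Dedekind eta function. -/
noncomputable def etaAt (z : ℂ) (k : ℕ) : ℂ := ModularForm.eta (k * z)

/-- `q ∏_{n ≥ 1} (1 - qⁿ) ^ (5 (n/5))` with `q = exp (2πiz)` and `(n/5)` the Legendre symbol. -/
noncomputable def hauptmodulD (z : ℂ) : ℂ :=
  Complex.exp (2 * Real.pi * Complex.I * z) *
    ∏' n : ℕ, (1 - Complex.exp (2 * Real.pi * Complex.I * z) ^ (n + 1)) ^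
      (5 * jacobiSym ((n : ℤ) + 1) 5)

/-- The modular function `t(z)` (used for `z` in the upper half plane). -/
noncomputable def Case.t : Case → ℂ → ℂ
  | .A, z => etaAt z 1 ^ 3 * etaAt z 6 ^ 9 / (etaAt z 2 ^ 3 * etaAt z 3 ^ 9)
  | .C, z => etaAt z 1 ^ 4 * etaAt z 6 ^ 8 / (etaAt z 2 ^ 8 * etaAt z 3 ^ 4)
  | .F, z => etaAt z 1 ^ 5 * etaAt z 3 * etaAt z 4 ^ 5 * etaAt z 6 ^ 2 * etaAt z 12 /
      etaAt z 2 ^ 14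
  | .E, z => etaAt z 1 ^ 4 * etaAt z 4 ^ 2 * etaAt z 8 ^ 4 / etaAt z 2 ^ 10
  | .G, z => etaAt z 2 ^ 4 * etaAt z 8 ^ 8 / etaAt z 4 ^ 12
  | .D, z => hauptmodulD z

/-- The modular form `f(z)` of weight one. In case `D` it is a square root of
`t(z)⁻¹ η(5z)⁵ / η(z)`. This quotient is a positive real number for `z` on the positive imaginary
axis, which is the only place where `f` is used below, and there the principal square root
written here is the positive one, that is, the branch with `f(z) → 1` as `z → i∞`. -/
noncomputable def Case.f : Case → ℂ → ℂ
  | .A, z => etaAt z 2 * etaAt z 3 ^ 6 / (etaAt z 1 ^ 2 * etaAt z 6 ^ 3)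
  | .C, z => etaAt z 2 ^ 6 * etaAt z 3 / (etaAt z 1 ^ 3 * etaAt z 6 ^ 2)
  | .F, z => etaAt z 2 ^ 15 * etaAt z 3 ^ 2 * etaAt z 12 ^ 2 /
      (etaAt z 1 ^ 6 * etaAt z 4 ^ 6 * etaAt z 6 ^ 5)
  | .E, z => etaAt z 2 ^ 10 / (etaAt z 1 ^ 4 * etaAt z 4 ^ 4)
  | .G, z => etaAt z 4 ^ 10 / (etaAt z 2 ^ 4 * etaAt z 8 ^ 4)
  | .D, z => ((hauptmodulD z)⁻¹ * (etaAt z 5 ^ 5 / etaAt z 1)) ^ (1 / 2 : ℂ)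

/-- The pullback of the differential form `t(z)^(s-1) z f(z) dt(z)` along the path `y ↦ i y`.
On this path `t(z)` is a positive real number, and the complex power is the one given by the
real logarithm of `t(z)`. -/
noncomputable def Case.gammaIntegrand (c : Case) (s : ℂ) (y : ℝ) : ℂ :=
  c.t (Complex.I * y) ^ (s - 1) * (Complex.I * y) * c.f (Complex.I * y) *
    (deriv c.t (Complex.I * y) * Complex.I)

/-- `Γ(s) = ∫_0^{i∞} t(z)^(s-1) z f(z) dt(z)`, along the positive imaginary axis. -/
noncomputable def Case.Gamma (c : Case) (s : ℂ) : ℂ :=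
  ∫ y in Set.Ioi (0 : ℝ), c.gammaIntegrand s y

end BeauvilleFamily

/-! Put ϑ = q d/dq, P = 1 - At + Bt², g = f², φ = ϑf/f and θ = t d/dt. The modular input is that ϑt
= t g P and that f is killed by L = θ² - t(Aθ(θ+1) + λ) + Bt²(θ+1)² = θPθ - (λt - Bt²). As a
first-order system in t, g, φ this is `IsSolution`. Because ϑz is constant, zf is killed by L too.
Hence t^s (Pθ(zf) - sP·zf) is a primitive of -(s² - (As(s+1)+λ)t + B(s+1)²t²) t^(s-1) z f dt, and
the recurrence says that its boundary values vanish (`hasDerivAt_primitive`, `recurrence`). At i∞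
the function t decays exponentially. At z = 0 it is enough that gP and φ - 1/(2πy) stay bounded on z
= iy: then yf lies between positive constants and t is bounded.

The differential equations come from formal power series. A formal solution (T, G, Φ) exists by
X-adic contraction (`exists_isSolution`). Explicit polynomials in T turn it into a solution of
Ramanujan's equations for E₂, E₄, E₆ at q^k; such solutions are rigid (`IsRamanujan.unique`), so
kE₂(q^k) = 12Φ + G p(T). The logarithmic derivative of an eta quotient is a combination of the
kE₂(q^k). Comparing logarithmic derivatives and leading coefficients identifies t with T and f² with
G. The transformation of E₂ under z ↦ -1/z gives the behaviour at z = 0.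

In case D the function t is not given as an eta quotient. By the Jacobi triple product t = q(θ₁/θ₂)⁵
for two theta series, and ϑt/t = η₁⁵/η₅ is a Wronskian identity. It is proved by summing over the
Gaussian multiples of 2 - i in two ways (`progSum_sq`). -/

namespace BeauvilleFamily

/-! ### Formal power series: the Euler operator and the rigidity of Ramanujan's equations -/

open PowerSeries

/-- The Euler operator `X d/dX` on formal power series. -/
noncomputable def eulerDeriv : Derivation ℂ ℂ⟦X⟧ ℂ⟦X⟧ := (X : ℂ⟦X⟧) • PowerSeries.derivative ℂ

theorem coeff_eulerDeriv (p : ℂ⟦X⟧) (n : ℕ) :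
    coeff n (eulerDeriv p) = n * coeff n p := by
  rw [eulerDeriv, Derivation.smul_apply, smul_eq_mul]
  cases n with
  | zero => simp
  | succ n =>
    rw [coeff_succ_X_mul, coeff_derivative]
    push_cast
    ring

theorem eulerDeriv_mul (p r : ℂ⟦X⟧) :
    eulerDeriv (p * r) = p * eulerDeriv r + eulerDeriv p * r := by
  rw [Derivation.leibniz, smul_eq_mul, smul_eq_mul, mul_comm r]

theorem eulerDeriv_pow (p : ℂ⟦X⟧) (n : ℕ) :
    eulerDeriv (p ^ n) = n * p ^ (n - 1) * eulerDeriv p := by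
  rw [Derivation.leibniz_pow, smul_eq_mul, nsmul_eq_mul, mul_assoc]

theorem eulerDeriv_aeval (T : ℂ⟦X⟧) (p : Polynomial ℂ) :
    eulerDeriv (Polynomial.aeval T p) =
      Polynomial.aeval T (Polynomial.derivative p) * eulerDeriv T := by
  rw [Derivation.map_aeval, smul_eq_mul]

theorem eulerDeriv_expand (k : ℕ) (hk : k ≠ 0) (p : ℂ⟦X⟧) :
    eulerDeriv (expand k hk p) = k * expand k hk (eulerDeriv p) := by
  ext n
  rw [coeff_eulerDeriv, ← map_natCast (C (R := ℂ)), coeff_C_mul, coeff_expand, coeff_expand]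
  split_ifs with h
  · obtain ⟨m, rfl⟩ := h
    rw [Nat.mul_div_cancel_left _ (Nat.pos_of_ne_zero hk), coeff_eulerDeriv]
    push_cast
    ring
  · simp

theorem eulerDeriv_rescale (c : ℂ) (p : ℂ⟦X⟧) :
    eulerDeriv (rescale c p) = rescale c (eulerDeriv p) := by
  ext n
  simp only [coeff_eulerDeriv, coeff_rescale]
  ring

theorem coeff_mul_X_pow_mul (p r : ℂ⟦X⟧) (n : ℕ) :
    coeff n (p * (X ^ n * r)) = constantCoeff p * constantCoeff r := by
  rw [mul_left_comm, coeff_X_pow_mul']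
  simp

/-- A solution of `ϑ p = p v` is determined by its coefficient of index `v 0`. -/
theorem eq_of_eulerDeriv_eq_mul {p r v : ℂ⟦X⟧} {m : ℕ} (hp : eulerDeriv p = p * v)
    (hr : eulerDeriv r = r * v) (hv : constantCoeff v = m) (h : coeff m p = coeff m r) :
    p = r := by
  have key : ∀ n, (X : ℂ⟦X⟧) ^ n ∣ p - r := by
    intro n
    induction n with
    | zero => simp
    | succ n ih =>
      obtain ⟨a, ha⟩ := ih
      have hn : coeff n (p - r) = constantCoeff a := by
        have := coeff_mul_X_pow_mul 1 a n
        rwa [one_mul, ← ha, map_one, one_mul] at this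
      have h0 : constantCoeff a = 0 := by
        -- The lowest coefficient of p - r, at index n, is multiplied by n - m in the equation. Only
        -- n = m leaves it free, and there `h` fixes it.
        rcases eq_or_ne n m with rfl | hne
        · rw [← hn, map_sub, h, sub_self]
        have h1 : eulerDeriv (p - r) = v * (p - r) := by rw [map_sub, hp, hr]; ring
        have h2 := congrArg (coeff n) h1
        rw [coeff_eulerDeriv, hn, ha, coeff_mul_X_pow_mul, hv] at h2
        have h3 : ((n : ℂ) - m) * constantCoeff a = 0 := by linear_combination h2
        rcases mul_eq_zero.mp h3 with h4 | h4
        · exact absurd (by exact_mod_cast sub_eq_zero.mp h4) hne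
        · exact h4
      obtain ⟨b, hb⟩ := X_dvd_iff.mpr h0
      exact ⟨b, by rw [ha, hb]; ring⟩
  rw [← sub_eq_zero]
  ext n
  exact X_pow_dvd_iff.mp (key (n + 1)) n (Nat.lt_succ_self n)

/-- Ramanujan's differential equations for `E₂(q ^ k), E₄(q ^ k), E₆(q ^ k)`. -/
structure IsRamanujan (k : ℕ) (x y z : ℂ⟦X⟧) : Prop where
  constX : constantCoeff x = 1
  constY : constantCoeff y = 1
  constZ : constantCoeff z = 1
  derivX : 12 * eulerDeriv x = k * (x ^ 2 - y)
  derivY : 3 * eulerDeriv y = k * (x * y - z)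
  derivZ : 2 * eulerDeriv z = k * (x * z - y ^ 2)

theorem IsRamanujan.expand {x y z : ℂ⟦X⟧} {l : ℕ} (h : IsRamanujan l x y z) (k : ℕ) (hk : k ≠ 0) :
    IsRamanujan (k * l) (expand k hk x) (expand k hk y) (expand k hk z) where
  constX := by rw [constantCoeff_expand, h.constX]
  constY := by rw [constantCoeff_expand, h.constY]
  constZ := by rw [constantCoeff_expand, h.constZ]
  derivX := by
    have := congrArg (PowerSeries.expand k hk) h.derivX
    simp only [map_mul, map_ofNat, map_natCast, map_sub, map_pow] at this
    rw [eulerDeriv_expand]; push_cast; linear_combination (k : ℂ⟦X⟧) * this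
  derivY := by
    have := congrArg (PowerSeries.expand k hk) h.derivY
    simp only [map_mul, map_ofNat, map_natCast, map_sub] at this
    rw [eulerDeriv_expand]; push_cast; linear_combination (k : ℂ⟦X⟧) * this
  derivZ := by
    have := congrArg (PowerSeries.expand k hk) h.derivZ
    simp only [map_mul, map_ofNat, map_natCast, map_sub, map_pow] at this
    rw [eulerDeriv_expand]; push_cast; linear_combination (k : ℂ⟦X⟧) * this

theorem constantCoeff_rescale_apply (c : ℂ) (p : ℂ⟦X⟧) :
    constantCoeff (rescale c p) = constantCoeff p := by
  rw [← coeff_zero_eq_constantCoeff_apply, coeff_rescale]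
  simp

theorem IsRamanujan.rescale {x y z : ℂ⟦X⟧} {k : ℕ} (h : IsRamanujan k x y z) (c : ℂ) :
    IsRamanujan k (rescale c x) (rescale c y) (rescale c z) where
  constX := by rw [constantCoeff_rescale_apply, h.constX]
  constY := by rw [constantCoeff_rescale_apply, h.constY]
  constZ := by rw [constantCoeff_rescale_apply, h.constZ]
  derivX := by
    have := congrArg (PowerSeries.rescale c) h.derivX
    simp only [map_mul, map_ofNat, map_natCast, map_sub, map_pow] at this
    rw [eulerDeriv_rescale, this]
  derivY := by
    have := congrArg (PowerSeries.rescale c) h.derivY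
    simp only [map_mul, map_ofNat, map_natCast, map_sub] at this
    rw [eulerDeriv_rescale, this]
  derivZ := by
    have := congrArg (PowerSeries.rescale c) h.derivZ
    simp only [map_mul, map_ofNat, map_natCast, map_sub, map_pow] at this
    rw [eulerDeriv_rescale, this]

theorem coeff_natCast_mul (k n : ℕ) (p : ℂ⟦X⟧) : coeff n ((k : ℂ⟦X⟧) * p) = k * coeff n p := by
  rw [← map_natCast (C (R := ℂ)), coeff_C_mul]

theorem coeff_ofNat_mul (k n : ℕ) [k.AtLeastTwo] (p : ℂ⟦X⟧) :
    coeff n ((OfNat.ofNat k : ℂ⟦X⟧) * p) = (OfNat.ofNat k : ℂ) * coeff n p := by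
  rw [← map_ofNat (C (R := ℂ)), coeff_C_mul]

/-- A solution of Ramanujan's equations is determined by one coefficient of `E₄³ - E₆²`. -/
theorem IsRamanujan.unique {k : ℕ} {x y z x' y' z' : ℂ⟦X⟧}
    (h : IsRamanujan k x y z) (h' : IsRamanujan k x' y' z')
    (hk : coeff k (y ^ 3 - z ^ 2) = coeff k (y' ^ 3 - z' ^ 2)) :
    x = x' ∧ y = y' ∧ z = z' := by
  have key : ∀ n, (X : ℂ⟦X⟧) ^ (n + 1) ∣ x - x' ∧ (X : ℂ⟦X⟧) ^ (n + 1) ∣ y - y' ∧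
      (X : ℂ⟦X⟧) ^ (n + 1) ∣ z - z' := by
    intro n
    induction n with
    | zero =>
      refine ⟨?_, ?_, ?_⟩ <;> rw [zero_add, pow_one, X_dvd_iff, map_sub, sub_eq_zero]
      · rw [h.constX, h'.constX]
      · rw [h.constY, h'.constY]
      · rw [h.constZ, h'.constZ]
    | succ n ih =>
      obtain ⟨⟨a, ha⟩, ⟨b, hb⟩, ⟨c, hc⟩⟩ := ih
      set N := n + 1 with hN
      have cf : ∀ {p p' r : ℂ⟦X⟧}, p - p' = X ^ N * r → coeff N (p - p') = constantCoeff r := by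
        intro p p' r hr
        have := coeff_mul_X_pow_mul 1 r N
        rwa [one_mul, ← hr, map_one, one_mul] at this
      -- At the first order N where the solutions may differ, the differences a, b, c of the
      -- coefficients satisfy the linearised system 12Na = k(2a - b), 3Nb = k(a + b - c), 2Nc = k(a
      -- + c - 2b).
      have e1 : 12 * eulerDeriv (x - x') = k * ((x + x') * (x - x') - (y - y')) := by
        rw [map_sub, mul_sub, h.derivX, h'.derivX]; ring
      have e2 : 3 * eulerDeriv (y - y') = k * (x * (y - y') + y' * (x - x') - (z - z')) := by
        rw [map_sub, mul_sub, h.derivY, h'.derivY]; ring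
      have e3 : 2 * eulerDeriv (z - z') =
          k * (x * (z - z') + z' * (x - x') - (y + y') * (y - y')) := by
        rw [map_sub, mul_sub, h.derivZ, h'.derivZ]; ring
      have d1 := congrArg (coeff N) e1
      have d2 := congrArg (coeff N) e2
      have d3 := congrArg (coeff N) e3
      rw [coeff_ofNat_mul, coeff_natCast_mul, coeff_eulerDeriv, cf ha, map_sub (coeff N) (_ * _),
          cf hb, ha,
        coeff_mul_X_pow_mul, map_add, h.constX, h'.constX] at d1
      rw [coeff_ofNat_mul, coeff_natCast_mul, coeff_eulerDeriv, cf hb, map_sub (coeff N) (_ + _),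
          map_add, cf hc, ha,
        hb, coeff_mul_X_pow_mul, coeff_mul_X_pow_mul, h.constX, h'.constY] at d2
      rw [coeff_ofNat_mul, coeff_natCast_mul, coeff_eulerDeriv, cf hc, map_sub (coeff N) (_ + _),
          map_add, ha,
        hb, hc, coeff_mul_X_pow_mul, coeff_mul_X_pow_mul, coeff_mul_X_pow_mul, h.constX,
        h'.constZ, map_add, h.constY, h'.constY] at d3
      have hN0 : (N : ℂ) ≠ 0 := by rw [hN]; exact_mod_cast Nat.succ_ne_zero n
      -- 3b - 2c is the leading difference of y³ - z² and an eigenvector with eigenvalue k, so it is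
      -- free only at N = k, the index prescribed by `hk`. The rest of the system is unipotent and
      -- forces a = b = c = 0.
      have hw : 3 * constantCoeff b - 2 * constantCoeff c = 0 := by
        rcases eq_or_ne N k with hNk | hNk
        · have hk' : coeff N (y ^ 3 - z ^ 2) = coeff N (y' ^ 3 - z' ^ 2) := by rw [hNk]; exact hk
          have e4 : (y ^ 3 - z ^ 2) - (y' ^ 3 - z' ^ 2) =
              (y ^ 2 + y * y' + y' ^ 2) * (y - y') - (z + z') * (z - z') := by ring
          have d4 := congrArg (coeff N) e4
          rw [map_sub, hk', sub_self, map_sub, hb, hc, coeff_mul_X_pow_mul,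
            coeff_mul_X_pow_mul] at d4
          simp only [map_add, map_mul, map_pow, h.constY, h'.constY, h.constZ, h'.constZ] at d4
          linear_combination -d4
        · have : ((N : ℂ) - k) * (3 * constantCoeff b - 2 * constantCoeff c) = 0 := by
            linear_combination d2 - d3
          rcases mul_eq_zero.mp this with h4 | h4
          · exact absurd (by exact_mod_cast sub_eq_zero.mp h4) hNk
          · exact h4
      have hyx : constantCoeff b = 2 * constantCoeff a := by
        have : (N : ℂ) * (constantCoeff b - 2 * constantCoeff a) = 0 := by
          linear_combination d2 / 3 - d1 / 6 + k / 6 * hw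
        rcases mul_eq_zero.mp this with h4 | h4
        · exact absurd h4 hN0
        · exact sub_eq_zero.mp h4
      have ha0 : constantCoeff a = 0 := by
        have : (N : ℂ) * constantCoeff a = 0 := by
          linear_combination d1 / 12 - k / 12 * hyx
        rcases mul_eq_zero.mp this with h4 | h4
        · exact absurd h4 hN0
        · exact h4
      have hb0 : constantCoeff b = 0 := by rw [hyx, ha0, mul_zero]
      have hc0 : constantCoeff c = 0 := by
        have : (2 : ℂ) * constantCoeff c = 0 := by linear_combination -hw + 3 * hb0
        simpa using this
      refine ⟨?_, ?_, ?_⟩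
      · rw [ha, pow_succ]; exact mul_dvd_mul_left _ (X_dvd_iff.mpr ha0)
      · rw [hb, pow_succ]; exact mul_dvd_mul_left _ (X_dvd_iff.mpr hb0)
      · rw [hc, pow_succ]; exact mul_dvd_mul_left _ (X_dvd_iff.mpr hc0)
  have fin : ∀ {p p' : ℂ⟦X⟧}, (∀ n, (X : ℂ⟦X⟧) ^ (n + 1) ∣ p - p') → p = p' := by
    intro p p' hp
    rw [← sub_eq_zero]
    ext n
    exact X_pow_dvd_iff.mp (hp n) n (Nat.lt_succ_self n)
  exact ⟨fin fun n => (key n).1, fin fun n => (key n).2.1, fin fun n => (key n).2.2⟩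

/-- `(T, G, Φ)` are formal expansions, in `q`, of a Hauptmodul `t`, of the square of a form `f` of
weight one with `L f = 0`, and of its logarithmic derivative. -/
structure IsSolution (A B l : ℤ) (T G Φ : ℂ⟦X⟧) : Prop where
  derivT : eulerDeriv T = T * (G * (1 - A * T + B * T ^ 2))
  derivG : eulerDeriv G = G * (2 * Φ)
  derivΦ : eulerDeriv Φ = Φ ^ 2 + G ^ 2 * (1 - A * T + B * T ^ 2) * (l * T - B * T ^ 2)
  exists_T : ∃ τ, T = X * τ ∧ constantCoeff τ = 1
  constG : constantCoeff G = 1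
  constΦ : constantCoeff Φ = 0

/-! ### Formal solutions by X-adic contraction -/

section Existence

/-- Congruence of power series modulo `X ^ n`. -/
def CongX (n : ℕ) (p r : ℂ⟦X⟧) : Prop := (X : ℂ⟦X⟧) ^ n ∣ p - r

theorem CongX.refl (n : ℕ) (p : ℂ⟦X⟧) : CongX n p p := by simp [CongX]

theorem CongX.add {n : ℕ} {p r p' r' : ℂ⟦X⟧} (h : CongX n p r) (h' : CongX n p' r') :
    CongX n (p + p') (r + r') := by
  unfold CongX at *
  convert! dvd_add h h' using 1
  ring

theorem CongX.sub {n : ℕ} {p r p' r' : ℂ⟦X⟧} (h : CongX n p r) (h' : CongX n p' r') :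
    CongX n (p - p') (r - r') := by
  unfold CongX at *
  convert! dvd_sub h h' using 1
  ring

theorem CongX.trans {n : ℕ} {p r s : ℂ⟦X⟧} (h : CongX n p r) (h' : CongX n r s) :
    CongX n p s := by
  unfold CongX at *
  convert! dvd_add h h' using 1
  ring

theorem CongX.symm {n : ℕ} {p r : ℂ⟦X⟧} (h : CongX n p r) : CongX n r p := by
  unfold CongX at *
  rwa [← dvd_neg, neg_sub]

theorem CongX.mul {n : ℕ} {p r p' r' : ℂ⟦X⟧} (h : CongX n p r) (h' : CongX n p' r') :
    CongX n (p * p') (r * r') := by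
  unfold CongX at *
  convert! dvd_add (Dvd.dvd.mul_right h p') (Dvd.dvd.mul_left h' r) using 1
  ring

theorem CongX.pow {n : ℕ} {p r : ℂ⟦X⟧} (h : CongX n p r) (m : ℕ) :
    CongX n (p ^ m) (r ^ m) := by
  induction m with
  | zero => simpa using CongX.refl n 1
  | succ m ih => rw [pow_succ, pow_succ]; exact ih.mul h

theorem CongX.X_mul {n : ℕ} {p r : ℂ⟦X⟧} (h : CongX n p r) : CongX (n + 1) (X * p) (X * r) := by
  unfold CongX at *
  rw [← mul_sub, pow_succ']
  exact mul_dvd_mul_left _ h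

theorem CongX.mono {n m : ℕ} {p r : ℂ⟦X⟧} (h : CongX n p r) (hm : m ≤ n) : CongX m p r :=
  (pow_dvd_pow _ hm).trans h

theorem eq_of_forall_congX {p r : ℂ⟦X⟧} (h : ∀ n, CongX (n + 1) p r) : p = r := by
  rw [← sub_eq_zero]
  ext n
  exact X_pow_dvd_iff.mp (h n) n (Nat.lt_succ_self n)

/-- Contractions for the `X`-adic topology have fixed points. -/
theorem exists_fixedPoint_of_congX {ι : Type*} (Ψ : (ι → ℂ⟦X⟧) → ι → ℂ⟦X⟧)
    (h : ∀ n s s', (∀ i, CongX n (s i) (s' i)) → ∀ i, CongX (n + 1) (Ψ s i) (Ψ s' i)) :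
    ∃ s, Ψ s = s := by
  set u : ℕ → ι → ℂ⟦X⟧ := fun n => Ψ^[n] 0 with hu
  have hu1 : ∀ n, u (n + 1) = Ψ (u n) := fun n => Function.iterate_succ_apply' Ψ n 0
  have step : ∀ n i, CongX n (u (n + 1) i) (u n i) := by
    intro n
    induction n with
    | zero => intro i; simp [CongX]
    | succ n ih => rw [hu1 (n + 1), hu1 n]; exact h n _ _ (by rw [← hu1 n]; exact ih)
  have far : ∀ n m i, CongX n (u (n + m) i) (u n i) := by
    intro n m i
    induction m with
    | zero => exact CongX.refl _ _
    | succ m ih => exact ((step (n + m) i).mono (by omega)).trans ih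
  set s : ι → ℂ⟦X⟧ := fun i => PowerSeries.mk fun n => coeff n (u (n + 1) i) with hs
  have lim : ∀ n i, CongX n (s i) (u n i) := by
    intro n i
    refine X_pow_dvd_iff.mpr fun m hm => ?_
    obtain ⟨k, rfl⟩ : ∃ k, n = m + 1 + k := ⟨n - (m + 1), by omega⟩
    have := X_pow_dvd_iff.mp (far (m + 1) k i) m (Nat.lt_succ_self m)
    rw [map_sub, sub_eq_zero] at this ⊢
    rw [hs, coeff_mk, this]
  refine ⟨s, funext fun i => eq_of_forall_congX fun n => ?_⟩
  exact ((h n _ _ (lim n) i).trans (hu1 n ▸ CongX.refl _ _)).trans (lim (n + 1) i).symm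

/-- The inverse of the operator `1 + ϑ`. -/
noncomputable def shiftedPrimitive (p : ℂ⟦X⟧) : ℂ⟦X⟧ :=
  PowerSeries.mk fun n => coeff n p / (n + 1)

theorem eulerDeriv_X_mul_shiftedPrimitive (p : ℂ⟦X⟧) :
    eulerDeriv (X * shiftedPrimitive p) = X * p := by
  ext n
  rw [coeff_eulerDeriv]
  cases n with
  | zero => simp
  | succ n =>
    rw [coeff_succ_X_mul, coeff_succ_X_mul, shiftedPrimitive, coeff_mk]
    have : (n : ℂ) + 1 ≠ 0 := by exact_mod_cast Nat.succ_ne_zero n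
    push_cast
    field_simp

theorem CongX.shiftedPrimitive {n : ℕ} {p r : ℂ⟦X⟧} (h : CongX n p r) :
    CongX n (shiftedPrimitive p) (shiftedPrimitive r) := by
  refine X_pow_dvd_iff.mpr fun m hm => ?_
  have := X_pow_dvd_iff.mp h m hm
  rw [map_sub, sub_eq_zero] at this ⊢
  simp only [BeauvilleFamily.shiftedPrimitive, coeff_mk, this]

theorem eulerDeriv_X : eulerDeriv (X : ℂ⟦X⟧) = X := by
  ext n
  rw [coeff_eulerDeriv, coeff_X]
  split_ifs with h <;> simp [h]

/-- Put T = Xτ, G = 1 + Xγ, Φ = Xψ and invert 1 + ϑ to get a fixed-point equation for (τ, ψ, γ). The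
right side for ψ contains τ without a factor X, and that for γ contains ψ likewise. Feeding the
updated τ and ψ into the later components gains the missing order and makes the map contract. -/
theorem exists_isSolution (A B l : ℤ) : ∃ T G Φ, IsSolution A B l T G Φ := by
  let P : ℂ⟦X⟧ → ℂ⟦X⟧ := fun τ => 1 - (A : ℂ⟦X⟧) * (X * τ) + (B : ℂ⟦X⟧) * (X * τ) ^ 2
  let t' : (Fin 3 → ℂ⟦X⟧) → ℂ⟦X⟧ := fun s =>
    1 + X * shiftedPrimitive (s 0 * (s 2 * P (s 0) - (A : ℂ⟦X⟧) * s 0 + (B : ℂ⟦X⟧) * X * s 0 ^ 2))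
  let p' : (Fin 3 → ℂ⟦X⟧) → ℂ⟦X⟧ := fun s =>
    shiftedPrimitive (X * s 1 ^ 2 +
      (1 + X * s 2) ^ 2 * P (t' s) * ((l : ℂ⟦X⟧) * t' s - (B : ℂ⟦X⟧) * X * t' s ^ 2))
  let g' : (Fin 3 → ℂ⟦X⟧) → ℂ⟦X⟧ := fun s => shiftedPrimitive (2 * p' s * (1 + X * s 2))
  have hP : ∀ n τ τ', CongX n τ τ' → CongX n (P τ) (P τ') := fun n τ τ' h =>
    ((CongX.refl n 1).sub ((CongX.refl n _).mul ((CongX.refl n X).mul h))).add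
      ((CongX.refl n _).mul (((CongX.refl n X).mul h).pow 2))
  have ht : ∀ n s s', (∀ i, CongX n (s i) (s' i)) → CongX (n + 1) (t' s) (t' s') := fun n s s' h =>
    (CongX.refl _ 1).add (((h 0).mul ((((h 2).mul (hP n _ _ (h 0))).sub
      ((CongX.refl n _).mul (h 0))).add ((CongX.refl n _).mul
          ((h 0).pow 2)))).shiftedPrimitive.X_mul)
  have hg0 : ∀ n (s s' : Fin 3 → ℂ⟦X⟧), (∀ i, CongX n (s i) (s' i)) →
      CongX (n + 1) (1 + X * s 2) (1 + X * s' 2) := fun n s s' h => (CongX.refl _ 1).add (h 2).X_mul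
  have hp : ∀ n s s', (∀ i, CongX n (s i) (s' i)) → CongX (n + 1) (p' s) (p' s') := fun n s s' h =>
    ((((h 1).pow 2).X_mul).add ((((hg0 n s s' h).pow 2).mul (hP _ _ _ (ht n s s' h))).mul
      (((CongX.refl _ _).mul (ht n s s' h)).sub
        ((CongX.refl _ _).mul ((ht n s s' h).pow 2))))).shiftedPrimitive
  have hg : ∀ n s s', (∀ i, CongX n (s i) (s' i)) → CongX (n + 1) (g' s) (g' s') := fun n s s' h =>
    (((CongX.refl _ 2).mul (hp n s s' h)).mul (hg0 n s s' h)).shiftedPrimitive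
  obtain ⟨s, hs⟩ := exists_fixedPoint_of_congX (fun s => ![t' s, p' s, g' s]) (by
    intro n s s' h i
    fin_cases i
    · exact ht n s s' h
    · exact hp n s s' h
    · exact hg n s s' h)
  have h0 : t' s = s 0 := congrFun hs 0
  have h1 : p' s = s 1 := congrFun hs 1
  have h2 : g' s = s 2 := congrFun hs 2
  have hτ : eulerDeriv (s 0) = 
      X * (s 0 * (s 2 * P (s 0) - (A : ℂ⟦X⟧) * s 0 + (B : ℂ⟦X⟧) * X * s 0 ^ 2)) := by
    conv_lhs => rw [← h0]
    simp only [t', map_add, Derivation.map_one_eq_zero, zero_add, eulerDeriv_X_mul_shiftedPrimitive]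
  have hφ : eulerDeriv (X * s 1) = X * (X * s 1 ^ 2 +
      (1 + X * s 2) ^ 2 * P (s 0) * ((l : ℂ⟦X⟧) * s 0 - (B : ℂ⟦X⟧) * X * s 0 ^ 2)) := by
    conv_lhs => rw [← h1]
    simp only [p', eulerDeriv_X_mul_shiftedPrimitive, h0]
  have hγ : eulerDeriv (X * s 2) = X * (2 * s 1 * (1 + X * s 2)) := by
    conv_lhs => rw [← h2]
    simp only [g', eulerDeriv_X_mul_shiftedPrimitive, h1]
  refine ⟨X * s 0, 1 + X * s 2, X * s 1, ?_, ?_, ?_, ⟨s 0, rfl, ?_⟩, by simp, by simp⟩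
  · rw [eulerDeriv_mul, eulerDeriv_X, hτ]
    simp only [P]
    ring
  · rw [map_add, Derivation.map_one_eq_zero, zero_add, hγ]
    ring
  · rw [hφ]
    simp only [P]
    ring
  · rw [← h0]
    simp [t']

end Existence

/-! ### Eisenstein series as polynomials in a formal solution -/

section Certificate

/-- Polynomial data expressing `E₂, E₄, E₆` at `c q ^ k` through a solution `(T, G, Φ)`. -/
structure IsCertificate (A B l : ℤ) (k : ℕ) (c : ℂ) (p a b d : Polynomial ℂ) : Prop where
  derivX : 144 * (1 - (A : Polynomial ℂ) * Polynomial.X + (B : Polynomial ℂ) * Polynomial.X ^ 2) *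
      ((l : Polynomial ℂ) * Polynomial.X - (B : Polynomial ℂ) * Polynomial.X ^ 2) +
    12 * Polynomial.X * (1 - (A : Polynomial ℂ) * Polynomial.X + (B : Polynomial ℂ) *
        Polynomial.X ^ 2) * Polynomial.derivative p = p ^ 2 - (k : Polynomial ℂ) ^ 2 * a
  derivY : 3 * Polynomial.X * (1 - (A : Polynomial ℂ) * Polynomial.X + (B : Polynomial ℂ) *
      Polynomial.X ^ 2) * Polynomial.derivative a = p * a - (k : Polynomial ℂ) * b
  derivZ : 2 * Polynomial.X * (1 - (A : Polynomial ℂ) * Polynomial.X + (B : Polynomial ℂ) *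
      Polynomial.X ^ 2) * Polynomial.derivative b = p * b - (k : Polynomial ℂ) * a ^ 2
  disc : a ^ 3 - b ^ 2 = 1728 * Polynomial.C c * Polynomial.X ^ k * d
  evalP : p.eval 0 = k
  evalA : a.eval 0 = 1
  evalB : b.eval 0 = 1
  evalD : d.eval 0 = 1

theorem constantCoeff_aeval {T : ℂ⟦X⟧} (hT : constantCoeff T = 0) (p : Polynomial ℂ) :
    constantCoeff (Polynomial.aeval T p) = p.eval 0 := by
  rw [Polynomial.aeval_def, Polynomial.hom_eval₂, hT, Polynomial.eval₂_eq_eval_map]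
  congr 1
  convert! Polynomial.map_id

/-- The first three certificate identities say that (12Φ + G p(T))/k, G² a(T), G³ b(T) solve
Ramanujan's equations of index k. So do E₂, E₄, E₆ at c q^k. Both discriminants have coefficient
1728c at q^k, so uniqueness applies. -/
theorem IsSolution.eisenstein {A B l : ℤ} {T G Φ x y z : ℂ⟦X⟧} (h : IsSolution A B l T G Φ)
    (hE : IsRamanujan 1 x y z) (hE1 : coeff 1 (y ^ 3 - z ^ 2) = 1728) {k : ℕ} (hk : k ≠ 0) {c : ℂ}
    {p a b d : Polynomial ℂ} (hc : IsCertificate A B l k c p a b d) :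
    k * expand k hk (rescale c x) = 12 * Φ + G * Polynomial.aeval T p := by
  obtain ⟨τ, hTτ, hτ⟩ := h.exists_T
  have hT0 : constantCoeff T = 0 := by simp [hTτ]
  have hk0 : (k : ℂ) ≠ 0 := Nat.cast_ne_zero.mpr hk
  set K : ℂ⟦X⟧ := C (1 / (k : ℂ)) with hK
  have hKk : K * (k : ℂ⟦X⟧) = 1 := by
    rw [hK, ← map_natCast (C (R := ℂ)), ← map_mul, one_div_mul_cancel hk0, map_one]
  have hKd : eulerDeriv K = 0 := by
    ext n
    rw [coeff_eulerDeriv, hK, coeff_C]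
    split_ifs with h <;> simp [h]
  set p' := Polynomial.aeval T p with hp'
  set a' := Polynomial.aeval T a with ha'
  set b' := Polynomial.aeval T b with hb'
  have q1 := congrArg (Polynomial.aeval T) hc.derivX
  have q2 := congrArg (Polynomial.aeval T) hc.derivY
  have q3 := congrArg (Polynomial.aeval T) hc.derivZ
  have q4 := congrArg (Polynomial.aeval T) hc.disc
  simp only [map_mul, map_add, map_sub, map_pow, map_ofNat, map_one, map_intCast, map_natCast,
    Polynomial.aeval_X, Polynomial.aeval_C, ← hp', ← ha', ← hb'] at q1 q2 q3 q4
  have s1 := eulerDeriv_aeval T p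
  have s2 := eulerDeriv_aeval T a
  have s3 := eulerDeriv_aeval T b
  rw [← hp', h.derivT] at s1
  rw [← ha', h.derivT] at s2
  rw [← hb', h.derivT] at s3
  have R1 : IsRamanujan k (K * (12 * Φ + G * p')) (G ^ 2 * a') (G ^ 3 * b') := by
    refine ⟨?_, ?_, ?_, ?_, ?_, ?_⟩
    · rw [map_mul, map_add, map_mul, map_mul, h.constΦ, h.constG, constantCoeff_aeval hT0,
        hc.evalP]
      simp [hK, hk0]
    · rw [map_mul, map_pow, h.constG, constantCoeff_aeval hT0, hc.evalA]; simp
    · rw [map_mul, map_pow, h.constG, constantCoeff_aeval hT0, hc.evalB]; simp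
    · have : eulerDeriv (12 : ℂ⟦X⟧) = 0 := by
        rw [← map_ofNat (algebraMap ℂ ℂ⟦X⟧)]; exact Derivation.map_algebraMap _ _
      rw [eulerDeriv_mul, hKd, map_add, eulerDeriv_mul 12, this, eulerDeriv_mul G, h.derivΦ, s1,
        h.derivG]
      linear_combination G ^ 2 * K * q1 - (K * (12 * Φ + G * p') ^ 2 + k * G ^ 2 * a') * hKk
    · rw [eulerDeriv_mul, eulerDeriv_pow, h.derivG, s2]
      linear_combination G ^ 3 * q2 - (12 * G ^ 2 * Φ * a' + G ^ 3 * a' * p') * hKk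
    · rw [eulerDeriv_mul, eulerDeriv_pow, h.derivG, s3]
      linear_combination G ^ 4 * q3 - (12 * G ^ 3 * Φ * b' + G ^ 4 * b' * p') * hKk
  have R2 := (hE.rescale c).expand k hk
  rw [mul_one] at R2
  have key := (R2.unique R1 ?_).1
  · rw [key]
    linear_combination (12 * Φ + G * p') * hKk
  · have e1 : coeff k ((G ^ 2 * a') ^ 3 - (G ^ 3 * b') ^ 2) = 1728 * c := by
      -- Since T = Xτ, the factor T^k isolates X^k, and the coefficient is read off from constant
      -- terms.
      have : (G ^ 2 * a') ^ 3 - (G ^ 3 * b') ^ 2 =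
          (1728 * C c * G ^ 6) * (X ^ k * (τ ^ k * Polynomial.aeval T d)) := by
        rw [← mul_assoc (X ^ k), ← mul_pow, ← hTτ]
        have hCc : algebraMap ℂ ℂ⟦X⟧ c = C c := rfl
        rw [hCc] at q4
        linear_combination G ^ 6 * q4
      rw [this, coeff_mul_X_pow_mul]
      simp only [map_mul, map_pow, map_ofNat, h.constG, hτ, constantCoeff_aeval hT0, hc.evalD,
        constantCoeff_C]
      ring
    have e2 : coeff k (expand k hk (rescale c y) ^ 3 - expand k hk (rescale c z) ^ 2) =
        1728 * c := by
      have := coeff_expand_mul k hk (rescale c (y ^ 3 - z ^ 2)) 1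
      rw [mul_one, coeff_rescale, hE1] at this
      simp only [map_sub, map_pow] at this ⊢
      rw [this]
      ring
    rw [e1, e2]

end Certificate

end BeauvilleFamily

/-! ### Analytic functions on the unit disc and their power series -/

namespace BeauvilleFamily

open PowerSeries Metric

/-- `h` is represented on the open unit disc by the power series `p`. -/
def HasDiskSeries (h : ℂ → ℂ) (p : ℂ⟦X⟧) : Prop :=
  ∀ q : ℂ, ‖q‖ < 1 → HasSum (fun n => coeff n p * q ^ n) (h q)

namespace HasDiskSeries

variable {h h' : ℂ → ℂ} {p p' : ℂ⟦X⟧}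

theorem congr (H : HasDiskSeries h p) (hh : ∀ q, ‖q‖ < 1 → h q = h' q) : HasDiskSeries h' p :=
  fun q hq => hh q hq ▸ H q hq

theorem eq (H : HasDiskSeries h p) (H' : HasDiskSeries h' p) {q : ℂ} (hq : ‖q‖ < 1) :
    h q = h' q := (H q hq).unique (H' q hq)

theorem of_differentiableOn (H : DifferentiableOn ℂ h (ball 0 1)) :
    HasDiskSeries h (PowerSeries.mk fun n => (n.factorial : ℂ)⁻¹ * iteratedDeriv n h 0) := by
  intro q hq
  convert! Complex.hasSum_taylorSeries_on_ball H (z := q) (by simpa using hq) using 2 with n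
  rw [coeff_mk, sub_zero, smul_eq_mul, smul_eq_mul]
  ring

theorem hasFPowerSeriesOnBall (H : HasDiskSeries h p) :
    HasFPowerSeriesOnBall h (.ofScalars ℂ fun n => coeff n p) 0 1 := by
  refine ⟨?_, one_pos, ?_⟩
  · refine le_of_forall_lt_imp_le_of_dense fun r hr ↦ ?_
    lift r to NNReal using hr.ne_top
    apply FormalMultilinearSeries.le_radius_of_summable
    have hr1 : (r : ℝ) < 1 := by exact_mod_cast hr
    have := (H (r : ℂ) (by simpa using hr1)).summable.norm
    simpa [FormalMultilinearSeries.ofScalars_norm] using this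
  · intro y hy
    rw [← ENNReal.coe_one, Metric.eball_coe, NNReal.coe_one, mem_ball_zero_iff] at hy
    simpa [FormalMultilinearSeries.ofScalars_apply_eq, mul_comm] using H y hy

theorem differentiableOn (H : HasDiskSeries h p) : DifferentiableOn ℂ h (ball 0 1) := by
  have := H.hasFPowerSeriesOnBall.differentiableOn
  rwa [← ENNReal.ofReal_one, Metric.eball_ofReal] at this

theorem differentiableAt (H : HasDiskSeries h p) {q : ℂ} (hq : ‖q‖ < 1) :
    DifferentiableAt ℂ h q :=
  H.differentiableOn.differentiableAt (isOpen_ball.mem_nhds (by simpa using hq))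

/-- Agreement off q = 0 is enough, by continuity. This matters because every nonzero q, but not q =
0, comes from a point of the upper half-plane. -/
theorem unique (H : HasDiskSeries h p) (H' : HasDiskSeries h' p')
    (hh : ∀ q, q ≠ 0 → ‖q‖ < 1 → h q = h' q) : p = p' := by
  have h0 : ∀ᶠ q in nhds (0 : ℂ), h q = h' q := by
    have c1 := (H.differentiableAt (q := 0) (by simp)).continuousAt
    have c2 := (H'.differentiableAt (q := 0) (by simp)).continuousAt
    have hev : h =ᶠ[nhdsWithin 0 {0}ᶜ] h' := by
      filter_upwards [self_mem_nhdsWithin,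
        mem_nhdsWithin_of_mem_nhds (ball_mem_nhds (0 : ℂ) one_pos)] with q hq1 hq2
      exact hh q hq1 (by simpa using hq2)
    exact (c1.eventuallyEq_nhds_iff_eventuallyEq_nhdsNE c2).mp hev
  have := (H.hasFPowerSeriesOnBall.hasFPowerSeriesAt.congr h0).eq_formalMultilinearSeries
    H'.hasFPowerSeriesOnBall.hasFPowerSeriesAt
  ext n
  simpa [FormalMultilinearSeries.coeff_ofScalars] using
    congr_arg (FormalMultilinearSeries.coeff · n) this

theorem constant (c : ℂ) : HasDiskSeries (fun _ => c) (C c) := by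
  intro q _
  convert! hasSum_ite_eq (0 : ℕ) c using 2 with n
  rw [coeff_C]
  split_ifs with h <;> simp [h]

theorem id : HasDiskSeries (fun q => q) X := by
  intro q _
  convert! hasSum_ite_eq (1 : ℕ) q using 2 with n
  rw [coeff_X]
  split_ifs with h <;> simp [h]

theorem add (H : HasDiskSeries h p) (H' : HasDiskSeries h' p') :
    HasDiskSeries (fun q => h q + h' q) (p + p') := by
  intro q hq
  simpa [add_mul] using (H q hq).add (H' q hq)

theorem const_mul (c : ℂ) (H : HasDiskSeries h p) :
    HasDiskSeries (fun q => c * h q) (C c * p) := by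
  intro q hq
  simpa [mul_assoc] using (H q hq).mul_left c

theorem sub (H : HasDiskSeries h p) (H' : HasDiskSeries h' p') :
    HasDiskSeries (fun q => h q - h' q) (p - p') := by
  intro q hq
  simpa [sub_mul] using (H q hq).sub (H' q hq)

theorem mul (H : HasDiskSeries h p) (H' : HasDiskSeries h' p') :
    HasDiskSeries (fun q => h q * h' q) (p * p') := by
  intro q hq
  have s1 := (H q hq).summable.norm
  have s2 := (H' q hq).summable.norm
  have s3 := (summable_norm_sum_mul_antidiagonal_of_summable_norm s1 s2).of_norm.hasSum
  rw [← tsum_mul_tsum_eq_tsum_sum_antidiagonal_of_summable_norm s1 s2, (H q hq).tsum_eq,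
    (H' q hq).tsum_eq] at s3
  convert! s3 using 2 with n
  rw [coeff_mul, Finset.sum_mul]
  refine Finset.sum_congr rfl fun x hx => ?_
  rw [← Finset.HasAntidiagonal.mem_antidiagonal.mp hx, pow_add]
  ring

theorem pow (H : HasDiskSeries h p) (n : ℕ) : HasDiskSeries (fun q => h q ^ n) (p ^ n) := by
  induction n with
  | zero => simpa using constant 1
  | succ n ih => simpa only [pow_succ] using ih.mul H

theorem coeff_eq (H : HasDiskSeries h p) (n : ℕ) :
    coeff n p = (n.factorial : ℂ)⁻¹ * iteratedDeriv n h 0 := by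
  rw [H.unique (of_differentiableOn H.differentiableOn) fun _ _ _ => rfl, coeff_mk]

theorem apply_zero (H : HasDiskSeries h p) : h 0 = constantCoeff p := by
  simpa using (H.coeff_eq 0).symm

theorem eulerDeriv (H : HasDiskSeries h p) :
    HasDiskSeries (fun q => q * deriv h q) (eulerDeriv p) := by
  have H1 := id.mul (of_differentiableOn (H.differentiableOn.deriv isOpen_ball))
  convert! H1 using 1
  ext n
  rw [coeff_eulerDeriv]
  cases n with
  | zero => simp
  | succ n =>
    rw [coeff_succ_X_mul, coeff_mk, H.coeff_eq, iteratedDeriv_succ', Nat.factorial_succ]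
    have : (n : ℂ) + 1 ≠ 0 := by exact_mod_cast Nat.succ_ne_zero n
    have := Nat.factorial_ne_zero n
    push_cast
    field_simp

theorem expand (H : HasDiskSeries h p) (k : ℕ) (hk : k ≠ 0) :
    HasDiskSeries (fun q => h (q ^ k)) (expand k hk p) := by
  intro q hq
  have H1 := H (q ^ k) (by rw [norm_pow]; exact pow_lt_one₀ (norm_nonneg _) hq hk)
  have hi : Function.Injective fun n : ℕ => k * n :=
    fun a b hab => Nat.eq_of_mul_eq_mul_left (Nat.pos_of_ne_zero hk) hab
  rw [← hi.hasSum_iff]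
  · convert! H1 using 2 with n
    simp [coeff_expand_mul, pow_mul]
  · intro n hn
    rw [coeff_expand_of_not_dvd, zero_mul]
    rintro ⟨m, rfl⟩
    exact hn ⟨m, rfl⟩

end HasDiskSeries

end BeauvilleFamily

/-! ### q-expansions and Ramanujan's identities for E₂, E₄, E₆ -/

namespace BeauvilleFamily

open PowerSeries UpperHalfPlane ModularForm EisensteinSeries Derivative MatrixGroups Filter
open scoped Manifold Real Topology

/-- `f` has the `q`-expansion `p`. -/
def HasQSeries (f : ℍ → ℂ) (p : ℂ⟦X⟧) : Prop :=
  ∀ τ : ℍ, HasSum (fun n => coeff n p * Function.Periodic.qParam 1 τ ^ n) (f τ)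

namespace HasQSeries

variable {f g : ℍ → ℂ} {p r : ℂ⟦X⟧}

theorem norm_qParam_lt (τ : ℍ) : ‖Function.Periodic.qParam 1 (τ : ℂ)‖ < 1 :=
  Function.Periodic.norm_qParam_lt_one one_pos τ.im_pos

theorem exists_qParam {q : ℂ} (hq : q ≠ 0) (hq1 : ‖q‖ < 1) :
    ∃ τ : ℍ, Function.Periodic.qParam 1 (τ : ℂ) = q :=
  ⟨⟨Function.Periodic.invQParam 1 q,
    Function.Periodic.im_invQParam_pos_of_norm_lt_one one_pos hq1 hq⟩,
    Function.Periodic.qParam_right_inv one_ne_zero hq⟩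

theorem of_disk {h : ℂ → ℂ} (H : HasDiskSeries h p)
    (hf : ∀ τ : ℍ, f τ = h (Function.Periodic.qParam 1 τ)) : HasQSeries f p :=
  fun τ => hf τ ▸ H _ (norm_qParam_lt τ)

/-- Each nonzero q in the disc is exp(2πiτ) for some τ in the upper half-plane, so convergence there
gives convergence on the whole disc. -/
theorem exists_disk (H : HasQSeries f p) :
    ∃ h, HasDiskSeries h p ∧ ∀ τ : ℍ, f τ = h (Function.Periodic.qParam 1 τ) := by
  refine ⟨fun q => ∑' n, coeff n p * q ^ n, fun q hq => Summable.hasSum ?_,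
    fun τ => (H τ).tsum_eq.symm⟩
  rcases eq_or_ne q 0 with rfl | h0
  · exact summable_of_ne_finset_zero (s := {0}) fun n hn => by
      rw [zero_pow (by simpa using hn), mul_zero]
  · obtain ⟨τ, rfl⟩ := exists_qParam h0 hq
    exact (H τ).summable

theorem unique (H : HasQSeries f p) (H' : HasQSeries f r) : p = r := by
  obtain ⟨h, hh, e⟩ := H.exists_disk
  obtain ⟨h', hh', e'⟩ := H'.exists_disk
  refine hh.unique hh' fun q h0 h1 => ?_
  obtain ⟨τ, rfl⟩ := exists_qParam h0 h1
  rw [← e, ← e']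

theorem mul (H : HasQSeries f p) (H' : HasQSeries g r) : HasQSeries (f * g) (p * r) := by
  obtain ⟨h, hh, e⟩ := H.exists_disk
  obtain ⟨h', hh', e'⟩ := H'.exists_disk
  exact of_disk (hh.mul hh') fun τ => by rw [Pi.mul_apply, e, e']

theorem sub (H : HasQSeries f p) (H' : HasQSeries g r) : HasQSeries (f - g) (p - r) := by
  intro τ
  simpa [sub_mul] using (H τ).sub (H' τ)

theorem const_smul (c : ℂ) (H : HasQSeries f p) : HasQSeries (c • f) (C c * p) := by
  intro τ
  simpa [mul_assoc] using (H τ).mul_left c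

theorem hasDerivAt_qParam (z : ℂ) : HasDerivAt (Function.Periodic.qParam 1)
    (2 * π * Complex.I * Function.Periodic.qParam 1 z) z := by
  have h1 : Function.Periodic.qParam 1 = fun z => Complex.exp (2 * π * Complex.I * z) := by
    ext z; simp [Function.Periodic.qParam]
  rw [h1]
  have := ((hasDerivAt_id z).const_mul (2 * π * Complex.I)).cexp
  simpa [mul_comm] using this

theorem normalizedDeriv (H : HasQSeries f p) :
    HasQSeries (normalizedDerivOfComplex f) (eulerDeriv p) := by
  obtain ⟨h, hh, e⟩ := H.exists_disk
  refine of_disk hh.eulerDeriv fun τ => ?_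
  have h1 : (f ∘ ofComplex) =ᶠ[𝓝 (τ : ℂ)] h ∘ Function.Periodic.qParam 1 := by
    filter_upwards [isOpen_upperHalfPlaneSet.mem_nhds τ.im_pos] with w hw
    rw [Function.comp_apply, Function.comp_apply, e, ofComplex_apply_of_im_pos hw]
  rw [normalizedDerivOfComplex, h1.deriv_eq,
    ((hh.differentiableAt (norm_qParam_lt τ)).hasDerivAt.comp (τ : ℂ)
      (hasDerivAt_qParam τ)).deriv]
  have := Complex.two_pi_I_ne_zero
  field_simp

end HasQSeries

/-- The `q`-expansion of `E₂`. -/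
noncomputable def seriesE2 : ℂ⟦X⟧ :=
  PowerSeries.mk fun n => if n = 0 then 1 else -24 * (ArithmeticFunction.sigma 1 n : ℂ)

theorem hasQSeries_E2 : HasQSeries E2 seriesE2 := by
  intro τ
  have := EisensteinSeries.hasSum_qExpansion_E2 (z := τ)
  simpa [seriesE2, Function.Periodic.qParam] using this

theorem hasQSeries_modularForm {k : ℤ} (F : ModularForm 𝒮ℒ k) :
    HasQSeries F (qExpansion 1 F) := by
  intro τ
  exact ModularForm.hasSum_qExpansion (f := F) one_pos one_mem_strictPeriods_SL τ

/-- A level one form built from a slash-invariant holomorphic function with a `q`-expansion. -/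
noncomputable def levelOneForm {k : ℤ} (f : ℍ → ℂ) (hf : MDiff f)
    (hs : ∀ γ : SL(2, ℤ), f ∣[k] γ = f) {p : ℂ⟦X⟧} (hp : HasQSeries f p) : ModularForm 𝒮ℒ k where
  toFun := f
  slash_action_eq' := fun _ ⟨γ, hγ⟩ => hγ ▸ hs γ
  holo' := hf
  bdd_at_cusps' {c} hc := by
    rw [Subgroup.IsArithmetic.isCusp_iff_isCusp_SL2Z] at hc
    rw [OnePoint.isBoundedAt_iff_forall_SL2Z hc]
    intro γ _
    rw [hs γ]
    exact isBoundedAtImInfty_of_hasSum_qExpansion one_pos hp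

/-- Reduces an identity of level one forms to a comparison of constant terms, once the space is
known to be a line. -/
theorem eq_const_mul_of_rank_one {k : ℤ} (hk : Module.rank ℂ (ModularForm 𝒮ℒ k) = 1)
    (F : ModularForm 𝒮ℒ k) (hF : constantCoeff (qExpansion 1 F) = 1) {f : ℍ → ℂ} (hf : MDiff f)
    (hs : ∀ γ : SL(2, ℤ), f ∣[k] γ = f) {p : ℂ⟦X⟧} (hp : HasQSeries f p) :
    p = C (constantCoeff p) * qExpansion 1 F := by
  have hF0 : F ≠ 0 := by
    rintro rfl
    have : qExpansion 1 ((0 : ModularForm 𝒮ℒ k) : ℍ → ℂ) = 0 := qExpansion_zero 1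
    rw [this] at hF
    simp at hF
  obtain ⟨c, hc⟩ := (finrank_eq_one_iff_of_nonzero' F hF0).mp
    (Module.rank_eq_one_iff_finrank_eq_one.mp hk) (levelOneForm f hf hs hp)
  have hfF : f = c • (F : ℍ → ℂ) := (congrArg DFunLike.coe hc).symm
  have h1 : p = C c * qExpansion 1 F :=
    hp.unique (hfF ▸ (hasQSeries_modularForm F).const_smul c)
  have h2 : constantCoeff p = c := by rw [h1, map_mul, hF, constantCoeff_C, mul_one]
  rw [h2]
  exact h1

theorem HasQSeries.serreDerivative {f : ℍ → ℂ} {p : ℂ⟦X⟧} (H : HasQSeries f p) (k : ℂ) :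
    HasQSeries (serreDerivative k f) (eulerDeriv p - C (k * 12⁻¹) * (seriesE2 * p)) := by
  have := H.normalizedDeriv.sub ((hasQSeries_E2.mul H).const_smul (k * 12⁻¹))
  convert! this using 1
  ext z
  simp [mul_assoc]

theorem slash_coe {k : ℤ} (F : ModularForm 𝒮ℒ k) (γ : SL(2, ℤ)) : (F : ℍ → ℂ) ∣[k] γ = F :=
  F.slash_action_eq' _ ⟨γ, rfl⟩

theorem constantCoeff_seriesE2 : constantCoeff seriesE2 = 1 := by
  rw [← coeff_zero_eq_constantCoeff_apply, seriesE2, coeff_mk, if_pos rfl]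

theorem constantCoeff_E₄ : constantCoeff (qExpansion 1 E₄) = 1 := by
  rw [← coeff_zero_eq_constantCoeff_apply]; exact E_qExpansion_coeff_zero _ ⟨2, rfl⟩

theorem constantCoeff_E₆ : constantCoeff (qExpansion 1 E₆) = 1 := by
  rw [← coeff_zero_eq_constantCoeff_apply]; exact E_qExpansion_coeff_zero _ ⟨3, rfl⟩

theorem constantCoeff_eulerDeriv (p : ℂ⟦X⟧) : constantCoeff (eulerDeriv p) = 0 := by
  rw [← coeff_zero_eq_constantCoeff_apply, coeff_eulerDeriv]; simp

/-- The analogue of the Serre derivative for `E₂`. -/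
theorem slash_E2_defect (γ : SL(2, ℤ)) :
    (normalizedDerivOfComplex E2 - (12⁻¹ : ℂ) • (E2 * E2)) ∣[(4 : ℤ)] γ =
      normalizedDerivOfComplex E2 - (12⁻¹ : ℂ) • (E2 * E2) := by
  have hE := E2_slash_action γ
  have hD := normalizedDerivOfComplex_SL_slash (k := 2) E2_mdifferentiable (γ := γ)
  have hM := ModularForm.mul_slash_SL2 2 2 γ E2 E2
  ext z
  have h1 : HasDerivAt (fun w : ℂ => denom γ w) (γ 1 0 : ℂ) (z : ℂ) := by
    have := ((hasDerivAt_id (z : ℂ)).const_mul (γ 1 0 : ℂ)).add_const (γ 1 1 : ℂ)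
    simpa [denom] using this
  have hj := (h1.fun_inv (denom_ne_zero γ z)).const_mul (2 * π * Complex.I * γ 1 0 : ℂ)
  -- Slashing E₂ produces a multiple of c/(cz + d). Differentiating this term yields the square that
  -- cancels against the one produced by E₂².
  have hd : normalizedDerivOfComplex (E2 ∣[(2 : ℤ)] γ) z = normalizedDerivOfComplex E2 z -
      (2 * π * Complex.I)⁻¹ * (1 / (2 * riemannZeta 2) *
        (2 * π * Complex.I * γ 1 0 * (-(γ 1 0) / denom γ z ^ 2))) := by
    rw [hE, normalizedDerivOfComplex, normalizedDerivOfComplex]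
    have h2 : ((E2 - (1 / (2 * riemannZeta 2)) • D2 γ) ∘ ofComplex) =ᶠ[𝓝 (z : ℂ)]
        fun w => (E2 ∘ ofComplex) w - 1 / (2 * riemannZeta 2) *
          ((2 * π * Complex.I * γ 1 0) * (denom γ w)⁻¹) := by
      filter_upwards [isOpen_upperHalfPlaneSet.mem_nhds z.im_pos] with w hw
      simp [D2, ofComplex_apply_of_im_pos hw, div_eq_mul_inv]
    have h3 := (UpperHalfPlane.mdifferentiableAt_iff.mp (E2_mdifferentiable z)).hasDerivAt
    rw [h2.deriv_eq, HasDerivAt.deriv (h3.fun_sub (hj.const_mul (1 / (2 * riemannZeta 2))))]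
    exact mul_sub _ _ _
  have e1 := congrFun hD z
  rw [hd] at e1
  have e2 := congrFun hE z
  have e3 := congrFun hM z
  simp only [Pi.sub_apply, Pi.smul_apply, Pi.mul_apply, smul_eq_mul, D2] at e1 e2 e3 ⊢
  rw [sub_eq_add_neg, ← _root_.neg_smul, SlashAction.add_slash, SL_smul_slash]
  simp only [Pi.add_apply, Pi.smul_apply, smul_eq_mul]
  rw [show (2 + 2 : ℤ) = 4 by norm_num] at e1 e3
  rw [e3, e2]
  rw [e2, eq_sub_iff_add_eq] at e1
  rw [← e1, riemannZeta_two]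
  have hpi : (π : ℂ) ≠ 0 := by exact_mod_cast Real.pi_ne_zero
  have hden := denom_ne_zero γ z
  have hI := Complex.I_ne_zero
  field_simp
  linear_combination (-72 * Complex.I * (γ 1 0 : ℂ) ^ 2 + 24 * π * denom γ z * (γ 1 0) * E2 z) *
    Complex.I_sq

/-- The Serre derivatives of E₄ and E₆, and ϑE₂ - E₂²/12, are level one forms of weight 6, 8 and 4.
Those spaces are lines spanned by E₆, E₄² and E₄, and the constant terms give the factors -1/3, -1/2
and -1/12. -/
theorem isRamanujan_eisenstein :
    IsRamanujan 1 seriesE2 (qExpansion 1 E₄) (qExpansion 1 E₆) := by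
  have h4 : HasQSeries E₄ (qExpansion 1 E₄) := hasQSeries_modularForm E₄
  have h6 : HasQSeries E₆ (qExpansion 1 E₆) := hasQSeries_modularForm E₆
  refine ⟨constantCoeff_seriesE2, constantCoeff_E₄, constantCoeff_E₆, ?_, ?_, ?_⟩
  · have hq := hasQSeries_E2.normalizedDeriv.sub ((hasQSeries_E2.mul hasQSeries_E2).const_smul 12⁻¹)
    have := eq_const_mul_of_rank_one levelOne_weight_four_rank_one E₄ constantCoeff_E₄
      ((normalizedDerivOfComplex_mdifferentiable E2_mdifferentiable).sub
        ((E2_mdifferentiable.mul E2_mdifferentiable).const_smul _)) slash_E2_defect hq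
    simp only [map_sub, map_mul, constantCoeff_eulerDeriv, constantCoeff_seriesE2,
        constantCoeff_C] at this
    have h := congrArg (C (12 : ℂ) * ·) this
    simp only [mul_sub, ← mul_assoc, ← map_mul] at h
    norm_num at h
    simp only [map_ofNat] at h
    push_cast
    linear_combination h
  · have := eq_const_mul_of_rank_one levelOne_weight_six_rank_one E₆ constantCoeff_E₆
      (serreDerivative_mdifferentiable ((4 : ℤ) : ℂ) E₄.holo')
      (fun γ => serreDerivative_slash_invariant (k := 4) E₄.holo' (slash_coe E₄ γ))
      (h4.serreDerivative _)
    simp only [map_sub, map_mul, constantCoeff_eulerDeriv, constantCoeff_seriesE2,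
        constantCoeff_E₄, constantCoeff_C] at this
    have h := congrArg (C (3 : ℂ) * ·) this
    simp only [mul_sub, ← mul_assoc, ← map_mul] at h
    norm_num at h
    simp only [map_ofNat] at h
    push_cast
    linear_combination h
  · have h8 : Module.rank ℂ (ModularForm 𝒮ℒ 8) = 1 := by
      have := dimension_level_one 8 ⟨4, rfl⟩
      simpa [Nat.ModEq] using this
    have hE8 : qExpansion 1 (ModularForm.mcast (show (4 + 4 : ℤ) = 8 by norm_num) (E₄.mul E₄)) =
        qExpansion 1 E₄ ^ 2 := by
      rw [ModularForm.qExpansion_mcast _ rfl,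
          ModularForm.qExpansion_mul one_pos one_mem_strictPeriods_SL, sq]
    have := eq_const_mul_of_rank_one h8 (ModularForm.mcast (show (4 + 4 : ℤ) =
        8 by norm_num) (E₄.mul E₄)) (by rw [hE8, map_pow, constantCoeff_E₄, one_pow])
      (serreDerivative_mdifferentiable ((6 : ℤ) : ℂ) E₆.holo')
      (fun γ => serreDerivative_slash_invariant (k := 6) E₆.holo' (slash_coe E₆ γ))
      (h6.serreDerivative _)
    simp only [map_sub, map_mul, constantCoeff_eulerDeriv, constantCoeff_seriesE2,
        constantCoeff_E₆, constantCoeff_C, hE8] at this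
    have h := congrArg (C (2 : ℂ) * ·) this
    simp only [mul_sub, ← mul_assoc, ← map_mul] at h
    norm_num at h
    simp only [map_ofNat] at h
    push_cast
    linear_combination h

theorem coeff_one_discriminant :
    coeff 1 (qExpansion 1 E₄ ^ 3 - qExpansion 1 E₆ ^ 2) = (1728 : ℂ) := by
  have h0 := constantCoeff_E₄
  have h0' := constantCoeff_E₆
  norm_num [pow_succ, PowerSeries.coeff_mul, Finset.Nat.antidiagonal_succ,
    E₄_qExpansion_coeff_one, E₆_qExpansion_coeff_one, h0, h0']

end BeauvilleFamily

/-! ### Explicit certificates for the six cases -/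

namespace BeauvilleFamily

open Polynomial

/-- Here and below the index after the case is k. The polynomials have degrees at most 2, 4 and 6
because E₂, E₄, E₆ have weights 2, 4, 6 and each power of G carries weight 2 and at most two powers
of T. Each field is a polynomial identity checked by expansion. -/
theorem isCertificate_A_1 : IsCertificate 7 (-8) 2 1 1
    (1 - 52 * X - 80 * X ^ 2)
    (1 + 232 * X + 960 * X ^ 2 + 256 * X ^ 3 + 256 * X ^ 4)
    (1 - 516 * X - 12072 * X ^ 2 - 24640 * X ^ 3 - 30720 * X ^ 4 + 6144 * X ^ 5 + 4096 * X ^ 6)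
    (1 - 45 * X + 819 * X ^ 2 - 7503 * X ^ 3 + 33552 * X ^ 4 - 42048 * X ^ 5 - 153600 * X ^ 6 +
        258048 * X ^ 7 + 589824 * X ^ 8 + 262144 * X ^ 9) := by
  constructor <;> simp [map_ofNat C] <;> ring

theorem isCertificate_A_2 : IsCertificate 7 (-8) 2 2 1
    (2 - 32 * X - 88 * X ^ 2)
    (1 - 8 * X + 240 * X ^ 2 - 464 * X ^ 3 + 16 * X ^ 4)
    (1 - 12 * X - 480 * X ^ 2 + 3080 * X ^ 3 - 12072 * X ^ 4 + 4128 * X ^ 5 + 64 * X ^ 6)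
    (1 - 18 * X + 63 * X ^ 2 + 300 * X ^ 3 - 657 * X ^ 4 - 4194 * X ^ 5 - 7503 * X ^ 6 - 6552 *
        X ^ 7 - 2880 * X ^ 8 - 512 * X ^ 9) := by
  constructor <;> simp [map_ofNat C] <;> ring

theorem isCertificate_A_3 : IsCertificate 7 (-8) 2 3 1
    (3 - 36 * X - 48 * X ^ 2)
    (1 - 8 * X + 256 * X ^ 3 + 256 * X ^ 4)
    (1 - 12 * X + 24 * X ^ 2 - 448 * X ^ 3 + 1536 * X ^ 4 + 6144 * X ^ 5 + 4096 * X ^ 6)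
    (1 - 15 * X + 48 * X ^ 2 + 64 * X ^ 3) := by
  constructor <;> simp [map_ofNat C] <;> ring

theorem isCertificate_A_6 : IsCertificate 7 (-8) 2 6 1
    (6 - 48 * X - 72 * X ^ 2)
    (1 - 8 * X + 16 * X ^ 3 + 16 * X ^ 4)
    (1 - 12 * X + 24 * X ^ 2 + 56 * X ^ 3 + 24 * X ^ 4 + 96 * X ^ 5 + 64 * X ^ 6)
    (1 - 6 * X - 15 * X ^ 2 - 8 * X ^ 3) := by
  constructor <;> simp [map_ofNat C] <;> ring

theorem isCertificate_C_1 : IsCertificate 10 9 3 1 1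
    (1 - 66 * X + 81 * X ^ 2)
    (1 + 228 * X + 270 * X ^ 2 - 972 * X ^ 3 + 729 * X ^ 4)
    (1 - 522 * X - 9477 * X ^ 2 + 18468 * X ^ 3 - 24057 * X ^ 4 + 39366 * X ^ 5 - 19683 * X ^ 6)
    (1 - 56 * X + 1324 * X ^ 2 - 17064 * X ^ 3 + 128790 * X ^ 4 - 565704 * X ^ 5 + 1338444 *
        X ^ 6 - 1417176 * X ^ 7 + 531441 * X ^ 8) := by
  constructor <;> simp [map_ofNat C] <;> ring

theorem isCertificate_C_2 : IsCertificate 10 9 3 2 1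
    (2 - 48 * X + 54 * X ^ 2)
    (1 - 12 * X + 270 * X ^ 2 - 972 * X ^ 3 + 729 * X ^ 4)
    (1 - 18 * X - 405 * X ^ 2 + 4860 * X ^ 3 - 24057 * X ^ 4 + 39366 * X ^ 5 - 19683 * X ^ 6)
    (1 - 28 * X + 270 * X ^ 2 - 972 * X ^ 3 + 729 * X ^ 4) := by
  constructor <;> simp [map_ofNat C] <;> ring

theorem isCertificate_C_3 : IsCertificate 10 9 3 3 1
    (3 - 54 * X + 99 * X ^ 2)
    (1 - 12 * X + 30 * X ^ 2 + 228 * X ^ 3 + 9 * X ^ 4)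
    (1 - 18 * X + 99 * X ^ 2 - 684 * X ^ 3 + 3159 * X ^ 4 + 1566 * X ^ 5 - 27 * X ^ 6)
    (1 - 24 * X + 204 * X ^ 2 - 776 * X ^ 3 + 1590 * X ^ 4 - 1896 * X ^ 5 + 1324 * X ^ 6 - 504 *
        X ^ 7 + 81 * X ^ 8) := by
  constructor <;> simp [map_ofNat C] <;> ring

theorem isCertificate_C_6 : IsCertificate 10 9 3 6 1
    (6 - 72 * X + 90 * X ^ 2)
    (1 - 12 * X + 30 * X ^ 2 - 12 * X ^ 3 + 9 * X ^ 4)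
    (1 - 18 * X + 99 * X ^ 2 - 180 * X ^ 3 + 135 * X ^ 4 + 54 * X ^ 5 - 27 * X ^ 6)
    (1 - 12 * X + 30 * X ^ 2 - 28 * X ^ 3 + 9 * X ^ 4) := by
  constructor <;> simp [map_ofNat C] <;> ring

/-- In case F the odd indices 1 and 3 use c = -1: it is E₂ at -q and at -q³ that is expressed
through T. -/
theorem isCertificate_F_1 : IsCertificate 17 72 6 1 (-1)
    (1 - 60 * X + 432 * X ^ 2)
    (1 - 264 * X + 6912 * X ^ 2 - 62208 * X ^ 3 + 186624 * X ^ 4)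
    (1 + 468 * X - 31752 * X ^ 2 + 730944 * X ^ 3 - 7838208 * X ^ 4 + 40310784 * X ^ 5 -
        80621568 * X ^ 6)
    (1 - 43 * X + 739 * X ^ 2 - 6345 * X ^ 3 + 27216 * X ^ 4 - 46656 * X ^ 5) := by
  constructor <;> simp [map_ofNat C] <;> ring

theorem isCertificate_F_2 : IsCertificate 17 72 6 2 1
    (2 - 96 * X + 648 * X ^ 2)
    (1 - 24 * X + 432 * X ^ 2 - 3888 * X ^ 3 + 11664 * X ^ 4)
    (1 - 36 * X + 9720 * X ^ 3 - 122472 * X ^ 4 + 629856 * X ^ 5 - 1259712 * X ^ 6)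
    (1 - 62 * X + 1647 * X ^ 2 - 24300 * X ^ 3 + 215055 * X ^ 4 - 1141614 * X ^ 5 + 3365793 *
        X ^ 6 - 4251528 * X ^ 7) := by
  constructor <;> simp [map_ofNat C] <;> ring

theorem isCertificate_F_3 : IsCertificate 17 72 6 3 (-1)
    (3 - 108 * X + 720 * X ^ 2)
    (1 - 24 * X + 192 * X ^ 2 - 768 * X ^ 3 + 2304 * X ^ 4)
    (1 - 36 * X + 504 * X ^ 2 - 2880 * X ^ 3 + 55296 * X ^ 5 - 110592 * X ^ 6)
    (1 - 57 * X + 1392 * X ^ 2 - 18880 * X ^ 3 + 153600 * X ^ 4 - 749568 * X ^ 5 + 2031616 *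
        X ^ 6 - 2359296 * X ^ 7) := by
  constructor <;> simp [map_ofNat C] <;> ring

theorem isCertificate_F_6 : IsCertificate 17 72 6 6 1
    (6 - 144 * X + 792 * X ^ 2)
    (1 - 24 * X + 192 * X ^ 2 - 528 * X ^ 3 + 144 * X ^ 4)
    (1 - 36 * X + 504 * X ^ 2 - 3384 * X ^ 3 + 10584 * X ^ 4 - 11232 * X ^ 5 - 1728 * X ^ 6)
    (1 - 42 * X + 705 * X ^ 2 - 5912 * X ^ 3 + 24768 * X ^ 4 - 41472 * X ^ 5) := by
  constructor <;> simp [map_ofNat C] <;> ring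

theorem isCertificate_E_1 : IsCertificate 12 32 4 1 1
    (1 - 80 * X + 320 * X ^ 2)
    (1 + 224 * X - 640 * X ^ 2 - 2048 * X ^ 3 + 4096 * X ^ 4)
    (1 - 528 * X - 6336 * X ^ 2 + 71680 * X ^ 3 - 184320 * X ^ 4 + 196608 * X ^ 5 - 262144 * X ^ 6)
    (1 - 68 * X + 2048 * X ^ 2 - 35840 * X ^ 3 + 401408 * X ^ 4 - 2981888 * X ^ 5 + 14680064 *
        X ^ 6 - 46137344 * X ^ 7 + 83886080 * X ^ 8 - 67108864 * X ^ 9) := by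
  constructor <;> simp [map_ofNat C] <;> ring

theorem isCertificate_E_2 : IsCertificate 12 32 4 2 1
    (2 - 64 * X + 256 * X ^ 2)
    (1 - 16 * X + 320 * X ^ 2 - 2048 * X ^ 3 + 4096 * X ^ 4)
    (1 - 24 * X - 288 * X ^ 2 + 7168 * X ^ 3 - 55296 * X ^ 4 + 196608 * X ^ 5 - 262144 * X ^ 6)
    (1 - 40 * X + 656 * X ^ 2 - 5632 * X ^ 3 + 26624 * X ^ 4 - 65536 * X ^ 5 + 65536 * X ^ 6) := by
  constructor <;> simp [map_ofNat C] <;> ring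

theorem isCertificate_E_4 : IsCertificate 12 32 4 4 1
    (4 - 80 * X + 320 * X ^ 2)
    (1 - 16 * X + 80 * X ^ 2 - 128 * X ^ 3 + 256 * X ^ 4)
    (1 - 24 * X + 216 * X ^ 2 - 896 * X ^ 3 + 1152 * X ^ 4 + 3072 * X ^ 5 - 4096 * X ^ 6)
    (1 - 32 * X + 416 * X ^ 2 - 2816 * X ^ 3 + 10496 * X ^ 4 - 20480 * X ^ 5 + 16384 * X ^ 6) := by
  constructor <;> simp [map_ofNat C] <;> ring

theorem isCertificate_E_8 : IsCertificate 12 32 4 8 1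
    (8 - 112 * X + 352 * X ^ 2)
    (1 - 16 * X + 80 * X ^ 2 - 128 * X ^ 3 + 16 * X ^ 4)
    (1 - 24 * X + 216 * X ^ 2 - 896 * X ^ 3 + 1656 * X ^ 4 - 960 * X ^ 5 - 64 * X ^ 6)
    (1 - 16 * X + 80 * X ^ 2 - 128 * X ^ 3) := by
  constructor <;> simp [map_ofNat C] <;> ring

theorem isCertificate_G_2 : IsCertificate 0 (-16) 0 2 1
    (2 - 160 * X ^ 2)
    (1 + 224 * X ^ 2 + 256 * X ^ 4)
    (1 - 528 * X ^ 2 - 8448 * X ^ 4 + 4096 * X ^ 6)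
    (1 - 64 * X ^ 2 + 1536 * X ^ 4 - 16384 * X ^ 6 + 65536 * X ^ 8) := by
  constructor <;> simp [map_ofNat C] <;> ring

theorem isCertificate_G_4 : IsCertificate 0 (-16) 0 4 1
    (4 - 128 * X ^ 2)
    (1 - 16 * X ^ 2 + 256 * X ^ 4)
    (1 - 24 * X ^ 2 - 384 * X ^ 4 + 4096 * X ^ 6)
    (1 - 32 * X ^ 2 + 256 * X ^ 4) := by
  constructor <;> simp [map_ofNat C] <;> ring

theorem isCertificate_G_8 : IsCertificate 0 (-16) 0 8 1
    (8 - 160 * X ^ 2)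
    (1 - 16 * X ^ 2 + 16 * X ^ 4)
    (1 - 24 * X ^ 2 + 120 * X ^ 4 + 64 * X ^ 6)
    (1 - 16 * X ^ 2) := by
  constructor <;> simp [map_ofNat C] <;> ring

/-- The last polynomial is the fifth power of 1 - 11X - X², and for k = 5 it is 1 - 11X - X² itself:
the discriminant vanishes only at cusps. -/
theorem isCertificate_D_1 : IsCertificate 11 (-1) 3 1 1
    (1 - 66 * X - 11 * X ^ 2)
    (1 + 228 * X + 494 * X ^ 2 - 228 * X ^ 3 + X ^ 4)
    (1 - 522 * X - 10005 * X ^ 2 - 10005 * X ^ 4 + 522 * X ^ 5 + X ^ 6)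
    (1 - 55 * X + 1205 * X ^ 2 - 13090 * X ^ 3 + 69585 * X ^ 4 - 134761 * X ^ 5 - 69585 * X ^ 6 -
        13090 * X ^ 7 - 1205 * X ^ 8 - 55 * X ^ 9 - X ^ 10) := by
  constructor <;> simp [map_ofNat C] <;> ring

theorem isCertificate_D_5 : IsCertificate 11 (-1) 3 5 1
    (5 - 66 * X - 7 * X ^ 2)
    (1 - 12 * X + 14 * X ^ 2 + 12 * X ^ 3 + X ^ 4)
    (1 - 18 * X + 75 * X ^ 2 + 75 * X ^ 4 + 18 * X ^ 5 + X ^ 6)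
    (1 - 11 * X - X ^ 2) := by
  constructor <;> simp [map_ofNat C] <;> ring

end BeauvilleFamily

/-! ### Analysis on the imaginary axis: convergence and the recurrence -/

namespace BeauvilleFamily

open MeasureTheory Set Filter
open scoped Real Topology

/-- The differential equations satisfied by `t`, `f`, `φ = θf/f` and `u = θt/t` on the positive
imaginary axis, together with the growth at the two ends. -/
structure IsAxisSolution (A B l : ℝ) (τ f φ u : ℝ → ℝ) : Prop where
  pos_t : ∀ y > 0, 0 < τ y
  pos_f : ∀ y > 0, 0 < f y
  u_eq : ∀ y > 0, u y = f y ^ 2 * (1 - A * τ y + B * τ y ^ 2)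
  deriv_t : ∀ y > 0, HasDerivAt τ (-2 * π * τ y * u y) y
  deriv_f : ∀ y > 0, HasDerivAt f (-2 * π * f y * φ y) y
  deriv_φ : ∀ y > 0, HasDerivAt φ
    (-2 * π * (φ y ^ 2 + u y * f y ^ 2 * (l * τ y - B * τ y ^ 2))) y
  at_top : ∃ C, ∀ y ≥ 1, τ y ≤ C * Real.exp (-(2 * π * y)) ∧ f y ≤ C ∧ (f y)⁻¹ ≤ C ∧
    |φ y| ≤ C ∧ |u y| ≤ C
  at_zero : ∃ C, ∀ y, 0 < y → y ≤ 1 → |u y| ≤ C ∧ |φ y - (2 * π * y)⁻¹| ≤ C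

/-- The integrand of `Γ(s)` in terms of `t`, `f` and `u`. -/
noncomputable def axisIntegrand (τ f u : ℝ → ℝ) (s : ℂ) (y : ℝ) : ℂ :=
  (τ y : ℂ) ^ (s - 1) * (Complex.I * y) * f y * ((-2 * π * τ y * u y : ℝ) : ℂ)

namespace IsAxisSolution

variable {A B l : ℝ} {τ f φ u : ℝ → ℝ}

/-- log(y f) has derivative 1/y - 2πφ, bounded on (0, 1] by `at_zero`, so it stays within a bounded
distance of its value at 1. -/
theorem mul_f_bounds (h : IsAxisSolution A B l τ f φ u) :
    ∃ c > 0, ∃ C, ∀ y, 0 < y → y ≤ 1 → c ≤ y * f y ∧ y * f y ≤ C := by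
  obtain ⟨C, hC⟩ := h.at_zero
  have hder : ∀ y > 0, HasDerivAt (fun y => Real.log (y * f y)) (y⁻¹ - 2 * π * φ y) y := by
    intro y hy
    have hf := h.pos_f y hy
    have := ((hasDerivAt_id y).fun_mul (h.deriv_f y hy)).log (mul_pos hy hf).ne'
    convert! this using 1
    simp only [id]
    field_simp
    ring
  have hbd : ∀ y, 0 < y → y ≤ 1 → |Real.log (y * f y) - Real.log (1 * f 1)| ≤ 2 * π * C := by
    intro y hy hy1
    have hb : ∀ x ∈ Icc y 1, ‖x⁻¹ - 2 * π * φ x‖ ≤ 2 * π * C := by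
      intro x hx
      have hx0 : 0 < x := hy.trans_le hx.1
      have := (hC x hx0 hx.2).2
      rw [Real.norm_eq_abs, show x⁻¹ - 2 * π * φ x = -(2 * π) * (φ x - (2 * π * x)⁻¹) by
        field_simp; ring, abs_mul, abs_neg, abs_of_pos Real.two_pi_pos]
      gcongr
    have := (convex_Icc y 1).norm_image_sub_le_of_norm_hasDerivWithin_le
      (fun x hx => (hder x (hy.trans_le hx.1)).hasDerivWithinAt) hb
      (right_mem_Icc.mpr hy1) (left_mem_Icc.mpr hy1)
    rw [Real.norm_eq_abs, Real.norm_eq_abs] at this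
    refine this.trans (mul_le_of_le_one_right ?_ ?_)
    · exact (norm_nonneg _).trans (hb y (left_mem_Icc.mpr hy1))
    · rw [abs_le]; constructor <;> linarith
  have hf1 := h.pos_f 1 one_pos
  refine ⟨f 1 * Real.exp (-(2 * π * C)), by positivity, f 1 * Real.exp (2 * π * C), ?_⟩
  intro y hy hy1
  have hyf := mul_pos hy (h.pos_f y hy)
  have hb := abs_le.mp (hbd y hy hy1)
  rw [one_mul] at hb
  constructor
  · rw [← Real.log_le_log_iff (by positivity) hyf, Real.log_mul hf1.ne' (Real.exp_ne_zero _),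
      Real.log_exp]
    linarith
  · rw [← Real.log_le_log_iff hyf (by positivity), Real.log_mul hf1.ne' (Real.exp_ne_zero _),
      Real.log_exp]
    linarith

/-- Since f ≥ c/y and u = f²(1 - Aτ + Bτ²) is bounded, the quadratic 1 - Aτ + Bτ² is bounded. As B ≠
0, so is τ. -/
theorem bounds_zero (h : IsAxisSolution A B l τ f φ u) (hB : B ≠ 0) :
    ∃ C, ∀ y, 0 < y → y ≤ 1 → τ y ≤ C ∧ y * f y ≤ C ∧ (f y)⁻¹ ≤ C * y ∧ |u y| ≤ C ∧
      |y * φ y - (2 * π)⁻¹| ≤ C * y := by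
  obtain ⟨c, hc, C₁, h₁⟩ := h.mul_f_bounds
  obtain ⟨C₂, h₂⟩ := h.at_zero
  have hC₂ : 0 ≤ C₂ := (abs_nonneg _).trans (h₂ 1 one_pos le_rfl).1
  -- If τ ≥ 1 then |B|τ² ≤ (C₂/c² + 1 + |A|)τ, which gives τ ≤ M. The bound M + 1 covers τ < 1 as
  -- well.
  set M := (C₂ / c ^ 2 + 1 + |A|) / |B| with hM
  have hB' : 0 < |B| := abs_pos.mpr hB
  have hM0 : 0 ≤ M := by positivity
  have hC₁ : 0 ≤ C₁ := hc.le.trans ((h₁ 1 one_pos le_rfl).1.trans (h₁ 1 one_pos le_rfl).2)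
  refine ⟨M + 1 + C₁ + c⁻¹ + C₂, fun y hy hy1 => ?_⟩
  have hf := h.pos_f y hy
  have ht := h.pos_t y hy
  obtain ⟨a1, a2⟩ := h₁ y hy hy1
  obtain ⟨b1, b2⟩ := h₂ y hy hy1
  have hci : 0 < c⁻¹ := inv_pos.mpr hc
  refine ⟨?_, by linarith, ?_, by linarith, ?_⟩
  · have hP : |1 - A * τ y + B * τ y ^ 2| ≤ C₂ / c ^ 2 := by
      rw [h.u_eq y hy, abs_mul, abs_of_nonneg (by positivity)] at b1
      rw [le_div_iff₀ (by positivity), mul_comm]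
      refine le_trans ?_ b1
      gcongr
      nlinarith
    by_contra! hcon
    have ht1 : 1 ≤ τ y := by linarith
    have e1 : |B| * τ y ^ 2 ≤ C₂ / c ^ 2 + 1 + |A| * τ y := by
      have : B * τ y ^ 2 = (1 - A * τ y + B * τ y ^ 2) - 1 + A * τ y := by ring
      calc |B| * τ y ^ 2 = |B * τ y ^ 2| := by rw [abs_mul, abs_of_nonneg (sq_nonneg (τ y))]
        _ ≤ |1 - A * τ y + B * τ y ^ 2| + 1 + |A * τ y| := by
            rw [this]
            refine (abs_add_le _ _).trans ?_
            gcongr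
            refine (abs_sub _ _).trans ?_
            simp
        _ ≤ _ := by rw [abs_mul, abs_of_pos ht]; linarith
    have e2 : |B| * τ y ^ 2 ≤ (C₂ / c ^ 2 + 1 + |A|) * τ y := by
      have : 0 ≤ C₂ / c ^ 2 := by positivity
      nlinarith
    have e3 : τ y ≤ M := by
      rw [hM, le_div_iff₀ hB']
      nlinarith
    linarith
  · have : (f y)⁻¹ ≤ c⁻¹ * y := by
      rw [inv_le_iff_one_le_mul₀ hf, mul_assoc, ← div_eq_inv_mul, le_div_iff₀ hc, one_mul]
      exact a1
    refine this.trans ?_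
    gcongr
    linarith
  · have : y * φ y - (2 * π)⁻¹ = y * (φ y - (2 * π * y)⁻¹) := by
      field_simp
    rw [this, abs_mul, abs_of_pos hy, mul_comm]
    gcongr
    linarith

theorem continuousOn_integrand (h : IsAxisSolution A B l τ f φ u) (s : ℂ) :
    ContinuousOn (axisIntegrand τ f u s) (Ioi 0) := by
  have c1 : ContinuousOn τ (Ioi 0) := fun y hy => (h.deriv_t y hy).continuousAt.continuousWithinAt
  have c2 : ContinuousOn f (Ioi 0) := fun y hy => (h.deriv_f y hy).continuousAt.continuousWithinAt
  have c3 : ContinuousOn u (Ioi 0) := by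
    refine ContinuousOn.congr (f := fun y => f y ^ 2 * (1 - A * τ y + B * τ y ^ 2)) ?_
      fun y hy => h.u_eq y hy
    fun_prop
  have c4 : ContinuousOn (fun y => (τ y : ℂ) ^ (s - 1)) (Ioi 0) := by
    refine ContinuousOn.cpow_const (by fun_prop) fun y hy => Or.inl ?_
    simpa using h.pos_t y hy
  unfold axisIntegrand
  fun_prop

theorem axisIntegrand_eq (h : IsAxisSolution A B l τ f φ u) (s : ℂ) {y : ℝ} (hy : 0 < y) :
    axisIntegrand τ f u s y = -(2 * π * Complex.I) * (τ y : ℂ) ^ s * y * f y * u y := by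
  have ht : (τ y : ℂ) ≠ 0 := by exact_mod_cast (h.pos_t y hy).ne'
  rw [axisIntegrand, Complex.cpow_sub _ _ ht, Complex.cpow_one]
  push_cast
  field_simp

theorem norm_axisIntegrand (h : IsAxisSolution A B l τ f φ u) (s : ℂ) {y : ℝ} (hy : 0 < y) :
    ‖axisIntegrand τ f u s y‖ = 2 * π * τ y ^ s.re * (y * f y) * |u y| := by
  rw [h.axisIntegrand_eq s hy]
  simp only [norm_mul, norm_neg, Complex.norm_real, Complex.norm_I, Complex.norm_ofNat, mul_one,
    Complex.norm_cpow_eq_rpow_re_of_pos (h.pos_t y hy), Real.norm_eq_abs]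
  rw [abs_of_pos Real.pi_pos, abs_of_pos hy, abs_of_pos (h.pos_f y hy)]
  ring

/-- On (0, 1] the integrand is bounded, because y f, u and τ are. Beyond 1 it is dominated by y
exp(-2π Re(s) y). -/
theorem integrableOn (h : IsAxisSolution A B l τ f φ u) (hB : B ≠ 0) {s : ℂ} (hs : 0 < s.re) :
    IntegrableOn (axisIntegrand τ f u s) (Ioi 0) := by
  have hc := h.continuousOn_integrand s
  rw [← Ioc_union_Ioi_eq_Ioi zero_le_one]
  refine IntegrableOn.union ?_ ?_
  · obtain ⟨C, hC⟩ := h.bounds_zero hB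
    refine Integrable.of_bound
      ((hc.mono Ioc_subset_Ioi_self).aestronglyMeasurable measurableSet_Ioc)
      (2 * π * C ^ s.re * C * C) ?_
    refine (ae_restrict_mem measurableSet_Ioc).mono fun y hy => ?_
    obtain ⟨b1, b2, b3, b4, b5⟩ := hC y hy.1 hy.2
    have := h.pos_t y hy.1
    have := h.pos_f y hy.1
    have := hy.1
    have hC0 : 0 ≤ C := by linarith
    rw [h.norm_axisIntegrand s hy.1]
    gcongr
  · obtain ⟨C, hC⟩ := h.at_top
    have hc1 := hc.mono (Ici_subset_Ioi.mpr one_pos)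
    refine (integrable_norm_iff ((hc1.mono Ioi_subset_Ici_self).aestronglyMeasurable
      measurableSet_Ioi)).mp
      -- Half of the available decay rate 2π Re s is spent on absorbing the factor y.
      (integrable_of_isBigO_exp_neg (b := π * s.re) (by positivity) hc1.norm ?_)
    refine Asymptotics.IsBigO.norm_left ?_
    have hlin : (fun y : ℝ => y) =o[atTop] fun y => Real.exp (π * s.re * y) := by
      simpa using isLittleO_pow_exp_pos_mul_atTop 1 (b := π * s.re) (by positivity)
    have h1 : axisIntegrand τ f u s =O[atTop] fun y => Real.exp (-(2 * π * s.re * y)) * y := by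
      refine Asymptotics.IsBigO.of_bound (2 * π * C ^ s.re * C * C) ?_
      filter_upwards [eventually_ge_atTop 1] with y hy
      obtain ⟨b1, b2, b3, b4, b5⟩ := hC y hy
      have hy0 : 0 < y := one_pos.trans_le hy
      have ht := h.pos_t y hy0
      have hf := h.pos_f y hy0
      have hC0 : 0 ≤ C := by linarith
      rw [h.norm_axisIntegrand s hy0, norm_mul, Real.norm_eq_abs, Real.norm_eq_abs, Real.abs_exp,
        abs_of_pos hy0]
      have e : Real.exp (-(2 * π * s.re * y)) = Real.exp (-(2 * π * y)) ^ s.re := by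
        rw [← Real.exp_mul]; ring_nf
      calc 2 * π * τ y ^ s.re * (y * f y) * |u y|
          ≤ 2 * π * (C * Real.exp (-(2 * π * y))) ^ s.re * (y * C) * C := by gcongr
        _ = _ := by rw [Real.mul_rpow hC0 (Real.exp_nonneg _), e]; ring
    refine h1.trans ?_
    refine ((Asymptotics.isBigO_refl (fun y => Real.exp (-(2 * π * s.re * y))) atTop).mul
      hlin.isBigO).congr_right fun y => ?_
    rw [← Real.exp_add]
    ring_nf

/-- A primitive of the combination of integrands in the recurrence. -/
noncomputable def primitive (A B : ℝ) (τ f φ : ℝ → ℝ) (s : ℂ) (y : ℝ) : ℂ :=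
  (τ y : ℂ) ^ s * ((((y * φ y - (2 * π)⁻¹) * (f y)⁻¹ : ℝ) : ℂ) -
    s * ((y * f y * (1 - A * τ y + B * τ y ^ 2) : ℝ) : ℂ))

/-- On z = iy the first term of `primitive`, times I, is t^s·Pθ(zf): indeed Pθ(zf) = ϑ(zf)/f² = zφ/f
+ 1/(2πi f). The second is -s t^s P·zf. The coefficients of the recurrence arise by applying θ and
using θPθ(zf) = (λt - Bt²) zf. -/
theorem hasDerivAt_primitive (h : IsAxisSolution A B l τ f φ u) (s : ℂ) {y : ℝ} (hy : 0 < y) :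
    HasDerivAt (fun y => Complex.I * primitive A B τ f φ s y)
      (-(s ^ 2 * axisIntegrand τ f u s y -
        (A * s * (s + 1) + l) * axisIntegrand τ f u (s + 1) y +
        B * (s + 1) ^ 2 * axisIntegrand τ f u (s + 2) y)) y := by
  have ht := h.deriv_t y hy
  have hf := h.deriv_f y hy
  have hp := h.deriv_φ y hy
  have hf0 := (h.pos_f y hy).ne'
  have ht0 : (τ y : ℂ) ≠ 0 := by exact_mod_cast (h.pos_t y hy).ne'
  have hu := h.u_eq y hy
  -- This is the equation L(zf) = 0. Subtracting 1/(2π) cancels the term in which y itself is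
  -- differentiated.
  have d1 : HasDerivAt (fun y => (y * φ y - (2 * π)⁻¹) * (f y)⁻¹)
      (-(2 * π * y * u y * f y * (l * τ y - B * τ y ^ 2))) y := by
    have := (((hasDerivAt_id y).fun_mul hp).sub_const (2 * π)⁻¹).fun_mul (hf.fun_inv hf0)
    convert! this using 1
    simp only [id]
    field_simp
    ring
  have d2 : HasDerivAt (fun y => y * f y * (1 - A * τ y + B * τ y ^ 2))
      (f y * (1 - 2 * π * y * φ y) * (1 - A * τ y + B * τ y ^ 2) +
        y * f y * ((2 * B * τ y - A) * (-2 * π * τ y * u y))) y := by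
    have := ((hasDerivAt_id y).fun_mul hf).fun_mul
      (((ht.const_mul A).const_sub 1).fun_add ((ht.fun_pow 2).const_mul B))
    convert! this using 1
    simp only [id]
    push_cast
    ring
  have d3 : HasDerivAt (fun y => (τ y : ℂ) ^ s)
      (s * (τ y : ℂ) ^ s * (-2 * π * u y)) y := by
    have hc : HasDerivAt (fun w : ℂ => w ^ s) (s * (τ y : ℂ) ^ (s - 1) * 1) (τ y : ℂ) :=
      (hasDerivAt_id (τ y : ℂ)).cpow_const (Or.inl (by simpa using h.pos_t y hy))
    have := hc.comp y ht.ofReal_comp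
    convert! this using 1
    rw [Complex.cpow_sub _ _ ht0, Complex.cpow_one]
    push_cast
    field_simp
  have d := ((d3.fun_mul (d1.ofReal_comp.fun_sub (d2.ofReal_comp.const_mul s))).const_mul
    Complex.I)
  refine (d.congr_deriv ?_)
  rw [h.axisIntegrand_eq s hy, h.axisIntegrand_eq _ hy, h.axisIntegrand_eq _ hy,
    Complex.cpow_add _ _ ht0, Complex.cpow_add _ _ ht0, Complex.cpow_one, Complex.cpow_ofNat, hu]
  push_cast
  have hf0' : (f y : ℂ) ≠ 0 := by exact_mod_cast hf0
  have hpi : (π : ℂ) ≠ 0 := by exact_mod_cast Real.pi_ne_zero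
  field_simp
  ring

theorem norm_primitive_le (h : IsAxisSolution A B l τ f φ u) (s : ℂ) {y : ℝ} (hy : 0 < y) :
    ‖primitive A B τ f φ s y‖ ≤
      τ y ^ s.re * (|y * φ y - (2 * π)⁻¹| * (f y)⁻¹ + ‖s‖ * (y * |u y| * (f y)⁻¹)) := by
  have hf := h.pos_f y hy
  have ht := h.pos_t y hy
  rw [primitive, norm_mul, Complex.norm_cpow_eq_rpow_re_of_pos ht]
  gcongr
  refine (norm_sub_le _ _).trans_eq ?_
  have : y * f y * (1 - A * τ y + B * τ y ^ 2) = y * u y * (f y)⁻¹ := by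
    rw [h.u_eq y hy]; field_simp
  rw [this, norm_mul, Complex.norm_real, Complex.norm_real, Real.norm_eq_abs, Real.norm_eq_abs]
  simp only [abs_mul, abs_inv, abs_of_pos hf, abs_of_pos hy]

/-- Both yφ - 1/(2π) and 1/f are O(y), and y f P = y u / f is O(y²), while τ^s stays bounded. -/
theorem tendsto_primitive_zero (h : IsAxisSolution A B l τ f φ u) (hB : B ≠ 0) {s : ℂ}
    (hs : 0 < s.re) : Tendsto (primitive A B τ f φ s) (𝓝[>] 0) (𝓝 0) := by
  obtain ⟨C, hC⟩ := h.bounds_zero hB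
  have h0 : Tendsto (fun y : ℝ => C ^ s.re * (C * y * (C * y) + ‖s‖ * (y * C * (C * y))))
      (𝓝[>] 0) (𝓝 0) := by
    have : Continuous fun y : ℝ => C ^ s.re * (C * y * (C * y) + ‖s‖ * (y * C * (C * y))) := by
      fun_prop
    simpa using this.continuousWithinAt (s := Ioi 0) (x := 0) |>.tendsto
  refine squeeze_zero_norm' ?_ h0
  filter_upwards [Ioc_mem_nhdsGT one_pos] with y hy
  obtain ⟨b1, b2, b3, b4, b5⟩ := hC y hy.1 hy.2
  refine (h.norm_primitive_le s hy.1).trans ?_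
  have ht := h.pos_t y hy.1
  have hf := h.pos_f y hy.1
  have := hy.1
  have hC0 : 0 ≤ C := by linarith
  gcongr

theorem tendsto_primitive_atTop (h : IsAxisSolution A B l τ f φ u) {s : ℂ}
    (hs : 0 < s.re) : Tendsto (primitive A B τ f φ s) atTop (𝓝 0) := by
  obtain ⟨C, hC⟩ := h.at_top
  have h0 : Tendsto (fun y : ℝ => C ^ s.re * (((C + 1) * C + ‖s‖ * (C * C)) *
      (y * Real.exp (-(2 * π * s.re) * y)))) atTop (𝓝 0) := by
    have := tendsto_rpow_mul_exp_neg_mul_atTop_nhds_zero 1 (2 * π * s.re) (by positivity)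
    simp only [Real.rpow_one] at this
    simpa using (this.const_mul ((C + 1) * C + ‖s‖ * (C * C))).const_mul (C ^ s.re)
  refine squeeze_zero_norm' ?_ h0
  filter_upwards [eventually_ge_atTop 1] with y hy
  obtain ⟨b1, b2, b3, b4, b5⟩ := hC y hy
  have hy0 : 0 < y := one_pos.trans_le hy
  refine (h.norm_primitive_le s hy0).trans ?_
  have ht := h.pos_t y hy0
  have hf := h.pos_f y hy0
  have hC0 : 0 ≤ C := by linarith
  have e : Real.exp (-(2 * π * s.re) * y) = Real.exp (-(2 * π * y)) ^ s.re := by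
    rw [← Real.exp_mul]; ring_nf
  have e2 : |y * φ y - (2 * π)⁻¹| ≤ (C + 1) * y := by
    refine (abs_sub _ _).trans ?_
    rw [abs_mul, abs_of_pos hy0, abs_of_pos (inv_pos.mpr Real.two_pi_pos)]
    have : (2 * π)⁻¹ ≤ 1 := inv_le_one_of_one_le₀ (by linarith [Real.pi_gt_three])
    nlinarith
  calc τ y ^ s.re * (|y * φ y - (2 * π)⁻¹| * (f y)⁻¹ + ‖s‖ * (y * |u y| * (f y)⁻¹))
      ≤ (C * Real.exp (-(2 * π * y))) ^ s.re * ((C + 1) * y * C + ‖s‖ * (y * C * C)) := by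
        gcongr
    _ = _ := by rw [Real.mul_rpow hC0 (Real.exp_nonneg _), e]; ring

theorem recurrence (h : IsAxisSolution A B l τ f φ u) (hB : B ≠ 0) {s : ℂ} (hs : 0 < s.re) :
    s ^ 2 * (∫ y in Ioi 0, axisIntegrand τ f u s y) =
      (A * s * (s + 1) + l) * (∫ y in Ioi 0, axisIntegrand τ f u (s + 1) y) -
        B * (s + 1) ^ 2 * ∫ y in Ioi 0, axisIntegrand τ f u (s + 2) y := by
  have i0 := (h.integrableOn hB hs).const_mul (s ^ 2)
  have i1 := (h.integrableOn hB (s := s + 1) (by simp; linarith)).const_mul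
    (A * s * (s + 1) + l)
  have i2 := (h.integrableOn hB (s := s + 2) (by simp; linarith)).const_mul
    (B * (s + 1) ^ 2)
  have i01 : Integrable (fun y => s ^ 2 * axisIntegrand τ f u s y -
      (A * s * (s + 1) + l) * axisIntegrand τ f u (s + 1) y) (volume.restrict (Ioi 0)) := i0.sub i1
  have i012 : Integrable (fun y => -(s ^ 2 * axisIntegrand τ f u s y -
      (A * s * (s + 1) + l) * axisIntegrand τ f u (s + 1) y +
      B * (s + 1) ^ 2 * axisIntegrand τ f u (s + 2) y)) (volume.restrict (Ioi 0)) :=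
          (i01.add i2).neg
  have key := integral_Ioi_of_hasDerivAt_of_tendsto (a := 0) (m := 0)
    -- The value of the formula at y = 0 carries no meaning. It is replaced by the one-sided limit
    -- 0, as continuity at the endpoint is required.
    (f := Function.update (fun y => Complex.I * primitive A B τ f φ s y) 0 0)
    (f' := fun y => -(s ^ 2 * axisIntegrand τ f u s y -
        (A * s * (s + 1) + l) * axisIntegrand τ f u (s + 1) y +
        B * (s + 1) ^ 2 * axisIntegrand τ f u (s + 2) y)) ?_ ?_ i012 ?_
  · rw [integral_neg, integral_add i01 i2, integral_sub i0 i1,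
      integral_const_mul, integral_const_mul, integral_const_mul] at key
    simp only [Function.update_self, sub_zero] at key
    linear_combination -key
  · rw [continuousWithinAt_update_same]
    have := (h.tendsto_primitive_zero hB hs).const_mul Complex.I
    simpa using this
  · intro y hy
    refine (h.hasDerivAt_primitive s hy).congr_of_eventuallyEq ?_
    filter_upwards [lt_mem_nhds (show (0 : ℝ) < y from hy)] with x hx
    rw [Function.update_of_ne hx.ne']
  · have := (h.tendsto_primitive_atTop hs).const_mul Complex.I
    rw [mul_zero] at this
    refine this.congr' ?_
    filter_upwards [eventually_gt_atTop 0] with x hx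
    rw [Function.update_of_ne hx.ne']

end IsAxisSolution

end BeauvilleFamily

/-! ### Behaviour on the imaginary axis of E₂ and of eta quotients -/

namespace BeauvilleFamily

open PowerSeries UpperHalfPlane Filter Metric
open scoped Real Topology

/-! ### Functions on the disc along the positive imaginary axis -/

/-- The value of `q = exp (2πiz)` at `z = iy`. -/
noncomputable def axisQ (y : ℝ) : ℂ := (Real.exp (-(2 * π * y)) : ℝ)

theorem axisQ_eq_exp (y : ℝ) : axisQ y = Complex.exp (2 * π * Complex.I * (Complex.I * y)) := by
  rw [axisQ, Complex.ofReal_exp]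
  congr 1
  push_cast
  linear_combination (-2 * π * y : ℂ) * Complex.I_sq

theorem norm_axisQ (y : ℝ) : ‖axisQ y‖ = Real.exp (-(2 * π * y)) := by
  rw [axisQ, Complex.norm_real, Real.norm_eq_abs, Real.abs_exp]

theorem norm_axisQ_lt {y : ℝ} (hy : 0 < y) : ‖axisQ y‖ < 1 := by
  rw [norm_axisQ, Real.exp_lt_one_iff]
  have := Real.pi_pos
  nlinarith [mul_pos this hy]

theorem axisQ_pow (y : ℝ) (k : ℕ) : axisQ y ^ k = axisQ (k * y) := by
  rw [axisQ, axisQ, ← Complex.ofReal_pow, ← Real.exp_nat_mul]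
  congr 2
  ring

theorem axisQ_ne_zero (y : ℝ) : axisQ y ≠ 0 := by
  rw [axisQ_eq_exp]; exact Complex.exp_ne_zero _

theorem hasDerivAt_axisQ (y : ℝ) : HasDerivAt axisQ (-2 * π * axisQ y) y := by
  have h : HasDerivAt (fun y : ℝ => Real.exp (-(2 * π * y)))
      (Real.exp (-(2 * π * y)) * -(2 * π * 1)) y :=
    ((hasDerivAt_id y).const_mul (2 * π)).fun_neg.exp
  have := h.ofReal_comp
  unfold axisQ
  convert! this using 1
  push_cast
  ring

theorem HasDiskSeries.hasDerivAt_axis {h : ℂ → ℂ} {p : ℂ⟦X⟧} (H : HasDiskSeries h p) {y : ℝ}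
    (hy : 0 < y) :
    HasDerivAt (fun y => h (axisQ y)) (-2 * π * (axisQ y * deriv h (axisQ y))) y := by
  have := (H.differentiableAt (norm_axisQ_lt hy)).hasDerivAt.comp y (hasDerivAt_axisQ y)
  convert! this using 1
  ring

/-- The difference quotient at 0 extends to a continuous function on the compact disc of radius r.
-/
theorem HasDiskSeries.norm_sub_le {h : ℂ → ℂ} {p : ℂ⟦X⟧} (H : HasDiskSeries h p) {r : ℝ}
    (hr : r < 1) : ∃ M, 0 ≤ M ∧ ∀ q, ‖q‖ ≤ r → ‖h q - h 0‖ ≤ M * ‖q‖ := by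
  have hd : ContinuousOn (dslope h 0) (closedBall 0 r) :=
    (((Complex.differentiableOn_dslope (ball_mem_nhds (0 : ℂ) one_pos)).mpr
      H.differentiableOn).continuousOn).mono (closedBall_subset_ball hr)
  obtain ⟨M, hM⟩ := (isCompact_closedBall (0 : ℂ) r).exists_bound_of_continuousOn hd
  refine ⟨max M 0, le_max_right _ _, fun q hq => ?_⟩
  have := sub_smul_dslope h 0 q
  rw [sub_zero, smul_eq_mul] at this
  rw [← this, norm_mul, mul_comm]
  gcongr
  exact (hM q (by simpa using hq)).trans (le_max_left _ _)

theorem HasDiskSeries.norm_le {h : ℂ → ℂ} {p : ℂ⟦X⟧} (H : HasDiskSeries h p) {r : ℝ}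
    (hr : r < 1) : ∃ M, ∀ q, ‖q‖ ≤ r → ‖h q‖ ≤ M := by
  obtain ⟨M, hM⟩ := (isCompact_closedBall (0 : ℂ) r).exists_bound_of_continuousOn
    (H.differentiableOn.continuousOn.mono (closedBall_subset_ball hr))
  exact ⟨M, fun q hq => hM q (by simpa using hq)⟩

/-! ### The Eisenstein series `E₂` as a function of `q` -/

/-- `E₂` as a function of `q`. -/
noncomputable def diskE2 (q : ℂ) : ℂ := ∑' n, coeff n seriesE2 * q ^ n

theorem hasDiskSeries_diskE2 : HasDiskSeries diskE2 seriesE2 := by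
  obtain ⟨h, hh, -⟩ := hasQSeries_E2.exists_disk
  exact fun q hq => (hh q hq).summable.hasSum

theorem E2_eq_diskE2 (z : ℍ) : EisensteinSeries.E2 z = diskE2 (Function.Periodic.qParam 1 z) :=
  (hasQSeries_E2 z).tsum_eq.symm

/-- The transformation of E₂ under z ↦ -1/z at z = iy; the last term is its quasi-modular
correction. -/
theorem diskE2_axis {y : ℝ} (hy : 0 < y) :
    diskE2 (axisQ y) = -(y ^ 2 : ℂ)⁻¹ * diskE2 (axisQ y⁻¹) + 6 / (π * y) := by
  let z : ℍ := ⟨Complex.I * y, by simpa using hy⟩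
  have hz : (z : ℂ) = Complex.I * y := rfl
  have hS : ((ModularGroup.S • z : ℍ) : ℂ) = Complex.I * (y⁻¹ : ℝ) := by
    rw [modular_S_smul, coe_mk, hz]
    have : (y : ℂ) ≠ 0 := by exact_mod_cast hy.ne'
    have hI := Complex.I_ne_zero
    push_cast
    field_simp
    rw [Complex.I_sq]
  have h1 : EisensteinSeries.E2 z = diskE2 (axisQ y) := by
    rw [E2_eq_diskE2, axisQ_eq_exp, hz]; simp [Function.Periodic.qParam]
  have h2 : EisensteinSeries.E2 (ModularGroup.S • z) = diskE2 (axisQ y⁻¹) := by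
    rw [E2_eq_diskE2, axisQ_eq_exp, hS]; simp [Function.Periodic.qParam]
  rw [← h1, ← h2, EisensteinSeries.E2, Pi.smul_apply, Pi.smul_apply, smul_eq_mul, smul_eq_mul,
    EisensteinSeries.G2_S_transform z, hz, riemannZeta_two]
  have hy' : (y : ℂ) ≠ 0 := by exact_mod_cast hy.ne'
  have hpi : (π : ℂ) ≠ 0 := by exact_mod_cast Real.pi_ne_zero
  have hI := Complex.I_ne_zero
  field_simp
  rw [Complex.I_sq]
  ring

theorem diskE2_zero : diskE2 0 = 1 := by
  rw [hasDiskSeries_diskE2.apply_zero, constantCoeff_seriesE2]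

/-- By `diskE2_axis` at ky, the expression equals -(E₂(q') - 1)/(ky²) with q' = exp(-2π/(ky)). That
difference is O(q'), exponentially small as y → 0. -/
theorem diskE2_axis_bound (k : ℕ) (hk : k ≠ 0) : ∃ C, ∀ y : ℝ, 0 < y → y ≤ 1 →
    ‖(k : ℂ) * diskE2 (axisQ y ^ k) + ((k : ℂ) * y ^ 2)⁻¹ - 6 / (π * y)‖ ≤ C := by
  have hk0 : (0 : ℝ) < k := by exact_mod_cast Nat.pos_of_ne_zero hk
  have hr : Real.exp (-(2 * π * (k : ℝ)⁻¹)) < 1 := by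
    rw [Real.exp_lt_one_iff, neg_lt_zero]; positivity
  obtain ⟨M, hM0, hM⟩ := hasDiskSeries_diskE2.norm_sub_le hr
  refine ⟨M * k, fun y hy hy1 => ?_⟩
  have hky : 0 < (k : ℝ) * y := by positivity
  have hy' : (y : ℂ) ≠ 0 := by exact_mod_cast hy.ne'
  have hk' : (k : ℂ) ≠ 0 := by exact_mod_cast hk
  have hpi : (π : ℂ) ≠ 0 := by exact_mod_cast Real.pi_ne_zero
  have e : (k : ℂ) * diskE2 (axisQ y ^ k) + ((k : ℂ) * y ^ 2)⁻¹ - 6 / (π * y) =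
      -((k : ℂ) * y ^ 2)⁻¹ * (diskE2 (axisQ (k * y)⁻¹) - diskE2 0) := by
    rw [axisQ_pow, diskE2_axis hky, diskE2_zero]
    push_cast
    field_simp
    ring
  have hx : (k : ℝ)⁻¹ ≤ ((k : ℝ) * y)⁻¹ := by
    gcongr
    nlinarith
  have hq : ‖axisQ (k * y)⁻¹‖ ≤ Real.exp (-(2 * π * (k : ℝ)⁻¹)) := by
    rw [norm_axisQ]
    gcongr
  -- With x = 1/(ky), the quadratic lower bound for exp(2πx) already dominates x².
  have hexp : ((k : ℝ) * y)⁻¹ ^ 2 * Real.exp (-(2 * π * (k * y)⁻¹)) ≤ 1 := by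
    rw [Real.exp_neg, ← div_eq_mul_inv, div_le_one (Real.exp_pos _)]
    set x := ((k : ℝ) * y)⁻¹
    have hx0 : 0 < x := inv_pos.mpr hky
    have hpi3 := Real.pi_gt_three
    have := Real.quadratic_le_exp_of_nonneg (x := 2 * π * x) (by positivity)
    have h3 : 3 ^ 2 * x ^ 2 ≤ π ^ 2 * x ^ 2 := by gcongr
    nlinarith [mul_pos Real.pi_pos hx0, sq_nonneg x]
  rw [e, norm_mul, norm_neg, norm_inv, norm_mul, norm_pow, Complex.norm_natCast, Complex.norm_real,
    Real.norm_eq_abs, abs_of_pos hy]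
  calc ((k : ℝ) * y ^ 2)⁻¹ * ‖diskE2 (axisQ (k * y)⁻¹) - diskE2 0‖
      ≤ ((k : ℝ) * y ^ 2)⁻¹ * (M * Real.exp (-(2 * π * (k * y)⁻¹))) := by
        gcongr
        exact (hM _ hq).trans_eq (by rw [norm_axisQ])
    _ = M * k * (((k : ℝ) * y)⁻¹ ^ 2 * Real.exp (-(2 * π * (k * y)⁻¹))) := by
        field_simp
    _ ≤ M * k * 1 := by gcongr
    _ = M * k := mul_one _

/-! ### Eta quotients -/

/-- Euler's product `∏ (1 - qⁿ)`. -/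
noncomputable def eulerProd (q : ℂ) : ℂ := ∏' n : ℕ, (1 - q ^ (n + 1))

theorem eulerProd_ne_zero {q : ℂ} (hq : ‖q‖ < 1) : eulerProd q ≠ 0 := by
  rcases eq_or_ne q 0 with rfl | h0
  · simp [eulerProd]
  · obtain ⟨τ, rfl⟩ := HasQSeries.exists_qParam h0 hq
    exact ModularForm.eta_tprod_ne_zero τ.2

theorem eulerProd_zero : eulerProd 0 = 1 := by simp [eulerProd]

/-- The logarithmic derivative of η is πi E₂/12, and the factor q^(1/24) of η accounts for the -1.
-/
theorem mul_deriv_eulerProd {q : ℂ} (h0 : q ≠ 0) (hq : ‖q‖ < 1) :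
    q * deriv eulerProd q = eulerProd q * ((24 : ℂ)⁻¹ * (diskE2 q - 1)) := by
  obtain ⟨τ, rfl⟩ := HasQSeries.exists_qParam h0 hq
  have h1 := ModularForm.logDeriv_eta_eq_E2 τ
  have hd : DifferentiableAt ℂ eulerProd (Function.Periodic.qParam 1 τ) :=
    ModularForm.differentiableOn_tprod_one_sub_pow.differentiableAt
      (isOpen_ball.mem_nhds (by simpa using hq))
  have h2 : logDeriv (fun z => eulerProd (Function.Periodic.qParam 1 z)) (τ : ℂ) =
      2 * π * Complex.I * Function.Periodic.qParam 1 τ *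
          deriv eulerProd (Function.Periodic.qParam 1 τ) /
        eulerProd (Function.Periodic.qParam 1 τ) := by
    have := (hd.hasDerivAt.comp (τ : ℂ) (HasQSeries.hasDerivAt_qParam τ)).deriv
    rw [logDeriv_apply]
    refine (congrArg (· / _) this).trans ?_
    ring
  have h3 : ModularForm.eta = fun z => Function.Periodic.qParam 24 z *
      eulerProd (Function.Periodic.qParam 1 z) := rfl
  rw [h3, logDeriv_mul (τ : ℂ) (Function.Periodic.qParam_ne_zero _) (g :=
      fun z => eulerProd (Function.Periodic.qParam 1 z))
    (eulerProd_ne_zero hq) (by fun_prop) (hd.comp (τ : ℂ)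
        (HasQSeries.hasDerivAt_qParam τ).differentiableAt),
    ModularForm.logDeriv_qParam, h2, E2_eq_diskE2] at h1
  have hP := eulerProd_ne_zero hq
  have hpi : (π : ℂ) ≠ 0 := by exact_mod_cast Real.pi_ne_zero
  have hI := Complex.I_ne_zero
  push_cast at h1
  field_simp at h1 ⊢
  linear_combination (24 : ℂ)⁻¹ * h1

theorem HasDiskSeries.zpow {h v : ℂ → ℂ} {p w : ℂ⟦X⟧} (H : HasDiskSeries h p)
    (H0 : ∀ q, ‖q‖ < 1 → h q ≠ 0) (W : HasDiskSeries v w)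
    (hv : ∀ q, q ≠ 0 → ‖q‖ < 1 → q * deriv h q = h q * v q) (a : ℤ) :
    ∃ r, HasDiskSeries (fun q => h q ^ a) r ∧ BeauvilleFamily.eulerDeriv r = r * (C (a : ℂ) *
        w) := by
  have hd : DifferentiableOn ℂ (fun q => h q ^ a) (ball 0 1) := fun q hq =>
    ((H.differentiableOn q hq).zpow (Or.inl (H0 q (by simpa using hq))))
  refine ⟨_, of_differentiableOn hd, ?_⟩
  have R := of_differentiableOn hd
  refine R.eulerDeriv.unique (R.mul (W.const_mul (a : ℂ))) fun q h0 hq => ?_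
  have h1 := (hasDerivAt_zpow a (h q) (Or.inl (H0 q hq))).comp q (H.differentiableAt hq).hasDerivAt
  have h2 : deriv (fun q => h q ^ a) q = a * h q ^ (a - 1) * deriv h q := h1.deriv
  rw [h2, zpow_sub_one₀ (H0 q hq)]
  have := H0 q hq
  have h3 := hv q h0 hq
  field_simp
  linear_combination a * h3

/-- `E₂(q ^ k)` as a formal power series. -/
noncomputable def seriesE2At (k : ℕ) : ℂ⟦X⟧ := if hk : k ≠ 0 then expand k hk seriesE2 else 0

theorem seriesE2At_of_ne {k : ℕ} (hk : k ≠ 0) : seriesE2At k = expand k hk seriesE2 := dif_pos hk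

theorem hasDiskSeries_seriesE2At {k : ℕ} (hk : k ≠ 0) :
    HasDiskSeries (fun q => diskE2 (q ^ k)) (seriesE2At k) :=
  seriesE2At_of_ne hk ▸ hasDiskSeries_diskE2.expand k hk

theorem exists_series_eulerProd_zpow {k : ℕ} (hk : k ≠ 0) (a : ℤ) :
    ∃ r, HasDiskSeries (fun q => eulerProd (q ^ k) ^ a) r ∧
      eulerDeriv r = r * (C ((k * a : ℂ) / 24) * (seriesE2At k - 1)) := by
  have H := HasDiskSeries.of_differentiableOn ModularForm.differentiableOn_tprod_one_sub_pow
  have hk1 : ∀ {q : ℂ}, ‖q‖ < 1 → ‖q ^ k‖ < 1 := fun {q} hq => by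
    rw [norm_pow]; exact pow_lt_one₀ (norm_nonneg _) hq hk
  have W := ((hasDiskSeries_seriesE2At hk).sub (HasDiskSeries.constant 1)).const_mul ((k : ℂ) / 24)
  have hv : ∀ q : ℂ, q ≠ 0 → ‖q‖ < 1 → q * deriv (fun q => eulerProd (q ^ k)) q =
      eulerProd (q ^ k) * ((k : ℂ) / 24 * (diskE2 (q ^ k) - 1)) := by
    intro q h0 hq
    have h1 := mul_deriv_eulerProd (pow_ne_zero k h0) (hk1 hq)
    have hd : DifferentiableAt ℂ eulerProd (q ^ k) := H.differentiableAt (hk1 hq)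
    have h2 : deriv (fun q => eulerProd (q ^ k)) q = deriv eulerProd (q ^ k) * (k * q ^ (k - 1)) :=
      (hd.hasDerivAt.comp q (hasDerivAt_pow k q)).deriv
    have h3 : q * deriv (fun q => eulerProd (q ^ k)) q = k * (q ^ k * deriv eulerProd (q ^ k)) := by
      rw [h2]
      obtain ⟨m, rfl⟩ := Nat.exists_eq_succ_of_ne_zero hk
      rw [Nat.succ_sub_one, pow_succ]
      ring
    rw [h3, h1]
    ring
  obtain ⟨r, hr, hr'⟩ := HasDiskSeries.zpow (H.expand k hk)
    (fun q hq => eulerProd_ne_zero (hk1 hq)) W hv a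
  refine ⟨r, hr, ?_⟩
  rw [hr', ← mul_assoc (C (a : ℂ)), ← map_mul, map_one]
  congr 3
  ring

/-- `∏ (∏ (1 - q ^ (k n))) ^ a` over the pairs `(k, a)` in a list. -/
noncomputable def eulerQuotient (L : List (ℕ × ℤ)) (q : ℂ) : ℂ :=
  (L.map fun x => eulerProd (q ^ x.1) ^ x.2).prod

/-- `∑ a k E₂(q ^ k) / 24` over the pairs `(k, a)` in a list. -/
noncomputable def eisensteinSum (L : List (ℕ × ℤ)) : ℂ⟦X⟧ :=
  (L.map fun x => C ((x.1 * x.2 : ℂ) / 24) * seriesE2At x.1).sum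

/-- `∑ a k E₂(q ^ k) / 24` over the pairs `(k, a)` in a list, as a function. -/
noncomputable def diskEisensteinSum (L : List (ℕ × ℤ)) (q : ℂ) : ℂ :=
  (L.map fun x => (x.1 * x.2 : ℂ) / 24 * diskE2 (q ^ x.1)).sum

theorem hasDiskSeries_eisensteinSum (L : List (ℕ × ℤ)) (hL : ∀ x ∈ L, x.1 ≠ 0) :
    HasDiskSeries (diskEisensteinSum L) (eisensteinSum L) := by
  induction L with
  | nil =>
    have := (HasDiskSeries.constant 0).congr (h' := diskEisensteinSum []) fun q _ => by
      simp [diskEisensteinSum]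
    simpa [eisensteinSum] using this
  | cons x L ih =>
    have := ((hasDiskSeries_seriesE2At (hL x (by simp))).const_mul ((x.1 * x.2 : ℂ) / 24)).add
      (ih fun y hy => hL y (by simp [hy]))
    simpa [eisensteinSum] using this.congr (h' := diskEisensteinSum (x :: L)) fun q _ => by
      simp [diskEisensteinSum]

theorem eulerQuotient_zero (L : List (ℕ × ℤ)) (hL : ∀ x ∈ L, x.1 ≠ 0) : eulerQuotient L 0 = 1 := by
  induction L with
  | nil => simp [eulerQuotient]
  | cons x L ih =>
    have := ih fun y hy => hL y (by simp [hy])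
    simp only [eulerQuotient, List.map_cons, List.prod_cons] at this ⊢
    rw [this, zero_pow (hL x (by simp)), eulerProd_zero]
    simp

/-- Logarithmic derivatives add. The constant subtracted is the exponent of q in front of the
corresponding eta quotient. -/
theorem exists_series_eulerQuotient (L : List (ℕ × ℤ)) (hL : ∀ x ∈ L, x.1 ≠ 0) :
    ∃ r, HasDiskSeries (eulerQuotient L) r ∧ eulerDeriv r = r * (eisensteinSum L -
      C (((L.map fun x => (x.1 : ℤ) * x.2).sum : ℤ) / 24 : ℂ)) := by
  induction L with
  | nil =>
    have := (HasDiskSeries.constant 1).congr (h' := eulerQuotient []) fun q _ => by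
      simp [eulerQuotient]
    refine ⟨1, by simpa using this, ?_⟩
    simp [eisensteinSum]
  | cons x L ih =>
    obtain ⟨r, hr, hr'⟩ := ih fun y hy => hL y (by simp [hy])
    obtain ⟨s, hs, hs'⟩ := exists_series_eulerProd_zpow (hL x (by simp)) x.2
    refine ⟨s * r, (hs.mul hr).congr fun q _ => by simp [eulerQuotient], ?_⟩
    rw [eulerDeriv_mul, hr', hs']
    simp only [eisensteinSum, List.map_cons, List.sum_cons]
    push_cast
    rw [add_div, map_add]
    ring

/-- The term in y⁻² measures the order of the eta quotient at the cusp 0, and the term in y⁻¹ its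
weight, half the sum of the exponents. -/
theorem diskEisensteinSum_axis_bound (L : List (ℕ × ℤ)) (hL : ∀ x ∈ L, x.1 ≠ 0) :
    ∃ C, ∀ y : ℝ, 0 < y → y ≤ 1 → ‖diskEisensteinSum L (axisQ y) +
      (L.map fun x => (x.2 / x.1 : ℂ)).sum / 24 * (y ^ 2 : ℂ)⁻¹ -
      ((L.map fun x => x.2).sum : ℤ) / 24 * (6 / (π * y))‖ ≤ C := by
  induction L with
  | nil => exact ⟨0, fun y _ _ => by simp [diskEisensteinSum]⟩
  | cons x L ih =>
    obtain ⟨C₁, h₁⟩ := ih fun y hy => hL y (by simp [hy])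
    obtain ⟨C₂, h₂⟩ := diskE2_axis_bound x.1 (hL x (by simp))
    have hk : (x.1 : ℂ) ≠ 0 := by exact_mod_cast hL x (by simp)
    refine ⟨‖(x.2 / 24 : ℂ)‖ * C₂ + C₁, fun y hy hy1 => ?_⟩
    have e := norm_add_le_of_le (norm_mul_le_of_le (le_refl ‖(x.2 / 24 : ℂ)‖) (h₂ y hy hy1))
      (h₁ y hy hy1)
    refine le_of_eq_of_le (congrArg _ ?_) e
    simp only [diskEisensteinSum, List.map_cons, List.sum_cons]
    push_cast
    field_simp
    ring

theorem eta_eq (z : ℂ) : ModularForm.eta z =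
    Complex.exp (2 * π * Complex.I * z / 24) * eulerProd (Complex.exp (2 * π * Complex.I * z)) := by
  simp [ModularForm.eta, eulerProd, Function.Periodic.qParam, ModularForm.eta_q]

theorem etaAt_eq (z : ℂ) (k : ℕ) : etaAt z k =
    Complex.exp (2 * π * Complex.I * z * (k / 24)) *
      eulerProd (Complex.exp (2 * π * Complex.I * z) ^ k) := by
  rw [etaAt, eta_eq, ← Complex.exp_nat_mul]
  ring_nf

theorem prod_etaAt_eq (L : List (ℕ × ℤ)) (z : ℂ) :
    (L.map fun x => etaAt z x.1 ^ x.2).prod =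
      Complex.exp (2 * π * Complex.I * z * (((L.map fun x => (x.1 : ℤ) * x.2).sum : ℤ) / 24)) *
        eulerQuotient L (Complex.exp (2 * π * Complex.I * z)) := by
  induction L with
  | nil => simp [eulerQuotient]
  | cons x L ih =>
    rw [List.map_cons, List.prod_cons, ih, etaAt_eq, mul_zpow, ← Complex.exp_int_mul]
    simp only [eulerQuotient, List.map_cons, List.prod_cons, List.sum_cons]
    push_cast
    rw [mul_mul_mul_comm, ← Complex.exp_add]
    congr 2
    ring

/-- All factors are real and positive, so the limit is nonnegative. It cannot be 0 because Euler's
product has no zero in the disc. -/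
theorem eulerProd_axis_pos {y : ℝ} (hy : 0 < y) : ∃ r : ℝ, 0 < r ∧ eulerProd (axisQ y) = r := by
  set x := Real.exp (-(2 * π * y)) with hx
  have hx1 : x < 1 := by
    have := norm_axisQ_lt hy
    rwa [norm_axisQ] at this
  have hx0 : 0 < x := Real.exp_pos _
  have h : Multipliable fun n : ℕ => 1 - x ^ (n + 1) := by
    simp_rw [sub_eq_add_neg]
    refine multipliable_one_add_of_summable ?_
    simpa [abs_of_pos hx0] using
      (summable_nat_add_iff 1).mpr (summable_geometric_of_lt_one hx0.le hx1)
  have he : eulerProd (axisQ y) = ((∏' n : ℕ, (1 - x ^ (n + 1)) : ℝ) : ℂ) := by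
    have := (h.hasProd.map Complex.ofRealHom Complex.continuous_ofReal).tprod_eq
    rw [eulerProd, axisQ]
    simp only [Function.comp_def, map_sub, map_one, map_pow] at this
    exact this
  refine ⟨∏' n : ℕ, (1 - x ^ (n + 1)), ?_, he⟩
  have h0 : 0 ≤ ∏' n : ℕ, (1 - x ^ (n + 1)) := by
    refine ge_of_tendsto' h.hasProd fun s => Finset.prod_nonneg fun n _ => ?_
    exact sub_nonneg.mpr (pow_le_one₀ hx0.le hx1.le)
  refine lt_of_le_of_ne h0 fun h1 => eulerProd_ne_zero (norm_axisQ_lt hy) ?_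
  rw [he, ← h1, Complex.ofReal_zero]

theorem eulerQuotient_axis_pos (L : List (ℕ × ℤ)) (hL : ∀ x ∈ L, x.1 ≠ 0) {y : ℝ} (hy : 0 < y) :
    ∃ r : ℝ, 0 < r ∧ eulerQuotient L (axisQ y) = r := by
  induction L with
  | nil => exact ⟨1, one_pos, by simp [eulerQuotient]⟩
  | cons x L ih =>
    obtain ⟨r, hr, e⟩ := ih fun y hy => hL y (by simp [hy])
    have hk : (0 : ℝ) < x.1 := by exact_mod_cast Nat.pos_of_ne_zero (hL x (by simp))
    obtain ⟨p, hp, e'⟩ := eulerProd_axis_pos (mul_pos hk hy)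
    refine ⟨p ^ x.2 * r, by positivity, ?_⟩
    simp only [eulerQuotient, List.map_cons, List.prod_cons] at e ⊢
    rw [e, axisQ_pow, e']
    push_cast
    rfl

end BeauvilleFamily

/-! ### From the unit disc to the imaginary axis -/

namespace BeauvilleFamily

open PowerSeries UpperHalfPlane Filter Metric MeasureTheory
open scoped Real Topology

/-- Functions of `q` on the unit disc which solve the differential equations attached to
`(A, B, λ)`, are positive on the positive imaginary axis, and have the growth near `z = 0` of
modular functions that are regular and non-zero there. -/
structure IsDiskSolution (A B l : ℤ) (t g φ : ℂ → ℂ) : Prop where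
  diff_t : DifferentiableOn ℂ t (ball 0 1)
  diff_g : DifferentiableOn ℂ g (ball 0 1)
  diff_φ : DifferentiableOn ℂ φ (ball 0 1)
  deriv_t : ∀ q, ‖q‖ < 1 → q * deriv t q = t q * (g q * (1 - A * t q + B * t q ^ 2))
  deriv_g : ∀ q, ‖q‖ < 1 → q * deriv g q = g q * (2 * φ q)
  deriv_φ : ∀ q, ‖q‖ < 1 → q * deriv φ q =
    φ q ^ 2 + g q ^ 2 * (1 - A * t q + B * t q ^ 2) * (l * t q - B * t q ^ 2)
  t_zero : t 0 = 0
  g_zero : g 0 = 1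
  pos_t : ∀ y > 0, ∃ r : ℝ, 0 < r ∧ t (axisQ y) = r
  pos_g : ∀ y > 0, ∃ r : ℝ, 0 < r ∧ g (axisQ y) = r
  bound : ∃ C, ∀ y : ℝ, 0 < y → y ≤ 1 →
    ‖g (axisQ y) * (1 - A * t (axisQ y) + B * t (axisQ y) ^ 2)‖ ≤ C ∧
      ‖φ (axisQ y) - (2 * π * y : ℂ)⁻¹‖ ≤ C

theorem IsSolution.isDiskSolution {A B l : ℤ} {T G Φ : ℂ⟦X⟧} (h : IsSolution A B l T G Φ)
    {t g φ : ℂ → ℂ} (ht : HasDiskSeries t T) (hg : HasDiskSeries g G) (hφ : HasDiskSeries φ Φ)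
    (pos_t : ∀ y > 0, ∃ r : ℝ, 0 < r ∧ t (axisQ y) = r)
    (pos_g : ∀ y > 0, ∃ r : ℝ, 0 < r ∧ g (axisQ y) = r)
    (bound : ∃ C, ∀ y : ℝ, 0 < y → y ≤ 1 →
      ‖g (axisQ y) * (1 - A * t (axisQ y) + B * t (axisQ y) ^ 2)‖ ≤ C ∧
        ‖φ (axisQ y) - (2 * π * y : ℂ)⁻¹‖ ≤ C) : IsDiskSolution A B l t g φ := by
  have hC : ∀ n : ℤ, C (n : ℂ) = (n : ℂ⟦X⟧) := fun n => map_intCast _ n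
  have hP : HasDiskSeries (fun q => 1 - A * t q + B * t q ^ 2) (1 - A * T + B * T ^ 2) := by
    have := ((HasDiskSeries.constant 1).sub (ht.const_mul A)).add ((ht.pow 2).const_mul B)
    rwa [hC, hC, map_one] at this
  have hW : HasDiskSeries (fun q => l * t q - B * t q ^ 2) (l * T - B * T ^ 2) := by
    have := (ht.const_mul l).sub ((ht.pow 2).const_mul B)
    rwa [hC, hC] at this
  refine ⟨ht.differentiableOn, hg.differentiableOn, hφ.differentiableOn, fun q hq => ?_,
    fun q hq => ?_, fun q hq => ?_, ?_, ?_, pos_t, pos_g, bound⟩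
  · exact HasDiskSeries.eq (h.derivT ▸ ht.eulerDeriv) (ht.mul (hg.mul hP)) hq
  · have := hg.mul (hφ.const_mul 2)
    rw [map_ofNat] at this
    exact HasDiskSeries.eq (h.derivG ▸ hg.eulerDeriv) this hq
  · exact HasDiskSeries.eq (h.derivΦ ▸ hφ.eulerDeriv)
      ((hφ.pow 2).add (((hg.pow 2).mul hP).mul hW)) hq
  · obtain ⟨τ, rfl, -⟩ := h.exists_T
    rw [ht.apply_zero]
    simp
  · rw [hg.apply_zero, h.constG]

namespace IsDiskSolution

variable {A B l : ℤ} {t g φ : ℂ → ℂ}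

theorem hasDerivAt_comp_axisQ {h : ℂ → ℂ} (hh : DifferentiableOn ℂ h (ball 0 1)) {y : ℝ}
    (hy : 0 < y) :
    HasDerivAt (fun y => h (axisQ y)) (-2 * π * (axisQ y * deriv h (axisQ y))) y :=
  (HasDiskSeries.of_differentiableOn hh).hasDerivAt_axis hy

theorem hasDerivAt_re {h : ℝ → ℂ} {h' : ℂ} {y : ℝ} (hh : HasDerivAt h h' y) :
    HasDerivAt (fun y => (h y).re) h'.re y :=
  (Complex.reCLM.hasFDerivAt.comp_hasDerivAt y hh)

theorem hasDerivAt_im {h : ℝ → ℂ} {h' : ℂ} {y : ℝ} (hh : HasDerivAt h h' y) :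
    HasDerivAt (fun y => (h y).im) h'.im y :=
  (Complex.imCLM.hasFDerivAt.comp_hasDerivAt y hh)

theorem t_real (h : IsDiskSolution A B l t g φ) {y : ℝ} (hy : 0 < y) : t (axisQ y) =
    ((t (axisQ y)).re : ℂ) := by
  obtain ⟨r, -, hr⟩ := h.pos_t y hy
  rw [hr, Complex.ofReal_re]

theorem g_real (h : IsDiskSolution A B l t g φ) {y : ℝ} (hy : 0 < y) : g (axisQ y) =
    ((g (axisQ y)).re : ℂ) := by
  obtain ⟨r, -, hr⟩ := h.pos_g y hy
  rw [hr, Complex.ofReal_re]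

theorem g_re_pos (h : IsDiskSolution A B l t g φ) {y : ℝ} (hy : 0 < y) : 0 < (g (axisQ y)).re := by
  obtain ⟨r, hr0, hr⟩ := h.pos_g y hy
  rwa [hr, Complex.ofReal_re]

/-- Since g is real along the axis, so is its logarithmic derivative, a real multiple of φ. -/
theorem φ_real (h : IsDiskSolution A B l t g φ) {y : ℝ} (hy : 0 < y) : φ (axisQ y) =
    ((φ (axisQ y)).re : ℂ) := by
  have h1 := hasDerivAt_im (hasDerivAt_comp_axisQ h.diff_g hy)
  have h2 : HasDerivAt (fun y => (g (axisQ y)).im) 0 y := by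
    refine (hasDerivAt_const y (0 : ℝ)).congr_of_eventuallyEq ?_
    filter_upwards [lt_mem_nhds hy] with x hx
    rw [h.g_real hx, Complex.ofReal_im]
  have h3 := h1.unique h2
  rw [h.deriv_g _ (norm_axisQ_lt hy), h.g_real hy] at h3
  have h4 : (-2 * π * ((g (axisQ y)).re * (2 * φ (axisQ y)) : ℂ)).im =
      -4 * π * (g (axisQ y)).re * (φ (axisQ y)).im := by
    simp
    ring
  rw [h4] at h3
  have h5 : (φ (axisQ y)).im = 0 := by
    have := h.g_re_pos hy
    have := Real.pi_pos
    rcases mul_eq_zero.mp h3 with h6 | h6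
    · nlinarith [mul_pos Real.pi_pos (h.g_re_pos hy)]
    · exact h6
  exact (Complex.ext rfl (by simp [h5]))

theorem isAxisSolution (h : IsDiskSolution A B l t g φ) :
    IsAxisSolution A B l (fun y => (t (axisQ y)).re)
    (fun y => √(g (axisQ y)).re) (fun y => (φ (axisQ y)).re)
    (fun y => (g (axisQ y)).re *
      (1 - A * (t (axisQ y)).re + B * (t (axisQ y)).re ^ 2)) where
  pos_t y hy := by
    obtain ⟨r, hr0, hr⟩ := h.pos_t y hy
    simpa [hr] using hr0
  pos_f y hy := Real.sqrt_pos.mpr (h.g_re_pos hy)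
  u_eq y hy := by
    simp only [Real.sq_sqrt (h.g_re_pos hy).le]
  deriv_t y hy := by
    have := hasDerivAt_re (hasDerivAt_comp_axisQ h.diff_t hy)
    refine this.congr_deriv ?_
    rw [h.deriv_t _ (norm_axisQ_lt hy), h.t_real hy, h.g_real hy, ← Complex.ofReal_re (_ * _)]
    congr 1
    push_cast
    simp only [Complex.ofReal_re]
    ring
  deriv_f y hy := by
    have h0 := h.g_re_pos hy
    have := (hasDerivAt_re (hasDerivAt_comp_axisQ h.diff_g hy)).sqrt h0.ne'
    refine this.congr_deriv ?_
    have e : (-2 * π * (axisQ y * deriv g (axisQ y)) : ℂ).re =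
        -4 * π * (g (axisQ y)).re * (φ (axisQ y)).re := by
      rw [h.deriv_g _ (norm_axisQ_lt hy), h.φ_real hy, h.g_real hy,
        ← Complex.ofReal_re (_ * _)]
      congr 1
      push_cast
      simp only [Complex.ofReal_re]
      ring
    rw [e]
    have hs := Real.sqrt_pos.mpr h0
    have := Real.sq_sqrt h0.le
    rw [div_eq_iff (by positivity)]
    linear_combination (4 * π * (φ (axisQ y)).re) * this
  deriv_φ y hy := by
    have := hasDerivAt_re (hasDerivAt_comp_axisQ h.diff_φ hy)
    refine this.congr_deriv ?_
    rw [Real.sq_sqrt (h.g_re_pos hy).le, h.deriv_φ _ (norm_axisQ_lt hy), h.t_real hy,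
      h.g_real hy, h.φ_real hy, ← Complex.ofReal_re (_ * _)]
    congr 1
    push_cast
    simp only [Complex.ofReal_re]
    ring
  at_top := by
    have hr : Real.exp (-(2 * π * 1)) < 1 := by
      rw [Real.exp_lt_one_iff]; linarith [Real.pi_pos]
    have hy : ∀ y : ℝ, 1 ≤ y → ‖axisQ y‖ ≤ Real.exp (-(2 * π * 1)) := fun y hy => by
      rw [norm_axisQ]; gcongr
    have dP : DifferentiableOn ℂ (fun q => g q * (1 - A * t q + B * t q ^ 2)) (ball 0 1) := by
      have := h.diff_t
      have := h.diff_g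
      fun_prop
    obtain ⟨M₁, -, h₁⟩ := (HasDiskSeries.of_differentiableOn h.diff_t).norm_sub_le hr
    obtain ⟨M₂, h₂⟩ := (HasDiskSeries.of_differentiableOn h.diff_g).norm_le hr
    obtain ⟨M₃, h₃⟩ := (HasDiskSeries.of_differentiableOn h.diff_φ).norm_le hr
    obtain ⟨M₄, h₄⟩ := (HasDiskSeries.of_differentiableOn dP).norm_le hr
    -- The interval includes q = 0, where g = 1. Its other points are values of q on the axis, where
    -- g > 0, so compactness bounds 1/g for all y ≥ 1.
    have hinv : ∃ M, ∀ x ∈ Set.Icc (0 : ℝ) (Real.exp (-(2 * π * 1))), ‖(g (x : ℂ))⁻¹‖ ≤ M := by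
      refine isCompact_Icc.exists_bound_of_continuousOn (ContinuousOn.inv₀ ?_ ?_)
      · refine h.diff_g.continuousOn.comp Complex.continuous_ofReal.continuousOn fun x hx => ?_
        rw [mem_ball_zero_iff, Complex.norm_real, Real.norm_eq_abs, abs_of_nonneg hx.1]
        exact hx.2.trans_lt hr
      · intro x hx
        rcases hx.1.eq_or_lt with rfl | hx0
        · simp [h.g_zero]
        · have e : (x : ℂ) = axisQ (-Real.log x / (2 * π)) := by
            rw [axisQ]
            congr 1
            rw [show -(2 * π * (-Real.log x / (2 * π))) = Real.log x by field_simp,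
              Real.exp_log hx0]
          have hpos : 0 < -Real.log x / (2 * π) := by
            have := Real.log_neg hx0 (hx.2.trans_lt hr)
            have := Real.pi_pos
            exact div_pos (by linarith) (by linarith)
          obtain ⟨r, hr0, hr⟩ := h.pos_g _ hpos
          rw [e, hr]
          exact_mod_cast hr0.ne'
    obtain ⟨M₅, h₅⟩ := hinv
    refine ⟨max M₁ (max (max M₂ 1) (max M₃ (max M₄ (max M₅ 1)))), fun y hy1 => ?_⟩
    have hy0 : 0 < y := one_pos.trans_le hy1
    have hg0 := h.g_re_pos hy0
    have hle : ∀ {x M : ℝ}, 0 ≤ x → x ≤ M → √x ≤ max M 1 := by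
      intro x M hx hxM
      rw [Real.sqrt_le_left (by positivity)]
      have h1 : 1 ≤ max M 1 := le_max_right _ _
      have h2 : M ≤ max M 1 := le_max_left _ _
      nlinarith
    refine ⟨?_, ?_, ?_, ?_, ?_⟩
    · have := h₁ _ (hy y hy1)
      rw [h.t_zero, sub_zero, norm_axisQ] at this
      refine (Complex.re_le_norm _).trans (this.trans ?_)
      gcongr
      exact le_max_left _ _
    · refine (hle hg0.le ((Complex.re_le_norm _).trans (h₂ _ (hy y hy1)))).trans ?_
      simp
    · have h6 := h₅ (Real.exp (-(2 * π * y))) ⟨(Real.exp_pos _).le, by gcongr⟩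
      have h7 : (g (axisQ y)).re⁻¹ ≤ M₅ := by
        refine le_of_eq_of_le ?_ h6
        change _ = ‖(g (axisQ y))⁻¹‖
        conv_rhs => rw [h.g_real hy0]
        rw [norm_inv, Complex.norm_real, Real.norm_eq_abs, abs_of_pos hg0]
      rw [← Real.sqrt_inv]
      refine (hle (inv_pos.mpr hg0).le h7).trans ?_
      simp
    · refine (Complex.abs_re_le_norm _).trans ((h₃ _ (hy y hy1)).trans ?_)
      simp
    · have := h₄ _ (hy y hy1)
      rw [h.t_real hy0, h.g_real hy0] at this
      refine le_of_eq_of_le ?_ (this.trans ?_)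
      · rw [← Real.norm_eq_abs, ← Complex.norm_real]
        push_cast
        rfl
      · simp
  at_zero := by
    obtain ⟨C, hC⟩ := h.bound
    refine ⟨C, fun y hy hy1 => ?_⟩
    obtain ⟨b1, b2⟩ := hC y hy hy1
    rw [h.t_real hy, h.g_real hy] at b1
    rw [h.φ_real hy] at b2
    constructor
    · refine le_of_eq_of_le ?_ b1
      rw [← Real.norm_eq_abs, ← Complex.norm_real]
      push_cast
      rfl
    · refine le_of_eq_of_le ?_ b2
      rw [← Real.norm_eq_abs, ← Complex.norm_real]
      push_cast
      rfl

end IsDiskSolution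

/-- The integral `Γ(s)` converges absolutely and satisfies the recurrence for `0 < Re s`. -/
def Case.SatisfiesRecurrence (c : Case) : Prop :=
    (∀ s : ℂ, 0 < s.re → IntegrableOn (c.gammaIntegrand s) (Set.Ioi (0 : ℝ))) ∧
    (∀ s : ℂ, 0 < s.re →
      s ^ 2 * c.Gamma s =
        ((c.coeffA : ℂ) * s * (s + 1) + (c.coeffLambda : ℂ)) * c.Gamma (s + 1) -
          (c.coeffB : ℂ) * (s + 1) ^ 2 * c.Gamma (s + 2))

/-- The recurrence for the functions of one of the six cases, once these are identified with a
solution of the differential equations. -/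
theorem recurrence_of_isDiskSolution (c : Case) (hB : c.coeffB ≠ 0) {t g φ : ℂ → ℂ}
    (h : IsDiskSolution c.coeffA c.coeffB c.coeffLambda t g φ)
    (ht : ∀ z : ℂ, 0 < z.im → c.t z = t (Complex.exp (2 * π * Complex.I * z)))
    (hf : ∀ y : ℝ, 0 < y → ∃ r : ℝ, 0 < r ∧ c.f (Complex.I * y) = r ∧ ((r : ℂ) ^ 2 = g (axisQ y))) :
    c.SatisfiesRecurrence := by
  have hA := h.isAxisSolution
  have hB' : (c.coeffB : ℝ) ≠ 0 := by exact_mod_cast hB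
  have key : ∀ s : ℂ, Set.EqOn (c.gammaIntegrand s) (axisIntegrand (fun y => (t (axisQ y)).re)
      (fun y => √(g (axisQ y)).re) (fun y => (g (axisQ y)).re *
      (1 - c.coeffA * (t (axisQ y)).re + c.coeffB * (t (axisQ y)).re ^ 2)) s) (Set.Ioi 0) := by
    intro s y hy
    have hy0 : 0 < y := hy
    obtain ⟨r, hr0, hr, hr2⟩ := hf y hy0
    have e1 : c.t (Complex.I * y) = ((t (axisQ y)).re : ℂ) := by
      rw [ht _ (by simpa using hy0), ← axisQ_eq_exp, ← h.t_real hy0]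
    have e2 : c.f (Complex.I * y) = (√(g (axisQ y)).re : ℝ) := by
      rw [hr, ← hr2, ← Complex.ofReal_pow, Complex.ofReal_re, Real.sqrt_sq hr0.le]
    -- The chain rule through q = exp(2πiz) turns dt/dz into 2πi ϑt, and the path z = iy contributes
    -- another factor i.
    have e3 : deriv c.t (Complex.I * y) * Complex.I =
        -2 * π * (t (axisQ y) * (g (axisQ y) *
          (1 - c.coeffA * t (axisQ y) + c.coeffB * t (axisQ y) ^ 2))) := by
      have h1 : c.t =ᶠ[𝓝 (Complex.I * y)]
          t ∘ fun z => Complex.exp (2 * π * Complex.I * z) := by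
        filter_upwards [isOpen_upperHalfPlaneSet.mem_nhds
          (show Complex.I * y ∈ upperHalfPlaneSet by simpa [upperHalfPlaneSet] using hy0)] with w hw
        exact ht w hw
      have h2 : HasDerivAt (fun z => Complex.exp (2 * π * Complex.I * z))
          (Complex.exp (2 * π * Complex.I * (Complex.I * y)) * (2 * π * Complex.I * 1))
          (Complex.I * y) := ((hasDerivAt_id _).const_mul (2 * π * Complex.I)).cexp
      have h3 := (HasDiskSeries.of_differentiableOn h.diff_t).differentiableAt (norm_axisQ_lt hy0)
      rw [axisQ_eq_exp] at h3
      have h4 := (h3.hasDerivAt.comp (Complex.I * y : ℂ) h2).deriv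
      rw [h1.deriv_eq, h4, ← axisQ_eq_exp, ← h.deriv_t _ (norm_axisQ_lt hy0)]
      linear_combination (2 * π * axisQ y * deriv t (axisQ y)) * Complex.I_sq
    rw [Case.gammaIntegrand, axisIntegrand, e3, e2, e1, h.t_real hy0, h.g_real hy0]
    push_cast
    simp only [Complex.ofReal_re]
    ring
  have hG : ∀ s, c.Gamma s = ∫ y in Set.Ioi 0, axisIntegrand (fun y => (t (axisQ y)).re)
      (fun y => √(g (axisQ y)).re) (fun y => (g (axisQ y)).re *
      (1 - c.coeffA * (t (axisQ y)).re + c.coeffB * (t (axisQ y)).re ^ 2)) s y :=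
    fun s => setIntegral_congr_fun measurableSet_Ioi (key s)
  refine ⟨fun s hs => (integrableOn_congr_fun (key s) measurableSet_Ioi).mpr
    (hA.integrableOn hB' hs), fun s hs => ?_⟩
  rw [hG, hG, hG]
  exact_mod_cast hA.recurrence hB' hs

end BeauvilleFamily

/-! ### The cases given by eta quotients -/

namespace BeauvilleFamily

open PowerSeries UpperHalfPlane Filter Metric MeasureTheory
open scoped Real Topology

/-- The numerical conditions say that t = q + …, of weight 0, and f = 1 + …, of weight 1, both of
order 0 at the cusp 0. The last two hypotheses match logarithmic derivatives with those of T and G,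
and the leading coefficients agree, so the series coincide. The sums over x.2 / x.1 kill the y⁻²
terms; the weights 0 and 1 give y⁻¹ terms 0 and 1/(2πy). -/
theorem isDiskSolution_eulerQuotient {A B l : ℤ} {T G Φ : ℂ⟦X⟧} (h : IsSolution A B l T G Φ)
    {L M : List (ℕ × ℤ)} (hL : ∀ x ∈ L, x.1 ≠ 0) (hM : ∀ x ∈ M, x.1 ≠ 0)
    (hL₁ : (L.map fun x => (x.1 : ℤ) * x.2).sum = 24) (hL₂ : (L.map fun x => x.2).sum = 0)
    (hL₃ : (L.map fun x => (x.2 / x.1 : ℂ)).sum = 0)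
    (hM₁ : (M.map fun x => (x.1 : ℤ) * x.2).sum = 0) (hM₂ : (M.map fun x => x.2).sum = 2)
    (hM₃ : (M.map fun x => (x.2 / x.1 : ℂ)).sum = 0)
    (hT : eisensteinSum L = G * (1 - A * T + B * T ^ 2)) (hΦ : eisensteinSum M = Φ) :
    IsDiskSolution A B l (fun q => q * eulerQuotient L q) (fun q => eulerQuotient M q ^ 2)
      (diskEisensteinSum M) := by
  have hL' := hasDiskSeries_eisensteinSum L hL
  have hM' := hasDiskSeries_eisensteinSum M hM
  obtain ⟨r, hr, hr'⟩ := exists_series_eulerQuotient L hL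
  obtain ⟨s, hs, hs'⟩ := exists_series_eulerQuotient M hM
  have hr0 : constantCoeff r = 1 := by rw [← hr.apply_zero, eulerQuotient_zero L hL]
  have hs0 : constantCoeff s = 1 := by rw [← hs.apply_zero, eulerQuotient_zero M hM]
  obtain ⟨τ, hτ, hτ0⟩ := h.exists_T
  have hT0 : constantCoeff T = 0 := by simp [hτ]
  have eT : X * r = T := by
    refine eq_of_eulerDeriv_eq_mul (m := 1) (v := G * (1 - A * T + B * T ^ 2)) ?_ h.derivT ?_ ?_
    · rw [eulerDeriv_mul, hr', hL₁, eulerDeriv_X, hT]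
      simp only [Int.cast_ofNat, ne_eq, OfNat.ofNat_ne_zero, not_false_eq_true, div_self, map_one]
      ring
    · simp [h.constG, hT0]
    · rw [hτ, ← zero_add 1, coeff_succ_X_mul, coeff_succ_X_mul, coeff_zero_eq_constantCoeff_apply,
        coeff_zero_eq_constantCoeff_apply, hr0, hτ0]
  have eG : s ^ 2 = G := by
    refine eq_of_eulerDeriv_eq_mul (m := 0) (v := 2 * Φ) ?_ h.derivG ?_ ?_
    · rw [eulerDeriv_pow, hs', hM₁, hΦ]
      simp only [Int.cast_zero, zero_div, map_zero, sub_zero, Nat.cast_ofNat, Nat.add_one_sub_one,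
        pow_one]
      ring
    · simp [h.constΦ]
    · rw [coeff_zero_eq_constantCoeff_apply, coeff_zero_eq_constantCoeff_apply, map_pow, hs0,
        h.constG, one_pow]
  have dT : HasDiskSeries (fun q => q * eulerQuotient L q) T := eT ▸ HasDiskSeries.id.mul hr
  have dG : HasDiskSeries (fun q => eulerQuotient M q ^ 2) G := eG ▸ hs.pow 2
  have hC : ∀ n : ℤ, C (n : ℂ) = (n : ℂ⟦X⟧) := fun n => map_intCast _ n
  have dU : HasDiskSeries (fun q => eulerQuotient M q ^ 2 *
      (1 - A * (q * eulerQuotient L q) + B * (q * eulerQuotient L q) ^ 2))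
      (G * (1 - A * T + B * T ^ 2)) := by
    have := dG.mul (((HasDiskSeries.constant 1).sub (dT.const_mul A)).add
      ((dT.pow 2).const_mul B))
    rwa [hC, hC, map_one] at this
  obtain ⟨C₁, h₁⟩ := diskEisensteinSum_axis_bound L hL
  obtain ⟨C₂, h₂⟩ := diskEisensteinSum_axis_bound M hM
  refine h.isDiskSolution dT dG (hΦ ▸ hM') (fun y hy => ?_) (fun y hy => ?_)
    ⟨max C₁ C₂, fun y hy hy1 => ⟨?_, ?_⟩⟩
  · obtain ⟨p, hp, e⟩ := eulerQuotient_axis_pos L hL hy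
    refine ⟨Real.exp (-(2 * π * y)) * p, by positivity, ?_⟩
    rw [e, axisQ]
    push_cast
    rfl
  · obtain ⟨p, hp, e⟩ := eulerQuotient_axis_pos M hM hy
    exact ⟨p ^ 2, by positivity, by rw [e]; push_cast; rfl⟩
  · rw [← HasDiskSeries.eq (hT ▸ hL') dU (norm_axisQ_lt hy)]
    have := h₁ y hy hy1
    rw [hL₂, hL₃] at this
    simp only [zero_div, zero_mul, add_zero, Int.cast_zero, sub_zero] at this
    exact this.trans (le_max_left _ _)
  · have := h₂ y hy hy1
    rw [hM₂, hM₃] at this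
    refine le_of_eq_of_le (congrArg _ ?_) (this.trans (le_max_right _ _))
    have hy' : (y : ℂ) ≠ 0 := by exact_mod_cast hy.ne'
    have hpi : (π : ℂ) ≠ 0 := by exact_mod_cast Real.pi_ne_zero
    push_cast
    field_simp
    ring

/-- The recurrence for a case given by eta quotients. -/
theorem recurrence_of_etaQuotient (c : Case) (hB : c.coeffB ≠ 0) {T G Φ : ℂ⟦X⟧}
    (h : IsSolution c.coeffA c.coeffB c.coeffLambda T G Φ)
    {L M : List (ℕ × ℤ)} (hL : ∀ x ∈ L, x.1 ≠ 0) (hM : ∀ x ∈ M, x.1 ≠ 0)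
    (hL₁ : (L.map fun x => (x.1 : ℤ) * x.2).sum = 24) (hL₂ : (L.map fun x => x.2).sum = 0)
    (hL₃ : (L.map fun x => (x.2 / x.1 : ℂ)).sum = 0)
    (hM₁ : (M.map fun x => (x.1 : ℤ) * x.2).sum = 0) (hM₂ : (M.map fun x => x.2).sum = 2)
    (hM₃ : (M.map fun x => (x.2 / x.1 : ℂ)).sum = 0)
    (hT : eisensteinSum L = G * (1 - c.coeffA * T + c.coeffB * T ^ 2)) (hΦ : eisensteinSum M = Φ)
    (ht : ∀ z, c.t z = (L.map fun x => etaAt z x.1 ^ x.2).prod)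
    (hf : ∀ z, c.f z = (M.map fun x => etaAt z x.1 ^ x.2).prod) :
    c.SatisfiesRecurrence := by
  refine recurrence_of_isDiskSolution c hB
    (isDiskSolution_eulerQuotient h hL hM hL₁ hL₂ hL₃ hM₁ hM₂ hM₃ hT hΦ) (fun z _ => ?_)
    fun y hy => ?_
  · rw [ht, prod_etaAt_eq, hL₁]
    simp
  · obtain ⟨p, hp, e⟩ := eulerQuotient_axis_pos M hM hy
    refine ⟨p, hp, ?_, by rw [e]⟩
    rw [hf, prod_etaAt_eq, hM₁, ← axisQ_eq_exp, e]
    simp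

theorem IsSolution.natCast_mul_seriesE2At {A B l : ℤ} {T G Φ : ℂ⟦X⟧}
    (h : IsSolution A B l T G Φ) {k : ℕ} (hk : k ≠ 0) {p a b d : Polynomial ℂ}
    (hc : IsCertificate A B l k 1 p a b d) :
    k * seriesE2At k = 12 * Φ + G * Polynomial.aeval T p := by
  have := h.eisenstein isRamanujan_eisenstein coeff_one_discriminant hk hc
  rwa [rescale_one, RingHom.id_apply, ← seriesE2At_of_ne hk] at this

theorem twentyFour_mul_C : (24 : ℂ⟦X⟧) * C (24 : ℂ)⁻¹ = 1 := by
  rw [← map_ofNat (C (R := ℂ)), ← map_mul]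
  norm_num

/-- Weighting kE₂(q^k) = 12Φ + G p(T) by the exponents of t cancels Φ and leaves 24 G(1 - AT + BT²).
The exponents of f add up to 2 and cancel the polynomials, leaving 24Φ. Cases C, E and G follow the
same pattern. -/
theorem satisfiesRecurrence_A : Case.A.SatisfiesRecurrence := by
  obtain ⟨T, G, Φ, h⟩ := exists_isSolution 7 (-8) 2
  have h1 := h.natCast_mul_seriesE2At (by norm_num) isCertificate_A_1
  have h2 := h.natCast_mul_seriesE2At (by norm_num) isCertificate_A_2
  have h3 := h.natCast_mul_seriesE2At (by norm_num) isCertificate_A_3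
  have h6 := h.natCast_mul_seriesE2At (by norm_num) isCertificate_A_6
  have h24 := twentyFour_mul_C
  simp [map_ofNat] at h1 h2 h3 h6
  refine recurrence_of_etaQuotient .A (by decide) h
    (L := [(1, 3), (6, 9), (2, -3), (3, -9)]) (M := [(2, 1), (3, 6), (1, -2), (6, -3)])
    (by simp) (by simp) (by simp) (by simp) (by norm_num) (by simp) (by simp) (by norm_num)
    ?_ ?_ (fun z => ?_) (fun z => ?_)
  · simp [eisensteinSum, div_eq_mul_inv, Case.coeffA, Case.coeffB]
    linear_combination C (24 : ℂ)⁻¹ * (3 * h1 + 9 * h6 - 3 * h2 - 9 * h3) +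
      G * (1 - 7 * T - 8 * T ^ 2) * h24
  · simp [eisensteinSum, div_eq_mul_inv]
    linear_combination C (24 : ℂ)⁻¹ * (1 * h2 + 6 * h3 - 2 * h1 - 3 * h6) + Φ * h24
  · simp [Case.t, zpow_neg]
    field_simp
  · simp [Case.f, zpow_neg]
    field_simp

theorem satisfiesRecurrence_C : Case.C.SatisfiesRecurrence := by
  obtain ⟨T, G, Φ, h⟩ := exists_isSolution 10 9 3
  have h1 := h.natCast_mul_seriesE2At (by norm_num) isCertificate_C_1
  have h2 := h.natCast_mul_seriesE2At (by norm_num) isCertificate_C_2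
  have h3 := h.natCast_mul_seriesE2At (by norm_num) isCertificate_C_3
  have h6 := h.natCast_mul_seriesE2At (by norm_num) isCertificate_C_6
  have h24 := twentyFour_mul_C
  simp [map_ofNat] at h1 h2 h3 h6
  refine recurrence_of_etaQuotient .C (by decide) h
    (L := [(1, 4), (6, 8), (2, -8), (3, -4)]) (M := [(2, 6), (3, 1), (1, -3), (6, -2)])
    (by simp) (by simp) (by simp) (by simp) (by norm_num) (by simp) (by simp) (by norm_num)
    ?_ ?_ (fun z => ?_) (fun z => ?_)
  · simp [eisensteinSum, div_eq_mul_inv, Case.coeffA, Case.coeffB]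
    linear_combination C (24 : ℂ)⁻¹ * (4 * h1 + 8 * h6 - 8 * h2 - 4 * h3) +
      G * (1 - 10 * T + 9 * T ^ 2) * h24
  · simp [eisensteinSum, div_eq_mul_inv]
    linear_combination C (24 : ℂ)⁻¹ * (6 * h2 + 1 * h3 - 3 * h1 - 2 * h6) + Φ * h24
  · simp [Case.t, zpow_neg]
    field_simp
  · simp [Case.f, zpow_neg]
    field_simp

theorem satisfiesRecurrence_E : Case.E.SatisfiesRecurrence := by
  obtain ⟨T, G, Φ, h⟩ := exists_isSolution 12 32 4
  have h1 := h.natCast_mul_seriesE2At (by norm_num) isCertificate_E_1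
  have h2 := h.natCast_mul_seriesE2At (by norm_num) isCertificate_E_2
  have h4 := h.natCast_mul_seriesE2At (by norm_num) isCertificate_E_4
  have h8 := h.natCast_mul_seriesE2At (by norm_num) isCertificate_E_8
  have h24 := twentyFour_mul_C
  simp [map_ofNat] at h1 h2 h4 h8
  refine recurrence_of_etaQuotient .E (by decide) h
    (L := [(1, 4), (4, 2), (8, 4), (2, -10)]) (M := [(2, 10), (1, -4), (4, -4)])
    (by simp) (by simp) (by simp) (by simp) (by norm_num) (by simp) (by simp) (by norm_num)
    ?_ ?_ (fun z => ?_) (fun z => ?_)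
  · simp [eisensteinSum, div_eq_mul_inv, Case.coeffA, Case.coeffB]
    linear_combination C (24 : ℂ)⁻¹ * (4 * h1 + 2 * h4 + 4 * h8 - 10 * h2) +
      G * (1 - 12 * T + 32 * T ^ 2) * h24
  · simp [eisensteinSum, div_eq_mul_inv]
    linear_combination C (24 : ℂ)⁻¹ * (10 * h2 - 4 * h1 - 4 * h4) + Φ * h24
  · simp [Case.t, zpow_neg]
    field_simp
  · simp [Case.f, zpow_neg]
    field_simp

theorem satisfiesRecurrence_G : Case.G.SatisfiesRecurrence := by
  obtain ⟨T, G, Φ, h⟩ := exists_isSolution 0 (-16) 0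
  have h2 := h.natCast_mul_seriesE2At (by norm_num) isCertificate_G_2
  have h4 := h.natCast_mul_seriesE2At (by norm_num) isCertificate_G_4
  have h8 := h.natCast_mul_seriesE2At (by norm_num) isCertificate_G_8
  have h24 := twentyFour_mul_C
  simp [map_ofNat] at h2 h4 h8
  refine recurrence_of_etaQuotient .G (by decide) h
    (L := [(2, 4), (8, 8), (4, -12)]) (M := [(4, 10), (2, -4), (8, -4)])
    (by simp) (by simp) (by simp) (by simp) (by norm_num) (by simp) (by simp) (by norm_num)
    ?_ ?_ (fun z => ?_) (fun z => ?_)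
  · simp [eisensteinSum, div_eq_mul_inv, Case.coeffA, Case.coeffB]
    linear_combination C (24 : ℂ)⁻¹ * (4 * h2 + 8 * h8 - 12 * h4) +
      G * (1 - 16 * T ^ 2) * h24
  · simp [eisensteinSum, div_eq_mul_inv]
    linear_combination C (24 : ℂ)⁻¹ * (10 * h4 - 4 * h2 - 4 * h8) + Φ * h24
  · simp [Case.t, zpow_neg]
    field_simp
  · simp [Case.f, zpow_neg]
    field_simp

/-- The Hecke relation at the prime 2. With m = 2^a r and r odd, it reduces to σ(2^b) = 2^(b+1) - 1.
-/
theorem sigma_one_two_mul (m : ℕ) (hm : m ≠ 0) :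
    ArithmeticFunction.sigma 1 (2 * m) + 2 * (if 2 ∣ m then ArithmeticFunction.sigma 1
        (m / 2) else 0) =
      3 * ArithmeticFunction.sigma 1 m := by
  obtain ⟨a, r, hr, rfl⟩ := Nat.exists_eq_two_pow_mul_odd hm
  have hco : ∀ b, ArithmeticFunction.sigma 1 (2 ^ b * r) =
      (2 ^ (b + 1) - 1) * ArithmeticFunction.sigma 1 r := fun b => by
    rw [ArithmeticFunction.isMultiplicative_sigma.map_mul_of_coprime
      (Nat.Coprime.pow_left b (Nat.coprime_two_left.mpr hr)),
      ArithmeticFunction.sigma_one_apply_prime_pow Nat.prime_two, Nat.geomSum_eq le_rfl]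
    simp
  rw [← mul_assoc, ← pow_succ', hco, hco]
  cases a with
  | zero =>
    rw [if_neg (by simpa [← even_iff_two_dvd] using hr)]
    norm_num
  | succ a =>
    rw [if_pos (by rw [pow_succ']; exact ⟨2 ^ a * r, by ring⟩),
      show 2 ^ (a + 1) * r / 2 = 2 ^ a * r by rw [pow_succ', mul_assoc]; simp, hco]
    have h1 : 1 ≤ 2 ^ a := Nat.one_le_two_pow
    obtain ⟨n, hn⟩ := Nat.exists_eq_add_of_le h1
    have e1 : 2 ^ (a + 1 + 1 + 1) - 1 = 7 + 8 * n := by rw [pow_succ, pow_succ, pow_succ, hn]; omega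
    have e2 : 2 ^ (a + 1 + 1) - 1 = 3 + 4 * n := by rw [pow_succ, pow_succ, hn]; omega
    have e3 : 2 ^ (a + 1) - 1 = 1 + 2 * n := by rw [pow_succ, hn]; omega
    rw [e1, e2, e3]
    ring

theorem coeff_seriesE2 (n : ℕ) : coeff n seriesE2 =
    if n = 0 then 1 else -24 * (ArithmeticFunction.sigma 1 n : ℂ) := coeff_mk _ _

/-- The twist of `E₂` by the sign character. -/
theorem rescale_neg_one_seriesE2 : rescale (-1) seriesE2 =
    6 * seriesE2At 2 - seriesE2 - 4 * seriesE2At 4 := by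
  ext n
  rw [seriesE2At_of_ne two_ne_zero, seriesE2At_of_ne four_ne_zero, map_sub, map_sub,
    coeff_ofNat_mul, coeff_ofNat_mul, coeff_rescale, coeff_expand, coeff_expand, coeff_seriesE2,
    coeff_seriesE2, coeff_seriesE2]
  rcases Nat.even_or_odd' n with ⟨m, rfl | rfl⟩
  · rcases eq_or_ne m 0 with rfl | hm
    · norm_num
    have h := sigma_one_two_mul m hm
    have h2 : 2 * m / 4 = m / 2 := by omega
    rw [if_pos (dvd_mul_right 2 m), if_neg (by omega), Nat.mul_div_cancel_left m two_pos,
      if_neg hm, h2, pow_mul]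
    by_cases hd : 2 ∣ m
    · rw [if_pos hd] at h
      rw [if_pos (by omega), if_neg (by omega)]
      have h' := congrArg (Nat.cast (R := ℂ)) h
      push_cast at h'
      linear_combination -48 * h'
    · rw [if_neg hd] at h
      rw [if_neg (by omega)]
      have h' := congrArg (Nat.cast (R := ℂ)) h
      push_cast at h'
      linear_combination -48 * h'
  · rw [if_neg (by omega), if_neg (by omega), if_neg (by omega), Odd.neg_one_pow ⟨m, rfl⟩]
    ring

theorem seriesE2At_one : seriesE2At 1 = seriesE2 := by
  rw [seriesE2At_of_ne one_ne_zero, expand_one_apply]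

theorem expand_seriesE2At {k m : ℕ} (hk : k ≠ 0) (hm : m ≠ 0) :
    expand k hk (seriesE2At m) = seriesE2At (k * m) := by
  rw [seriesE2At_of_ne hm, seriesE2At_of_ne (mul_ne_zero hk hm), expand_mul k hk m hm]

/-- η₁ and η₄ occur with equal exponents, and so do η₃ and η₁₂. Hence only E₂(q) + 4E₂(q⁴) = 6E₂(q²)
- E₂(-q) and its analogue in q³ are needed, which the certificates at -q and -q³ supply. -/
theorem satisfiesRecurrence_F : Case.F.SatisfiesRecurrence := by
  obtain ⟨T, G, Φ, h⟩ := exists_isSolution 17 72 6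
  have h1 := h.eisenstein isRamanujan_eisenstein coeff_one_discriminant one_ne_zero
    isCertificate_F_1
  have h2 := h.natCast_mul_seriesE2At (by norm_num) isCertificate_F_2
  have h3 := h.eisenstein isRamanujan_eisenstein coeff_one_discriminant three_ne_zero
    isCertificate_F_3
  have h6 := h.natCast_mul_seriesE2At (by norm_num) isCertificate_F_6
  have h24 := twentyFour_mul_C
  rw [rescale_neg_one_seriesE2, ← seriesE2At_one] at h1 h3
  simp [map_ofNat, expand_seriesE2At] at h1 h2 h3 h6
  refine recurrence_of_etaQuotient .F (by decide) h
    (L := [(1, 5), (3, 1), (4, 5), (6, 2), (12, 1), (2, -14)])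
    (M := [(2, 15), (3, 2), (12, 2), (1, -6), (4, -6), (6, -5)])
    (by simp) (by simp) (by simp) (by simp) (by norm_num) (by simp) (by simp) (by norm_num)
    ?_ ?_ (fun z => ?_) (fun z => ?_)
  · simp [eisensteinSum, div_eq_mul_inv, Case.coeffA, Case.coeffB]
    linear_combination C (24 : ℂ)⁻¹ * (-5 * h1 + h2 - h3 + 5 * h6) +
      G * (1 - 17 * T + 72 * T ^ 2) * h24
  · simp [eisensteinSum, div_eq_mul_inv]
    linear_combination C (24 : ℂ)⁻¹ * (6 * h1 - 3 * h2 - 2 * h3 + h6) + Φ * h24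
  · simp [Case.t, zpow_neg]
    field_simp
  · simp [Case.f, zpow_neg]
    field_simp

end BeauvilleFamily

namespace BeauvilleFamily

open Filter
open scoped Topology

/-! ### The Jacobi triple product -/

/-- The finite product `∏ (1 - qⁱ)` over `1 ≤ i ≤ n`. -/
noncomputable def qFactorial (q : ℂ) (n : ℕ) : ℂ := ∏ i ∈ Finset.range n, (1 - q ^ (i + 1))

/-- The inverse of `qFactorial`, extended by zero to negative integers. -/
noncomputable def invQFactorial (q : ℂ) (m : ℤ) : ℂ :=
  if 0 ≤ m then (qFactorial q m.toNat)⁻¹ else 0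

/-- The `q`-binomial coefficient `2n` over `n + k`. -/
noncomputable def centralQBinomial (q : ℂ) (n : ℕ) (k : ℤ) : ℂ :=
  qFactorial q (2 * n) * invQFactorial q (n - k) * invQFactorial q (n + k)

section TripleProduct

variable {q : ℂ}

theorem one_sub_pow_ne_zero (hq : ‖q‖ < 1) (n : ℕ) : 1 - q ^ (n + 1) ≠ 0 := by
  rw [sub_ne_zero]
  intro h
  have := congrArg norm h
  rw [norm_one, norm_pow] at this
  exact (pow_lt_one₀ (norm_nonneg q) hq n.succ_ne_zero).ne this.symm

theorem qFactorial_ne_zero (hq : ‖q‖ < 1) (n : ℕ) : qFactorial q n ≠ 0 :=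
  Finset.prod_ne_zero_iff.mpr fun i _ => one_sub_pow_ne_zero hq i

theorem qFactorial_succ (n : ℕ) : qFactorial q (n + 1) = qFactorial q n * (1 - q ^ (n + 1)) :=
  Finset.prod_range_succ _ _

/-- The convention 1/(q)_m = 0 for m < 0 makes this hold for all integers, so the q-binomial
recurrence needs no boundary cases. -/
theorem one_sub_mul_invQFactorial (hq : ‖q‖ < 1) (m : ℤ) :
    (1 - q ^ m) * invQFactorial q m = invQFactorial q (m - 1) := by
  rcases lt_trichotomy m 0 with h | rfl | h
  · rw [invQFactorial, invQFactorial, if_neg (by omega), if_neg (by omega), mul_zero]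
  · rw [invQFactorial, invQFactorial, if_neg (by omega : ¬ (0 : ℤ) ≤ 0 - 1)]
    simp
  · obtain ⟨n, rfl⟩ : ∃ n : ℕ, m = n + 1 := ⟨(m - 1).toNat, by omega⟩
    rw [invQFactorial, invQFactorial, if_pos (by omega), if_pos (by omega)]
    have h1 : ((n : ℤ) + 1).toNat = n + 1 := by omega
    have h2 : ((n : ℤ) + 1 - 1).toNat = n := by omega
    rw [h1, h2, qFactorial_succ]
    have := one_sub_pow_ne_zero hq n
    have := qFactorial_ne_zero hq n
    rw [← Nat.cast_succ, zpow_natCast]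
    field_simp

theorem centralQBinomial_eq_zero {n : ℕ} {k : ℤ} (h : (n : ℤ) < |k|) :
    centralQBinomial q n k = 0 := by
  rw [centralQBinomial]
  rcases lt_abs.mp h with h | h
  · rw [invQFactorial, if_neg (by omega), mul_zero, zero_mul]
  · rw [invQFactorial, invQFactorial, if_neg (by omega : ¬ 0 ≤ (n : ℤ) + k), mul_zero]

theorem centralQBinomial_zero (k : ℤ) : centralQBinomial q 0 k = if k = 0 then 1 else 0 := by
  split_ifs with h
  · subst h
    simp [centralQBinomial, invQFactorial, qFactorial]
  · exact centralQBinomial_eq_zero (by simpa using h)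

/-- The q-Pascal rule applied twice, since the upper index 2n grows by 2. -/
theorem centralQBinomial_succ (hq0 : q ≠ 0) (hq : ‖q‖ < 1) (n : ℕ) (k : ℤ) :
    centralQBinomial q (n + 1) k = centralQBinomial q n k * (1 + q ^ (2 * n + 1)) +
      q ^ (n + 1 - k : ℤ) * centralQBinomial q n (k - 1) +
      q ^ (n + 1 + k : ℤ) * centralQBinomial q n (k + 1) := by
  set a : ℤ := n - k with ha
  set b : ℤ := n + k with hb
  have ra := one_sub_mul_invQFactorial hq (a + 1)
  have ra' := one_sub_mul_invQFactorial hq a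
  have rb := one_sub_mul_invQFactorial hq (b + 1)
  have rb' := one_sub_mul_invQFactorial hq b
  rw [add_sub_cancel_right] at ra rb
  have hab : q ^ (2 * n) = q ^ a * q ^ b := by
    rw [← zpow_add₀ hq0, ← zpow_natCast]
    congr 1
    push_cast
    omega
  simp only [centralQBinomial]
  rw [show ((n + 1 : ℕ) : ℤ) - k = a + 1 by push_cast; omega,
    show ((n + 1 : ℕ) : ℤ) + k = b + 1 by push_cast; omega,
    show (n : ℤ) - (k - 1) = a + 1 by omega, show (n : ℤ) + (k - 1) = b - 1 by omega,
    show (n : ℤ) - (k + 1) = a - 1 by omega, show (n : ℤ) + (k + 1) = b + 1 by omega,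
    show (n : ℤ) + 1 - k = a + 1 by omega, show (n : ℤ) + 1 + k = b + 1 by omega,
    ← ra', ← rb', ← ra, ← rb, show 2 * (n + 1) = 2 * n + 1 + 1 by ring, qFactorial_succ,
    qFactorial_succ, pow_succ q (2 * n + 1), pow_succ q (2 * n), hab, zpow_add_one₀ hq0,
    zpow_add_one₀ hq0]
  ring

theorem summable_mul_centralQBinomial (w : ℤ → ℂ) (n : ℕ) :
    Summable fun k => w k * centralQBinomial q n k := by
  refine summable_of_ne_finset_zero (s := Finset.Icc (-n : ℤ) n) fun k hk => ?_
  rw [centralQBinomial_eq_zero, mul_zero]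
  rw [Finset.mem_Icc, not_and_or] at hk
  rw [lt_abs]
  omega

/-- Here w k = (-x)^k q^(k(k-1)/2), encoded by its recursion. Multiplying out the two new factors
shifts the summation index by one in each direction, which matches `centralQBinomial_succ`. -/
theorem finite_tripleProduct (hq0 : q ≠ 0) (hq : ‖q‖ < 1) {x : ℂ} (hx : x ≠ 0) {w : ℤ → ℂ}
    (hw0 : w 0 = 1) (hw : ∀ k, w (k + 1) = -x * q ^ k * w k) (n : ℕ) :
    ∏ i ∈ Finset.range n, (1 - x * q ^ i) * (1 - x⁻¹ * q ^ (i + 1)) =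
      ∑' k, w k * centralQBinomial q n k := by
  induction n with
  | zero =>
    rw [tsum_eq_single 0 fun k hk => by rw [centralQBinomial_zero, if_neg hk, mul_zero]]
    simp [centralQBinomial_zero, hw0]
  | succ n ih =>
    have s := summable_mul_centralQBinomial (q := q) w n
    have e1 : ∑' k, w k * (q ^ (n + 1 - k : ℤ) * centralQBinomial q n (k - 1)) =
        -x * q ^ n * ∑' k, w k * centralQBinomial q n k := by
      rw [← tsum_mul_left, ← (Equiv.addRight (1 : ℤ)).tsum_eq]
      refine tsum_congr fun k => ?_
      simp only [Equiv.coe_addRight, hw, add_sub_cancel_right]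
      rw [show (n : ℤ) + 1 - (k + 1) = n - k by ring, zpow_sub₀ hq0, zpow_natCast]
      have := zpow_ne_zero k hq0
      field_simp
    have e2 : ∑' k, w k * (q ^ (n + 1 + k : ℤ) * centralQBinomial q n (k + 1)) =
        -x⁻¹ * q ^ (n + 1) * ∑' k, w k * centralQBinomial q n k := by
      rw [← tsum_mul_left, ← (Equiv.addRight (1 : ℤ)).tsum_eq (fun k => _ * (w k * _))]
      refine tsum_congr fun k => ?_
      simp only [Equiv.coe_addRight, hw]
      rw [zpow_add₀ hq0, ← Nat.cast_succ, zpow_natCast]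
      field_simp
    have s1 : Summable fun k => w k * (q ^ (n + 1 - k : ℤ) * centralQBinomial q n (k - 1)) := by
      refine summable_of_ne_finset_zero (s := Finset.Icc (-(n + 1) : ℤ) (n + 1)) fun k hk => ?_
      rw [centralQBinomial_eq_zero, mul_zero, mul_zero]
      rw [Finset.mem_Icc, not_and_or] at hk
      rw [lt_abs]
      omega
    have s2 : Summable fun k => w k * (q ^ (n + 1 + k : ℤ) * centralQBinomial q n (k + 1)) := by
      refine summable_of_ne_finset_zero (s := Finset.Icc (-(n + 1) : ℤ) (n + 1)) fun k hk => ?_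
      rw [centralQBinomial_eq_zero, mul_zero, mul_zero]
      rw [Finset.mem_Icc, not_and_or] at hk
      rw [lt_abs]
      omega
    have e : ∑' k, w k * centralQBinomial q (n + 1) k =
        (1 + q ^ (2 * n + 1)) * (∑' k, w k * centralQBinomial q n k) +
        (∑' k, w k * (q ^ (n + 1 - k : ℤ) * centralQBinomial q n (k - 1))) +
        ∑' k, w k * (q ^ (n + 1 + k : ℤ) * centralQBinomial q n (k + 1)) := by
      rw [← tsum_mul_left, ← (s.mul_left _).tsum_add s1, ← ((s.mul_left _).add s1).tsum_add s2]
      refine tsum_congr fun k => ?_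
      rw [centralQBinomial_succ hq0 hq]
      ring
    rw [Finset.prod_range_succ, ih, e, e1, e2]
    field_simp
    ring

theorem tendsto_qFactorial (hq : ‖q‖ < 1) : Tendsto (qFactorial q) atTop (𝓝 (eulerProd q)) :=
  (ModularForm.multipliable_one_sub_pow hq).hasProd.tendsto_prod_nat

/-- For fixed k the central q-binomial tends to 1/∏(1 - qⁿ). It is bounded uniformly in n and k, so
dominated convergence applies. -/
theorem tendsto_tsum_mul_centralQBinomial (hq : ‖q‖ < 1) {w : ℤ → ℂ} (hw : Summable w) :
    Tendsto (fun n => ∑' k, w k * centralQBinomial q n k) atTop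
      (𝓝 ((∑' k, w k) * (eulerProd q)⁻¹)) := by
  have hP := eulerProd_ne_zero hq
  have t1 := tendsto_qFactorial hq
  have t2 := t1.inv₀ hP
  obtain ⟨K₁, h₁⟩ := (Metric.isBounded_range_of_tendsto _ t1).exists_norm_le
  obtain ⟨K₂, h₂⟩ := (Metric.isBounded_range_of_tendsto _ t2).exists_norm_le
  have hK₂ : 0 ≤ K₂ := (norm_nonneg _).trans (h₂ _ ⟨0, rfl⟩)
  have hK₁ : 0 ≤ K₁ := (norm_nonneg _).trans (h₁ _ ⟨0, rfl⟩)
  have b2 : ∀ m, ‖invQFactorial q m‖ ≤ K₂ := fun m => by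
    rw [invQFactorial]
    split_ifs
    · exact h₂ _ ⟨m.toNat, rfl⟩
    · simpa using hK₂
  have lim : ∀ (f : ℕ → ℤ), Tendsto f atTop atTop →
      Tendsto (fun n => invQFactorial q (f n)) atTop (𝓝 (eulerProd q)⁻¹) := by
    intro f hf
    have hf' : Tendsto (fun n => (f n).toNat) atTop atTop := by
      rw [tendsto_atTop] at hf ⊢
      exact fun b => (hf b).mono fun n hn => by omega
    refine (t2.comp hf').congr' ?_
    filter_upwards [hf.eventually_ge_atTop 0] with n hn
    rw [invQFactorial, if_pos hn]
    rfl
  rw [← tsum_mul_right]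
  refine tendsto_tsum_of_dominated_convergence (bound := fun k => ‖w k‖ * (K₁ * K₂ * K₂))
    (hw.norm.mul_right _) (fun k => ?_) (.of_forall fun n k => ?_)
  · refine Tendsto.const_mul _ ?_
    have hc : Tendsto (fun n : ℕ => (n : ℤ)) atTop atTop := tendsto_natCast_atTop_atTop
    have l1 := lim (fun n => n - k) (tendsto_atTop_add_const_right _ (-k) hc)
    have l2 := lim (fun n => n + k) (tendsto_atTop_add_const_right _ k hc)
    have l0 : Tendsto (fun n : ℕ => qFactorial q (2 * n)) atTop (𝓝 (eulerProd q)) :=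
      t1.comp (tendsto_id.const_mul_atTop' two_pos)
    have := (l0.mul l1).mul l2
    rwa [mul_inv_cancel₀ hP, one_mul] at this
  · rw [centralQBinomial, norm_mul, norm_mul, norm_mul]
    gcongr
    · exact h₁ _ ⟨2 * n, rfl⟩
    · exact b2 _
    · exact b2 _

theorem tendsto_tripleProduct (hq0 : q ≠ 0) (hq : ‖q‖ < 1) {x : ℂ} (hx : x ≠ 0) {w : ℤ → ℂ}
    (hw0 : w 0 = 1) (hw : ∀ k, w (k + 1) = -x * q ^ k * w k) (hs : Summable w) :
    Tendsto (fun n => ∏ i ∈ Finset.range n, (1 - x * q ^ i) * (1 - x⁻¹ * q ^ (i + 1))) atTop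
      (𝓝 ((∑' k, w k) * (eulerProd q)⁻¹)) := by
  simp_rw [finite_tripleProduct hq0 hq hx hw0 hw]
  exact tendsto_tsum_mul_centralQBinomial hq hs

/-- Jacobi's formula for the cube of Euler's product. -/
theorem eulerProd_pow_three (hq0 : q ≠ 0) (hq : ‖q‖ < 1) {w : ℤ → ℂ}
    (hw0 : w 0 = 1) (hw : ∀ k, w (k + 1) = -q ^ k * w k) (hs : Summable fun k => k * w k) :
    eulerProd q ^ 3 = -∑' k : ℤ, k * w k := by
  have hP := eulerProd_ne_zero hq
  have key : ∀ n : ℕ, ∑' k : ℤ, (k * w k) * centralQBinomial q (n + 1) k =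
      -(qFactorial q n * qFactorial q (n + 1)) := by
    intro n
    -- R is the finite triple product at level n + 1 without its factor 1 - x. Differentiating (1 -
    -- x)R(x) at x = 1 therefore gives -R(1), while the sum side gains the factor k.
    set R : ℂ → ℂ := fun x => (∏ i ∈ Finset.range n, (1 - x * q ^ (i + 1))) *
      ∏ i ∈ Finset.range (n + 1), (1 - x⁻¹ * q ^ (i + 1)) with hR
    have hfin : ∀ v : ℤ → ℂ, ∑' k : ℤ, v k * centralQBinomial q (n + 1) k =
        ∑ k ∈ Finset.Icc (-(n + 1) : ℤ) (n + 1), v k * centralQBinomial q (n + 1) k := fun v => by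
      refine tsum_eq_sum fun k hk => ?_
      rw [centralQBinomial_eq_zero, mul_zero]
      rw [Finset.mem_Icc, not_and_or] at hk
      rw [lt_abs]
      push_cast
      omega
    have hd1 : HasDerivAt (fun x : ℂ => ∑ k ∈ Finset.Icc (-(n + 1) : ℤ) (n + 1),
        (x ^ k * w k) * centralQBinomial q (n + 1) k)
        (∑ k ∈ Finset.Icc (-(n + 1) : ℤ) (n + 1), (k * w k) * centralQBinomial q (n + 1) k) 1 := by
      refine HasDerivAt.fun_sum fun k _ => ?_
      have := ((hasDerivAt_zpow k (1 : ℂ) (Or.inl one_ne_zero)).mul_const (w k)).mul_const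
        (centralQBinomial q (n + 1) k)
      simpa using this
    have hRd : DifferentiableAt ℂ R 1 := by
      have h1 : ∀ i, DifferentiableAt ℂ (fun x : ℂ => 1 - x * q ^ (i + 1)) 1 := fun i => by fun_prop
      have h2 : ∀ i, DifferentiableAt ℂ (fun x : ℂ => 1 - x⁻¹ * q ^ (i + 1)) 1 := fun i => by
        have : DifferentiableAt ℂ (fun x : ℂ => x⁻¹) 1 := differentiableAt_inv one_ne_zero
        fun_prop
      exact (DifferentiableAt.fun_finsetProd fun i _ => h1 i).mul
        (DifferentiableAt.fun_finsetProd fun i _ => h2 i)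
    have hd2 : HasDerivAt (fun x : ℂ => (1 - x) * R x) (-R 1) 1 := by
      have := ((hasDerivAt_id (1 : ℂ)).const_sub 1).fun_mul hRd.hasDerivAt
      simpa using this
    have heq : (fun x : ℂ => ∑ k ∈ Finset.Icc (-(n + 1) : ℤ) (n + 1),
        (x ^ k * w k) * centralQBinomial q (n + 1) k) =ᶠ[𝓝 1] fun x => (1 - x) * R x := by
      filter_upwards [isOpen_ne.mem_nhds (one_ne_zero (α := ℂ))] with x hx
      rw [← hfin, ← finite_tripleProduct hq0 hq (x := x) hx (by simp [hw0]) (fun k => by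
        rw [zpow_add_one₀ hx, hw]; ring), Finset.prod_mul_distrib, Finset.prod_range_succ', hR]
      simp only [pow_zero, mul_one]
      ring
    rw [hfin, hd1.unique (hd2.congr_of_eventuallyEq heq), hR]
    simp [qFactorial]
  have t1 := (tendsto_add_atTop_iff_nat 1).mpr (tendsto_tsum_mul_centralQBinomial hq hs)
  simp_rw [key] at t1
  have t2 := tendsto_qFactorial hq
  have t3 := (t2.mul ((tendsto_add_atTop_iff_nat 1).mpr t2)).neg
  have h := tendsto_nhds_unique t1 t3
  rw [mul_inv_eq_iff_eq_mul₀ hP] at h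
  rw [h]
  ring

end TripleProduct

end BeauvilleFamily

namespace BeauvilleFamily

open PowerSeries Filter UpperHalfPlane
open scoped Topology Real

/-! ### A quadratic identity between theta series -/

/-- `exp (2πizr)`. -/
noncomputable def expAt (z : ℍ) (r : ℂ) : ℂ := Complex.exp (2 * π * Complex.I * z * r)

theorem expAt_add (z : ℍ) (r s : ℂ) : expAt z (r + s) = expAt z r * expAt z s := by
  rw [expAt, expAt, expAt, ← Complex.exp_add]
  ring_nf

theorem expAt_natCast (z : ℍ) (n : ℕ) : expAt z n = expAt z 1 ^ n := by
  rw [expAt, expAt, ← Complex.exp_nat_mul]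
  ring_nf

theorem norm_expAt_ofReal (z : ℍ) (r : ℝ) : ‖expAt z r‖ = Real.exp (-(2 * π * z.im * r)) := by
  rw [expAt, Complex.norm_exp]
  congr 1
  simp

theorem summable_norm_pow_mul_expAt (z : ℍ) (j : ℕ) {c : ℝ} (hc : 0 < c) :
    Summable fun x : ℤ => ‖(x : ℂ) ^ j * expAt z (c * x ^ 2)‖ := by
  have h := summable_pow_mul_jacobiTheta₂_term_bound 0 (T := 2 * c * z.im)
    (by have := z.im_pos; positivity) j
  refine h.congr fun x => ?_
  have e : (c * x ^ 2 : ℂ) = ((c * x ^ 2 : ℝ) : ℂ) := by push_cast; rfl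
  rw [norm_mul, e, norm_expAt_ofReal, norm_pow, Complex.norm_intCast]
  congr 1
  · push_cast; rfl
  · congr 1; ring

/-- The sign character on pairs of odd integers, which depends on the sum modulo `4`. -/
def oddSign (p : ℤ × ℤ) : ℤ :=
  if Odd p.1 ∧ Odd p.2 then if 4 ∣ p.1 + p.2 then 1 else -1 else 0

/-- The summand of the quadratic identity. -/
noncomputable def quadTerm (z : ℍ) (p : ℤ × ℤ) : ℂ :=
  oddSign p * ((p.1 : ℂ) ^ 2 - (p.2 : ℂ) ^ 2) *
    (expAt z ((1 / 40 : ℝ) * p.1 ^ 2) * expAt z ((1 / 40 : ℝ) * p.2 ^ 2))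

theorem oddSign_swap (x y : ℤ) : oddSign (y, x) = oddSign (x, y) := by
  simp only [oddSign, and_comm, add_comm]

theorem oddSign_rot (x y : ℤ) : oddSign (-y, x) = -oddSign (x, y) := by
  simp only [oddSign, odd_neg]
  split_ifs <;> grind

theorem abs_oddSign_le (p : ℤ × ℤ) : |oddSign p| ≤ 1 := by
  unfold oddSign
  split_ifs <;> simp

theorem quadTerm_swap (z : ℍ) (x y : ℤ) : quadTerm z (y, x) = -quadTerm z (x, y) := by
  simp only [quadTerm, oddSign_swap]
  ring

/-- Rotation by a right angle changes the sign of both the character and x² - y², so the term is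
invariant. -/
theorem quadTerm_rot (z : ℍ) (x y : ℤ) : quadTerm z (-y, x) = quadTerm z (x, y) := by
  simp only [quadTerm, oddSign_rot]
  push_cast
  rw [neg_sq]
  ring

theorem summable_quadTerm (z : ℍ) : Summable (quadTerm z) := by
  have h0 := summable_norm_pow_mul_expAt z 0 (c := 1 / 40) (by norm_num)
  have h2 := summable_norm_pow_mul_expAt z 2 (c := 1 / 40) (by norm_num)
  have s := (h2.mul_norm h0).add (h0.mul_norm h2)
  refine Summable.of_norm_bounded s fun p => ?_
  have hs : ‖(oddSign p : ℂ)‖ ≤ 1 := by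
    rw [Complex.norm_intCast]
    exact_mod_cast abs_oddSign_le p
  rw [quadTerm, mul_assoc, norm_mul]
  refine (mul_le_of_le_one_left (norm_nonneg _) hs).trans ?_
  refine le_of_eq_of_le (congrArg _ ?_) (norm_sub_le _ _)
  ring

/-- Rotation of the plane by a right angle. -/
def rotEquiv : ℤ × ℤ ≃ ℤ × ℤ where
  toFun p := (-p.2, p.1)
  invFun p := (p.2, -p.1)
  left_inv p := by simp
  right_inv p := by simp

/-- The lattice y ≡ 2x mod 5 splits by x mod 5. The class x ≡ 0 sums to zero, the term being
antisymmetric under the swap. Rotation permutes the four other classes cyclically, so each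
contributes the sum over x ≡ 2, y ≡ 4. -/
theorem tsum_lattice_quadTerm (z : ℍ) :
    ∑' p, Set.indicator {p : ℤ × ℤ | 5 ∣ p.2 - 2 * p.1} (quadTerm z) p =
      4 * ∑' p, Set.indicator {p : ℤ × ℤ | 5 ∣ p.1 - 2 ∧ 5 ∣ p.2 - 4} (quadTerm z) p := by
  set U₀ := Set.indicator {p : ℤ × ℤ | 5 ∣ p.1 ∧ 5 ∣ p.2} (quadTerm z) with hU₀
  set U₂ := Set.indicator {p : ℤ × ℤ | 5 ∣ p.1 - 2 ∧ 5 ∣ p.2 - 4} (quadTerm z) with hU₂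
  have s0 : Summable U₀ := (summable_quadTerm z).indicator _
  have s2 : Summable U₂ := (summable_quadTerm z).indicator _
  have z0 : ∑' p, U₀ p = 0 := by
    have h : ∑' p, U₀ p = -∑' p, U₀ p := by
      rw [← tsum_neg, ← (Equiv.prodComm ℤ ℤ).tsum_eq]
      refine tsum_congr fun p => ?_
      obtain ⟨x, y⟩ := p
      simp only [hU₀, Equiv.prodComm_apply, Prod.swap_prod_mk, Set.indicator_apply,
        Set.mem_ofPred_eq, and_comm, quadTerm_swap z x y]
      split_ifs <;> simp
    exact self_eq_neg.mp h
  have hr : ∀ f : ℤ × ℤ → ℂ, ∑' p, f (rotEquiv p) = ∑' p, f p := fun f => rotEquiv.tsum_eq f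
  have sr : ∀ {f : ℤ × ℤ → ℂ}, Summable f → Summable fun p => f (rotEquiv p) :=
    fun hf => rotEquiv.summable_iff.mpr hf
  have key : ∀ p, Set.indicator {p : ℤ × ℤ | 5 ∣ p.2 - 2 * p.1} (quadTerm z) p =
      U₀ p + (U₂ p + U₂ (rotEquiv p) + U₂ (rotEquiv (rotEquiv p)) +
        U₂ (rotEquiv (rotEquiv (rotEquiv p)))) := by
    rintro ⟨x, y⟩
    have q1 : quadTerm z (-y, x) = quadTerm z (x, y) := quadTerm_rot z x y
    have q2 : quadTerm z (-x, -y) = quadTerm z (x, y) := (quadTerm_rot z (-y) x).trans q1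
    have q3 : quadTerm z (- -y, -x) = quadTerm z (x, y) := (quadTerm_rot z (-x) (-y)).trans q2
    simp only [hU₀, hU₂, rotEquiv, Equiv.coe_fn_mk, Set.indicator_apply, Set.mem_ofPred_eq, q1, q2,
      q3]
    by_cases h : (5 : ℤ) ∣ y - 2 * x
    · rw [if_pos h]
      have h5 : x % 5 = 0 ∨ x % 5 = 1 ∨ x % 5 = 2 ∨ x % 5 = 3 ∨ x % 5 = 4 := by omega
      rcases h5 with h5 | h5 | h5 | h5 | h5
      · rw [if_pos (by omega), if_neg (by omega), if_neg (by omega), if_neg (by omega),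
          if_neg (by omega)]
        simp
      · rw [if_neg (by omega), if_neg (by omega), if_neg (by omega), if_neg (by omega),
          if_pos (by omega)]
        simp
      · rw [if_neg (by omega), if_pos (by omega), if_neg (by omega), if_neg (by omega),
          if_neg (by omega)]
        simp
      · rw [if_neg (by omega), if_neg (by omega), if_neg (by omega), if_pos (by omega),
          if_neg (by omega)]
        simp
      · rw [if_neg (by omega), if_neg (by omega), if_pos (by omega), if_neg (by omega),
          if_neg (by omega)]
        simp
    · rw [if_neg h, if_neg (by omega), if_neg (by omega), if_neg (by omega), if_neg (by omega),
        if_neg (by omega)]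
      simp
  rw [tsum_congr key, s0.tsum_add (((s2.add (sr s2)).add (sr (sr s2))).add (sr (sr (sr s2)))),
    ((s2.add (sr s2)).add (sr (sr s2))).tsum_add (sr (sr (sr s2))),
    (s2.add (sr s2)).tsum_add (sr (sr s2)), s2.tsum_add (sr s2),
    hr (fun p => U₂ (rotEquiv (rotEquiv p))), hr (fun p => U₂ (rotEquiv p)), hr U₂, z0]
  ring

/-- The theta series `∑ (-1)ⁿ xʲ exp (2πiz c x²)` over the progression `x = an + b`. -/
noncomputable def progSum (z : ℍ) (c : ℝ) (a b : ℤ) (j : ℕ) : ℂ :=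
  ∑' n : ℤ, (-1 : ℂ) ^ n * (((a * n + b : ℤ) : ℂ) ^ j * expAt z (c * ((a * n + b : ℤ) : ℂ) ^ 2))

theorem summable_norm_progSum (z : ℍ) {c : ℝ} (hc : 0 < c) {a : ℤ} (ha : a ≠ 0) (b : ℤ) (j : ℕ) :
    Summable fun n : ℤ => ‖(-1 : ℂ) ^ n *
      (((a * n + b : ℤ) : ℂ) ^ j * expAt z (c * ((a * n + b : ℤ) : ℂ) ^ 2))‖ := by
  have hi : Function.Injective fun n : ℤ => a * n + b := fun m n h => by
    simpa [ha] using h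
  refine ((summable_norm_pow_mul_expAt z j hc).comp_injective hi).congr fun n => ?_
  rw [Function.comp_apply, norm_mul ((-1 : ℂ) ^ n), norm_zpow, norm_neg, norm_one, one_zpow,
      one_mul]

theorem progSum_mul_progSum (z : ℍ) {c c' : ℝ} (hc : 0 < c) (hc' : 0 < c') {a a' : ℤ}
    (ha : a ≠ 0) (ha' : a' ≠ 0) (b b' : ℤ) (j j' : ℕ) :
    HasSum (fun p : ℤ × ℤ => ((-1 : ℂ) ^ p.1 * (((a * p.1 + b : ℤ) : ℂ) ^ j *
        expAt z (c * ((a * p.1 + b : ℤ) : ℂ) ^ 2))) *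
      ((-1 : ℂ) ^ p.2 * (((a' * p.2 + b' : ℤ) : ℂ) ^ j' *
        expAt z (c' * ((a' * p.2 + b' : ℤ) : ℂ) ^ 2))))
      (progSum z c a b j * progSum z c' a' b' j') := by
  have h1 := summable_norm_progSum z hc ha b j
  have h2 := summable_norm_progSum z hc' ha' b' j'
  rw [progSum, progSum, tsum_mul_tsum_of_summable_norm h1 h2]
  exact (h1.mul_norm h2).of_norm.hasSum

theorem oddSign_of_even_sub {x y k : ℤ} (hx : Odd x) (hy : Odd y) (h : 4 ∣ x + y - 2 * k) :
    (oddSign (x, y) : ℂ) = (-1 : ℂ) ^ k := by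
  rw [oddSign, if_pos ⟨hx, hy⟩]
  rcases Int.even_or_odd k with hk | hk
  · rw [hk.neg_one_zpow, if_pos (by obtain ⟨m, rfl⟩ := hk; simp only; omega)]
    simp
  · rw [hk.neg_one_zpow, if_neg (by obtain ⟨m, rfl⟩ := hk; simp only; omega)]
    simp

/-- The square of `∑ (-1)ᵏ (2k - 1) q ^ ((2k - 1)² / 8)` as a Wronskian of theta series. -/
theorem progSum_sq (z : ℍ) : 2 * progSum z (1 / 8) 2 (-1) 1 ^ 2 =
    progSum z (1 / 40) 10 (-3) 2 * progSum z (1 / 40) 10 (-1) 0 -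
      progSum z (1 / 40) 10 (-3) 0 * progSum z (1 / 40) 10 (-1) 2 := by
  have c1 : (0 : ℝ) < 1 / 40 := by norm_num
  have c2 : (0 : ℝ) < 1 / 8 := by norm_num
  have n10 : (10 : ℤ) ≠ 0 := by norm_num
  have H1 := (progSum_mul_progSum z c1 c1 n10 n10 (-3) (-1) 2 0).sub
    (progSum_mul_progSum z c1 c1 n10 n10 (-3) (-1) 0 2)
  -- With x = 2u + v and y = 2v - u one has x² - y² = 8uv + 3(u² - v²). The second part is
  -- antisymmetric and its total vanishes.
  have H2 := ((progSum_mul_progSum z c2 c2 two_ne_zero two_ne_zero (-1) (-1) 1 1).mul_left 8).add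
    (((progSum_mul_progSum z c2 c2 two_ne_zero two_ne_zero (-1) (-1) 2 0).sub
      (progSum_mul_progSum z c2 c2 two_ne_zero two_ne_zero (-1) (-1) 0 2)).mul_left 3)
  have e1 : ∑' p, Set.indicator {p : ℤ × ℤ | 5 ∣ p.1 - 2 ∧ 5 ∣ p.2 - 4} (quadTerm z) p =
      progSum z (1 / 40) 10 (-3) 2 * progSum z (1 / 40) 10 (-1) 0 -
      progSum z (1 / 40) 10 (-3) 0 * progSum z (1 / 40) 10 (-1) 2 := by
    rw [← H1.tsum_eq]
    -- Odd numbers congruent to 2 and 4 mod 5 are those congruent to -3 and -1 mod 10.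
    let ι : ℤ × ℤ → ℤ × ℤ := fun p => (10 * p.1 + -3, 10 * p.2 + -1)
    have hι : Function.Injective ι := by
      rintro ⟨a, b⟩ ⟨c, d⟩ h
      simp only [ι, Prod.mk.injEq] at h ⊢
      omega
    rw [← hι.tsum_eq]
    · refine tsum_congr fun p => ?_
      rw [Set.indicator_of_mem (by simp only [ι, Set.mem_ofPred_eq]; omega)]
      simp only [quadTerm, ι]
      rw [oddSign_of_even_sub (k := p.1 + p.2) ⟨5 * p.1 - 2, by ring⟩ ⟨5 * p.2 - 1, by ring⟩
        (by omega), zpow_add₀ (by norm_num)]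
      push_cast
      ring
    · intro p hp
      have h1 := Set.mem_of_indicator_ne_zero hp
      have h2 : Odd p.1 ∧ Odd p.2 := by
        by_contra hn
        refine hp ?_
        rw [Set.indicator_apply, if_pos h1, quadTerm, oddSign, if_neg hn]
        simp
      obtain ⟨⟨⟨a, ha⟩, ⟨b, hb⟩⟩, ⟨c, hc⟩, ⟨d, hd⟩⟩ := And.intro h1 h2
      exact ⟨((p.1 + 3) / 10, (p.2 + 1) / 10), Prod.ext (by simp only [ι]; omega)
        (by simp only [ι]; omega)⟩
  have e2 : ∑' p, Set.indicator {p : ℤ × ℤ | 5 ∣ p.2 - 2 * p.1} (quadTerm z) p =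
      8 * progSum z (1 / 8) 2 (-1) 1 ^ 2 := by
    have : 8 * progSum z (1 / 8) 2 (-1) 1 ^ 2 = _ := (by ring : _ = 8 *
        (progSum z (1 / 8) 2 (-1) 1 *
      progSum z (1 / 8) 2 (-1) 1) + 3 * (progSum z (1 / 8) 2 (-1) 2 * progSum z (1 / 8) 2 (-1) 0 -
      progSum z (1 / 8) 2 (-1) 0 * progSum z (1 / 8) 2 (-1) 2)).trans H2.tsum_eq.symm
    rw [this]
    -- Multiplication of u + iv by the Gaussian integer 2 - i, with u and v odd. Its image is the
    -- odd part of the lattice, and it multiplies the norm by 5, turning 1/40 into 1/8.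
    let ι : ℤ × ℤ → ℤ × ℤ := fun p =>
      (2 * (2 * p.1 + -1) + (2 * p.2 + -1), 2 * (2 * p.2 + -1) - (2 * p.1 + -1))
    have hι : Function.Injective ι := by
      rintro ⟨a, b⟩ ⟨c, d⟩ h
      simp only [ι, Prod.mk.injEq] at h ⊢
      omega
    rw [← hι.tsum_eq]
    · refine tsum_congr fun p => ?_
      rw [Set.indicator_of_mem (by simp only [ι, Set.mem_ofPred_eq]; omega)]
      simp only [quadTerm, ι]
      rw [oddSign_of_even_sub (k := p.1 + p.2) ⟨2 * p.1 + p.2 - 2, by ring⟩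
        ⟨2 * p.2 - p.1 - 1, by ring⟩ (by omega), zpow_add₀ (by norm_num), ← expAt_add]
      have e : ((1 / 40 : ℝ) : ℂ) * ((2 * (2 * p.1 + -1) + (2 * p.2 + -1) : ℤ) : ℂ) ^ 2 +
          ((1 / 40 : ℝ) : ℂ) * ((2 * (2 * p.2 + -1) - (2 * p.1 + -1) : ℤ) : ℂ) ^ 2 =
          ((1 / 8 : ℝ) : ℂ) * ((2 * p.1 + -1 : ℤ) : ℂ) ^ 2 +
          ((1 / 8 : ℝ) : ℂ) * ((2 * p.2 + -1 : ℤ) : ℂ) ^ 2 := by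
        push_cast
        ring
      rw [e, expAt_add]
      push_cast
      ring
    · intro p hp
      have h1 := Set.mem_of_indicator_ne_zero hp
      have h2 : Odd p.1 ∧ Odd p.2 := by
        by_contra hn
        refine hp ?_
        rw [Set.indicator_apply, if_pos h1, quadTerm, oddSign, if_neg hn]
        simp
      obtain ⟨⟨a, ha⟩, ⟨c, hc⟩, ⟨d, hd⟩⟩ := And.intro h1 h2
      exact ⟨(((2 * p.1 - p.2) / 5 + 1) / 2, ((p.1 + 2 * p.2) / 5 + 1) / 2),
        Prod.ext (by simp only [ι]; omega) (by simp only [ι]; omega)⟩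
  have := tsum_lattice_quadTerm z
  rw [e1, e2] at this
  linear_combination this / 4

end BeauvilleFamily

namespace BeauvilleFamily

open PowerSeries Filter UpperHalfPlane
open scoped Topology Real

/-! ### Theta series as functions of `q` -/

theorem hasSum_congr_fun {ι : Type*} {f g : ι → ℂ} {s : ℂ} (h : ∀ n, f n = g n) :
    HasSum f s ↔ HasSum g s := by
  rw [funext h]

/-- The function `∑ cₙ q ^ Eₙ`, the sum being over the integers. -/
noncomputable def thetaFun (E : ℤ → ℕ) (c : ℤ → ℂ) (q : ℂ) : ℂ := ∑' n, c n * q ^ E n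

theorem hasSum_extend_iff {E : ℤ → ℕ} (hE : Function.Injective E) {c : ℤ → ℂ} {q s : ℂ} :
    HasSum (fun m => Function.extend E c 0 m * q ^ m) s ↔ HasSum (fun n => c n * q ^ E n) s := by
  rw [← hE.hasSum_iff]
  · refine hasSum_congr_fun fun n => ?_
    rw [Function.comp_apply, hE.extend_apply]
  · intro m hm
    rw [Function.extend_apply' _ _ _ (by simpa using hm), Pi.zero_apply, zero_mul]

theorem hasDiskSeries_thetaFun {E : ℤ → ℕ} (hE : Function.Injective E) {c : ℤ → ℂ}
    (hs : ∀ q : ℂ, ‖q‖ < 1 → Summable fun n => c n * q ^ E n) :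
    HasDiskSeries (thetaFun E c) (PowerSeries.mk (Function.extend E c 0)) := by
  intro q hq
  simp only [coeff_mk]
  exact (hasSum_extend_iff hE).mpr (hs q hq).hasSum

theorem mul_deriv_thetaFun {E : ℤ → ℕ} (hE : Function.Injective E) {c : ℤ → ℂ}
    (hs : ∀ q : ℂ, ‖q‖ < 1 → Summable fun n => c n * q ^ E n) {q : ℂ} (hq : ‖q‖ < 1) :
    HasSum (fun n => E n * c n * q ^ E n) (q * deriv (thetaFun E c) q) := by
  have h := (hasDiskSeries_thetaFun hE hs).eulerDeriv q hq
  rw [← hasSum_extend_iff hE (c := fun n => E n * c n)]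
  refine (hasSum_congr_fun fun m => ?_).mp h
  rw [coeff_eulerDeriv, coeff_mk]
  congr 1
  by_cases hm : ∃ n, E n = m
  · obtain ⟨n, rfl⟩ := hm
    rw [hE.extend_apply, hE.extend_apply]
  · rw [Function.extend_apply' _ _ _ hm, Function.extend_apply' _ _ _ hm]
    simp

/-- The exponents `5 n (n - 1) / 2 + m n`. -/
def rogersExp (m : ℕ) (n : ℤ) : ℕ := (n * (5 * n - 5 + 2 * m) / 2).toNat

theorem two_mul_rogersExp {m : ℕ} (hm : m = 1 ∨ m = 2) (n : ℤ) :
    2 * (rogersExp m n : ℤ) = n * (5 * n - 5 + 2 * m) := by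
  have h0 : 0 ≤ n * (5 * n - 5 + 2 * m) := by
    rcases le_or_gt n 0 with h | h
    · exact mul_nonneg_of_nonpos_of_nonpos h (by omega)
    · exact mul_nonneg h.le (by omega)
  have h2 : 2 ∣ n * (5 * n - 5 + 2 * m) := by
    rcases Int.even_or_odd' n with ⟨k, rfl | rfl⟩
    · exact Dvd.intro _ (by ring : 2 * (k * (5 * (2 * k) - 5 + 2 * m)) = _)
    · exact Dvd.intro _ (by ring : 2 * ((2 * k + 1) * (5 * k + m)) = _)
  rw [rogersExp, Int.toNat_of_nonneg (Int.ediv_nonneg h0 two_pos.le), Int.mul_ediv_cancel' h2]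

theorem rogersExp_injective {m : ℕ} (hm : m = 1 ∨ m = 2) : Function.Injective (rogersExp m) := by
  intro a b h
  have h1 := two_mul_rogersExp hm a
  rw [h, two_mul_rogersExp hm b] at h1
  have h2 : (a - b) * (5 * (a + b) - 5 + 2 * m) = 0 := by linear_combination -h1
  rcases mul_eq_zero.mp h2 with h3 | h3
  · omega
  · omega

theorem natAbs_le_rogersExp {m : ℕ} (hm : m = 1 ∨ m = 2) (n : ℤ) : n.natAbs ≤ rogersExp m n := by
  have h := two_mul_rogersExp hm n
  have hm' : (m : ℤ) = 1 ∨ (m : ℤ) = 2 := by exact_mod_cast hm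
  zify
  rcases le_total 0 n with h0 | h0
  · rw [abs_of_nonneg h0]
    rcases h0.eq_or_lt with rfl | h1
    · positivity
    · have : 1 ≤ n := h1
      rcases hm' with e | e <;> rw [e] at h <;> nlinarith
  · rw [abs_of_nonpos h0]
    rcases hm' with e | e <;> rw [e] at h <;> nlinarith

theorem rogersExp_zero (m : ℕ) : rogersExp m 0 = 0 := by simp [rogersExp]

theorem rogersExp_add_one {m : ℕ} (hm : m = 1 ∨ m = 2) (n : ℤ) :
    (rogersExp m (n + 1) : ℤ) = rogersExp m n + 5 * n + m := by
  have h1 := two_mul_rogersExp hm n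
  have h2 := two_mul_rogersExp hm (n + 1)
  have : 2 * (rogersExp m (n + 1) : ℤ) = 2 * (rogersExp m n + 5 * n + m) := by
    rw [mul_add, mul_add, h1, h2]; ring
  omega

theorem summable_pow_natAbs {q : ℂ} (hq : ‖q‖ < 1) : Summable fun n : ℤ => ‖q‖ ^ n.natAbs := by
  have := summable_geometric_of_lt_one (norm_nonneg q) hq
  exact Summable.of_nat_of_neg (by simpa using this) (by simpa using this)

/-- The signed theta series `∑ (-1)ⁿ q ^ (5 n (n - 1) / 2 + m n)`. -/
noncomputable def rogersTheta (m : ℕ) : ℂ → ℂ := thetaFun (rogersExp m) fun n => (-1) ^ n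

theorem summable_rogersTheta {m : ℕ} (hm : m = 1 ∨ m = 2) (q : ℂ) (hq : ‖q‖ < 1) :
    Summable fun n : ℤ => (-1 : ℂ) ^ n * q ^ rogersExp m n := by
  refine Summable.of_norm_bounded (summable_pow_natAbs hq) fun n => ?_
  rw [norm_mul, norm_zpow, norm_neg, norm_one, one_zpow, one_mul, norm_pow]
  exact pow_le_pow_of_le_one (norm_nonneg _) hq.le (natAbs_le_rogersExp hm n)

theorem hasDiskSeries_rogersTheta {m : ℕ} (hm : m = 1 ∨ m = 2) :
    ∃ p, HasDiskSeries (rogersTheta m) p :=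
  ⟨_, hasDiskSeries_thetaFun (rogersExp_injective hm) (summable_rogersTheta hm)⟩

theorem rogersTheta_zero {m : ℕ} (hm : m = 1 ∨ m = 2) : rogersTheta m 0 = 1 := by
  rw [rogersTheta, thetaFun, tsum_eq_single 0]
  · simp [rogersExp_zero]
  · intro n hn
    rw [zero_pow, mul_zero]
    intro h
    exact hn (rogersExp_injective hm (h.trans (rogersExp_zero m).symm))

/-- The triple product with base q⁵ and x = q^m. -/
theorem tendsto_rogersTheta {m : ℕ} (hm : m = 1 ∨ m = 2) {q : ℂ} (hq0 : q ≠ 0) (hq : ‖q‖ < 1) :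
    Tendsto (fun N => ∏ i ∈ Finset.range N, (1 - q ^ (5 * i + m)) * (1 - q ^ (5 * i + (5 - m))))
      atTop (𝓝 (rogersTheta m q * (eulerProd (q ^ 5))⁻¹)) := by
  have hq5 : ‖q ^ 5‖ < 1 := by
    rw [norm_pow]; exact pow_lt_one₀ (norm_nonneg _) hq (by norm_num)
  have h := tendsto_tripleProduct (pow_ne_zero 5 hq0) hq5 (pow_ne_zero m hq0)
    (w := fun n : ℤ => (-1 : ℂ) ^ n * q ^ rogersExp m n) (by simp [rogersExp_zero]) (fun k => ?_)
    (summable_rogersTheta hm q hq)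
  · refine h.congr fun N => Finset.prod_congr rfl fun i _ => ?_
    have e : (q ^ m)⁻¹ * (q ^ 5) ^ (i + 1) = q ^ (5 * i + (5 - m)) := by
      have := pow_ne_zero m hq0
      rw [inv_mul_eq_iff_eq_mul₀ this, ← pow_mul, ← pow_add]
      congr 1
      omega
    rw [e, ← pow_mul, ← pow_add, add_comm m]
  · have e : q ^ rogersExp m (k + 1) = q ^ m * (q ^ 5) ^ k * q ^ rogersExp m k := by
      rw [← zpow_natCast, rogersExp_add_one hm, zpow_add₀ hq0, zpow_add₀ hq0, zpow_natCast,
        zpow_natCast, zpow_mul]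
      norm_cast
      ring
    rw [e, zpow_add_one₀ (by norm_num)]
    ring

theorem prod_range_five_mul {M : Type*} [CommMonoid M] (f : ℕ → M) (N : ℕ) :
    ∏ n ∈ Finset.range (5 * N), f n = ∏ i ∈ Finset.range N,
      (f (5 * i) * f (5 * i + 1) * f (5 * i + 2) * f (5 * i + 3) * f (5 * i + 4)) := by
  induction N with
  | zero => simp
  | succ N ih =>
    rw [Finset.prod_range_succ, ← ih, show 5 * (N + 1) = 5 * N + 4 + 1 by ring,
      Finset.prod_range_succ, Finset.prod_range_succ, Finset.prod_range_succ,
      Finset.prod_range_succ, Finset.prod_range_succ]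
    simp only [mul_assoc]

theorem tendsto_five_mul_atTop : Tendsto (fun N : ℕ => 5 * N) atTop atTop :=
  tendsto_id.const_mul_atTop' (by norm_num)

/-- The residues ±1, ±2 mod 5 from the two theta series, with one of their two factors ∏(1 -
q^(5n)), make up ∏(1 - qⁿ). The other factor remains. -/
theorem rogersTheta_mul {q : ℂ} (hq0 : q ≠ 0) (hq : ‖q‖ < 1) :
    rogersTheta 1 q * rogersTheta 2 q = eulerProd q * eulerProd (q ^ 5) := by
  have hq5 : ‖q ^ 5‖ < 1 := by
    rw [norm_pow]; exact pow_lt_one₀ (norm_nonneg _) hq (by norm_num)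
  have h5 := eulerProd_ne_zero hq5
  have h := ((tendsto_rogersTheta (Or.inl rfl) hq0 hq).mul
    (tendsto_rogersTheta (Or.inr rfl) hq0 hq)).mul (tendsto_qFactorial hq5)
  have h' := (tendsto_qFactorial hq).comp tendsto_five_mul_atTop
  have e := tendsto_nhds_unique (h'.congr fun N => ?_) h
  · rw [e]
    field_simp
  · rw [Function.comp_apply, qFactorial, prod_range_five_mul, qFactorial, ← Finset.prod_mul_distrib,
      ← Finset.prod_mul_distrib]
    refine Finset.prod_congr rfl fun i _ => ?_
    rw [← pow_mul, show 5 * (i + 1) = 5 * i + 4 + 1 by ring]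
    simp only [Nat.reduceSub, add_assoc, Nat.reduceAdd]
    ring

theorem rogersTheta_ne_zero {m : ℕ} (hm : m = 1 ∨ m = 2) {q : ℂ} (hq : ‖q‖ < 1) :
    rogersTheta m q ≠ 0 := by
  rcases eq_or_ne q 0 with rfl | hq0
  · rw [rogersTheta_zero hm]; exact one_ne_zero
  have hq5 : ‖q ^ 5‖ < 1 := by
    rw [norm_pow]; exact pow_lt_one₀ (norm_nonneg _) hq (by norm_num)
  have h := rogersTheta_mul hq0 hq
  have h0 := mul_ne_zero (eulerProd_ne_zero hq) (eulerProd_ne_zero hq5)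
  rw [← h] at h0
  rcases hm with rfl | rfl
  · exact left_ne_zero_of_mul h0
  · exact right_ne_zero_of_mul h0

theorem jacobiSym_five (n : ℕ) : jacobiSym ((n : ℤ) + 1) 5 =
    if n % 5 = 0 ∨ n % 5 = 3 then 1 else if n % 5 = 4 then 0 else -1 := by
  rw [jacobiSym.mod_left]
  have h : n % 5 = 0 ∨ n % 5 = 1 ∨ n % 5 = 2 ∨ n % 5 = 3 ∨ n % 5 = 4 := by omega
  rcases h with h | h | h | h | h
  · rw [show ((n : ℤ) + 1) % (5 : ℕ) = 1 by omega, h]; norm_num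
  · rw [show ((n : ℤ) + 1) % (5 : ℕ) = 2 by omega, h]; norm_num
  · rw [show ((n : ℤ) + 1) % (5 : ℕ) = 3 by omega, h]; norm_num
  · rw [show ((n : ℤ) + 1) % (5 : ℕ) = 4 by omega, h]; norm_num
  · rw [show ((n : ℤ) + 1) % (5 : ℕ) = 0 by omega, h]; norm_num

/-- Finitely many exponents a occur, so |(1 - w)^a - 1| ≤ K|w| holds with one K for all of them. -/
theorem multipliable_one_sub_pow_zpow {q : ℂ} (hq : ‖q‖ < 1) {a : ℕ → ℤ}
    (ha : (Set.range a).Finite) : Multipliable fun n => (1 - q ^ (n + 1)) ^ a n := by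
  have hb : ∀ a : ℤ, ∃ M, 0 ≤ M ∧ ∀ w : ℂ, ‖w‖ ≤ ‖q‖ → ‖(1 - w) ^ a - 1‖ ≤ M * ‖w‖ := by
    intro a
    have hd : DifferentiableOn ℂ (fun w : ℂ => (1 - w) ^ a) (Metric.ball 0 1) := by
      intro w hw
      refine ((differentiableAt_id.const_sub 1).zpow (Or.inl ?_)).differentiableWithinAt
      intro h
      have : w = 1 := (sub_eq_zero.mp h).symm
      simp [this] at hw
    obtain ⟨M, h0, hM⟩ := (HasDiskSeries.of_differentiableOn hd).norm_sub_le hq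
    exact ⟨M, h0, fun w hw => by simpa using hM w hw⟩
  choose M h0 hM using hb
  obtain ⟨K, hK⟩ := (ha.image M).bddAbove
  have h := multipliable_one_add_of_summable (f := fun n => (1 - q ^ (n + 1)) ^ a n - 1) ?_
  · simpa using h
  · have hg := ((summable_nat_add_iff 1).mpr
      (summable_geometric_of_lt_one (norm_nonneg _) hq)).mul_left K
    refine Summable.of_nonneg_of_le (fun _ => norm_nonneg _) (fun n => ?_) hg
    have hn : ‖q ^ (n + 1)‖ ≤ ‖q‖ := by
      rw [norm_pow, pow_succ]
      exact mul_le_of_le_one_left (norm_nonneg _) (pow_le_one₀ (norm_nonneg _) hq.le)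
    refine (hM (a n) _ hn).trans ?_
    rw [norm_pow]
    gcongr
    exact hK ⟨a n, ⟨n, rfl⟩, rfl⟩

theorem tprod_jacobiSym {q : ℂ} (hq0 : q ≠ 0) (hq : ‖q‖ < 1) :
    ∏' n : ℕ, (1 - q ^ (n + 1)) ^ (5 * jacobiSym ((n : ℤ) + 1) 5) =
      (rogersTheta 1 q / rogersTheta 2 q) ^ 5 := by
  have hq5 : ‖q ^ 5‖ < 1 := by
    rw [norm_pow]; exact pow_lt_one₀ (norm_nonneg _) hq (by norm_num)
  have h5 := eulerProd_ne_zero hq5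
  have h1 := rogersTheta_ne_zero (Or.inl rfl) hq
  have h2 := rogersTheta_ne_zero (Or.inr rfl) hq
  have hm : Multipliable fun n : ℕ => (1 - q ^ (n + 1)) ^ (5 * jacobiSym ((n : ℤ) + 1) 5) := by
    refine multipliable_one_sub_pow_zpow hq ((Set.toFinite {5, 0, -5}).subset ?_)
    rintro _ ⟨n, rfl⟩
    simp only [jacobiSym_five]
    split_ifs <;> simp
  have t := hm.hasProd.tendsto_prod_nat.comp tendsto_five_mul_atTop
  have t' := ((tendsto_rogersTheta (Or.inl rfl) hq0 hq).div
    (tendsto_rogersTheta (Or.inr rfl) hq0 hq) (mul_ne_zero h2 (inv_ne_zero h5))).pow 5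
  rw [mul_div_mul_right _ _ (inv_ne_zero h5)] at t'
  refine tendsto_nhds_unique (t.congr fun N => ?_) t'
  rw [Function.comp_apply, prod_range_five_mul, Pi.div_apply, ← Finset.prod_div_distrib,
    ← Finset.prod_pow]
  refine Finset.prod_congr rfl fun i _ => ?_
  simp only [jacobiSym_five]
  rw [if_pos (by omega), if_neg (by omega), if_neg (by omega), if_neg (by omega),
    if_neg (by omega), if_pos (by omega), if_neg (by omega), if_pos (by omega)]
  have e1 := one_sub_pow_ne_zero hq (5 * i + 1)
  have e2 := one_sub_pow_ne_zero hq (5 * i + 2)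
  norm_num [zpow_neg]
  norm_cast
  field_simp

theorem expAt_eq_qParam (z : ℍ) : expAt z 1 = Function.Periodic.qParam 1 z := by
  simp [expAt, Function.Periodic.qParam]

/-- Completing the square: the exponent is ((10n + 2m - 5)² - (2m - 5)²)/40. -/
theorem pow_rogersExp {m : ℕ} (hm : m = 1 ∨ m = 2) (z : ℍ) (n : ℤ) :
    expAt z 1 ^ rogersExp m n = expAt z ((1 / 40 : ℝ) * ((10 * n + (2 * m - 5) : ℤ) : ℂ) ^ 2) *
      expAt z (-(2 * m - 5) ^ 2 / 40) := by
  rw [← expAt_natCast, ← expAt_add]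
  congr 1
  have h := congrArg (Int.cast (R := ℂ)) (two_mul_rogersExp hm n)
  push_cast at h ⊢
  linear_combination h / 2

theorem rogersTheta_eq {m : ℕ} (hm : m = 1 ∨ m = 2) (z : ℍ) :
    rogersTheta m (expAt z 1) =
      expAt z (-(2 * m - 5) ^ 2 / 40) * progSum z (1 / 40) 10 (2 * m - 5) 0 := by
  rw [rogersTheta, thetaFun, progSum, ← tsum_mul_left]
  refine tsum_congr fun n => ?_
  rw [pow_rogersExp hm]
  ring

theorem mul_deriv_rogersTheta_eq {m : ℕ} (hm : m = 1 ∨ m = 2) (z : ℍ) :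
    40 * (expAt z 1 * deriv (rogersTheta m) (expAt z 1)) = expAt z (-(2 * m - 5) ^ 2 / 40) *
      (progSum z (1 / 40) 10 (2 * m - 5) 2 -
        (2 * m - 5) ^ 2 * progSum z (1 / 40) 10 (2 * m - 5) 0) := by
  have hq : ‖expAt z 1‖ < 1 := by
    rw [expAt_eq_qParam]; exact HasQSeries.norm_qParam_lt z
  have h := (mul_deriv_thetaFun (rogersExp_injective hm) (summable_rogersTheta hm) hq).mul_left 40
  have s2 := (summable_norm_progSum z (c := 1 / 40) (by norm_num) (a := 10) (by norm_num)
    (2 * m - 5) 2).of_norm.hasSum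
  have s0 := (summable_norm_progSum z (c := 1 / 40) (by norm_num) (a := 10) (by norm_num)
    (2 * m - 5) 0).of_norm.hasSum
  refine h.unique ((hasSum_congr_fun fun n => ?_).mp
    ((s2.sub (s0.mul_left ((2 * m - 5 : ℂ) ^ 2))).mul_left (expAt z (-(2 * m - 5) ^ 2 / 40))))
  rw [pow_rogersExp hm]
  have h := congrArg (Int.cast (R := ℂ)) (two_mul_rogersExp hm n)
  push_cast at h ⊢
  linear_combination (-20 * (-1 : ℂ) ^ n * expAt z (1 / 40 * (10 * n + (2 * m - 5)) ^ 2) *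
    expAt z (-(2 * m - 5) ^ 2 / 40)) * h

/-- Jacobi's formula for the cube of Euler's product, in symmetric form. -/
theorem eulerProd_cube_eq (z : ℍ) :
    2 * eulerProd (expAt z 1) ^ 3 = -(expAt z (-1 / 8) * progSum z (1 / 8) 2 (-1) 1) := by
  have hq : ‖expAt z 1‖ < 1 := by
    rw [expAt_eq_qParam]; exact HasQSeries.norm_qParam_lt z
  have hq0 : expAt z 1 ≠ 0 := Complex.exp_ne_zero _
  set w : ℤ → ℂ := fun k => (-1) ^ k * (expAt z (-1 / 8) *
    expAt z ((1 / 8 : ℝ) * ((2 * k + -1 : ℤ) : ℂ) ^ 2)) with hw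
  have s1 := ((summable_norm_progSum z (c := 1 / 8) (by norm_num) (a := 2) (by norm_num)
    (-1) 1).of_norm.hasSum).mul_left (expAt z (-1 / 8))
  have s0 := ((summable_norm_progSum z (c := 1 / 8) (by norm_num) (a := 2) (by norm_num)
    (-1) 0).of_norm.mul_left (expAt z (-1 / 8)))
  have w0 : Summable w := by
    refine s0.congr fun k => ?_
    simp only [hw]
    ring
  have w1 : HasSum (fun k : ℤ => (2 * k - 1) * w k)
      (expAt z (-1 / 8) * progSum z (1 / 8) 2 (-1) 1) := by
    refine (hasSum_congr_fun fun k => ?_).mp s1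
    simp only [hw]
    push_cast
    ring
  have wk : Summable fun k : ℤ => k * w k := by
    refine ((w1.summable.add w0).mul_left 2⁻¹).congr fun k => ?_
    ring
  -- The reflection k ↦ 1 - k fixes (2k - 1)² and reverses the sign. So 2∑ k w k may be replaced by
  -- ∑ (2k - 1) w k.
  have hsym : ∑' k, w k = 0 := by
    have h : ∑' k, w k = -∑' k, w k := by
      rw [← tsum_neg, ← (Equiv.subLeft (1 : ℤ)).tsum_eq]
      refine tsum_congr fun k => ?_
      simp only [hw, Equiv.subLeft_apply]
      rw [sub_eq_add_neg, zpow_add₀ (by norm_num), zpow_neg, zpow_one, ← inv_zpow,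
        show ((2 * (1 + -k) + -1 : ℤ) : ℂ) = -((2 * k + -1 : ℤ) : ℂ) by push_cast; ring, neg_sq]
      norm_num
    exact self_eq_neg.mp h
  have hc := eulerProd_pow_three hq0 hq (w := w) ?_ (fun k => ?_) wk
  · rw [hc, ← w1.tsum_eq, ← tsum_neg]
    have e : ∀ k : ℤ, (2 * (k : ℂ) - 1) * w k = 2 * (k * w k) - w k := fun k => by ring
    rw [tsum_neg, tsum_congr e, (wk.mul_left 2).tsum_sub w0, hsym, tsum_mul_left]
    ring
  · simp only [hw]
    rw [← expAt_add, zpow_zero, one_mul]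
    norm_num [expAt]
  · simp only [hw]
    have e : expAt z 1 ^ k = expAt z k := by
      rw [expAt, expAt, ← Complex.exp_int_mul]
      ring_nf
    rw [e, zpow_add_one₀ (by norm_num), ← expAt_add, ← expAt_add]
    have e2 : -1 / 8 + ((1 / 8 : ℝ) : ℂ) * ((2 * (k + 1) + -1 : ℤ) : ℂ) ^ 2 =
        k + (-1 / 8 + ((1 / 8 : ℝ) : ℂ) * ((2 * k + -1 : ℤ) : ℂ) ^ 2) := by
      push_cast
      ring
    rw [e2, expAt_add z k]
    ring

/-- The Wronskian of the two theta series is an eta quotient. -/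
theorem rogersTheta_wronskian {q : ℂ} (hq0 : q ≠ 0) (hq : ‖q‖ < 1) :
    rogersTheta 1 q * rogersTheta 2 q + 5 * (rogersTheta 2 q * (q * deriv (rogersTheta 1) q) -
      rogersTheta 1 q * (q * deriv (rogersTheta 2) q)) = eulerProd q ^ 6 := by
  obtain ⟨z, hz⟩ := HasQSeries.exists_qParam hq0 hq
  rw [← expAt_eq_qParam] at hz
  subst hz
  have a0 := rogersTheta_eq (Or.inl rfl : 1 = 1 ∨ 1 = 2) z
  have b0 := rogersTheta_eq (Or.inr rfl : 2 = 1 ∨ 2 = 2) z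
  have a1 := mul_deriv_rogersTheta_eq (Or.inl rfl : 1 = 1 ∨ 1 = 2) z
  have b1 := mul_deriv_rogersTheta_eq (Or.inr rfl : 2 = 1 ∨ 2 = 2) z
  have c1 := eulerProd_cube_eq z
  have h := progSum_sq z
  -- The two normalising exponents 9/40 and 1/40 add up to 1/4, twice that of Jacobi's series; their
  -- difference 1/5 produces the undifferentiated product in the Wronskian.
  have e1 : expAt z (-(9 / 40)) * expAt z (-(1 / 40)) = expAt z (-1 / 8) ^ 2 := by
    rw [sq, ← expAt_add, ← expAt_add]
    norm_num
  norm_num at a0 b0 a1 b1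
  set qa := expAt z 1 * deriv (rogersTheta 1) (expAt z 1)
  set qb := expAt z 1 * deriv (rogersTheta 2) (expAt z 1)
  rw [a0, b0]
  linear_combination (expAt z (-(1 / 40)) * progSum z (1 / 40) 10 (-1) 0) / 8 * a1 -
    (expAt z (-(9 / 40)) * progSum z (1 / 40) 10 (-3) 0) / 8 * b1 +
    (progSum z (1 / 40) 10 (-3) 2 * progSum z (1 / 40) 10 (-1) 0 -
      progSum z (1 / 40) 10 (-3) 0 * progSum z (1 / 40) 10 (-1) 2) / 8 * e1 -
    expAt z (-1 / 8) ^ 2 / 8 * h -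
    (2 * eulerProd (expAt z 1) ^ 3 - expAt z (-1 / 8) * progSum z (1 / 8) 2 (-1) 1) / 4 * c1

end BeauvilleFamily

/-! ### Case D: the Rogers–Ramanujan theta quotient -/

namespace BeauvilleFamily

open PowerSeries UpperHalfPlane Filter Metric
open scoped Real Topology

/-- An Euler quotient corresponding to an eta quotient which vanishes at `z = 0` is bounded on the
imaginary axis near `z = 0`. -/
theorem eulerQuotient_axis_bound (L : List (ℕ × ℤ)) (hL : ∀ x ∈ L, x.1 ≠ 0)
    (hL₁ : (L.map fun x => (x.1 : ℤ) * x.2).sum = 0) {a : ℝ} (ha : 0 < a)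
    (hL₂ : (L.map fun x => (x.2 / x.1 : ℂ)).sum = a) :
    ∃ M, ∀ y : ℝ, 0 < y → y ≤ 1 → ‖eulerQuotient L (axisQ y)‖ ≤ M := by
  obtain ⟨r, hr, hr'⟩ := exists_series_eulerQuotient L hL
  obtain ⟨C₀, hC₀⟩ := diskEisensteinSum_axis_bound L hL
  set b : ℝ := (((L.map fun x => x.2).sum : ℤ) : ℝ) with hb
  rw [hL₂] at hC₀
  rw [hL₁, Int.cast_zero, zero_div, map_zero, sub_zero] at hr'
  have hu : ∀ y : ℝ, 0 < y → 0 < (eulerQuotient L (axisQ y)).re ∧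
      eulerQuotient L (axisQ y) = ((eulerQuotient L (axisQ y)).re : ℂ) := fun y hy => by
    obtain ⟨p, hp, e⟩ := eulerQuotient_axis_pos L hL hy
    rw [e, Complex.ofReal_re]
    exact ⟨hp, rfl⟩
  have hd : ∀ y : ℝ, 0 < y → HasDerivAt (fun y => (eulerQuotient L (axisQ y)).re)
      (-2 * π * ((eulerQuotient L (axisQ y)).re * (diskEisensteinSum L (axisQ y)).re)) y := by
    intro y hy
    refine (IsDiskSolution.hasDerivAt_re (hr.hasDerivAt_axis hy)).congr_deriv ?_
    have hq := hr.eulerDeriv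
    rw [hr'] at hq
    rw [hq.eq (hr.mul (hasDiskSeries_eisensteinSum L hL)) (norm_axisQ_lt hy), (hu y hy).2]
    simp
  -- The logarithmic derivative behaves like -a/(24y²) + b/(4πy). As a > 0, this quadratic in 1/y is
  -- bounded above, though not below.
  have hlow : ∃ K, ∀ y : ℝ, 0 < y → y ≤ 1 → (diskEisensteinSum L (axisQ y)).re ≤ K := by
    have hpi := Real.pi_pos
    refine ⟨C₀ + (b / (4 * π)) ^ 2 / (a / 24), fun y hy hy1 => ?_⟩
    have h1 := (Complex.re_le_norm _).trans (hC₀ y hy hy1)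
    have e : (diskEisensteinSum L (axisQ y) + a / 24 * (y ^ 2 : ℂ)⁻¹ -
        b / 24 * (6 / (π * y)) : ℂ).re =
        (diskEisensteinSum L (axisQ y)).re + a / 24 * (y ^ 2)⁻¹ - b / 24 * (6 / (π * y)) := by
      have : (a / 24 * (y ^ 2 : ℂ)⁻¹ : ℂ) = ((a / 24 * (y ^ 2)⁻¹ : ℝ) : ℂ) := by push_cast; rfl
      have h' : (b / 24 * (6 / (π * y)) : ℂ) = ((b / 24 * (6 / (π * y)) : ℝ) : ℂ) := by
        push_cast; rfl
      rw [this, h', Complex.sub_re, Complex.add_re, Complex.ofReal_re, Complex.ofReal_re]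
    have hb' : (((L.map fun x => x.2).sum : ℤ) : ℂ) = (b : ℂ) := by rw [hb, Complex.ofReal_intCast]
    rw [hb', e] at h1
    have h2 : b / 24 * (6 / (π * y)) - a / 24 * (y ^ 2)⁻¹ ≤ (b / (4 * π)) ^ 2 / (a / 24) := by
      rw [le_div_iff₀ (by positivity)]
      have e2 : b / 24 * (6 / (π * y)) = b / (4 * π) * y⁻¹ := by field_simp; ring
      rw [e2, ← inv_pow]
      nlinarith [sq_nonneg (b / (4 * π) - a / 24 * y⁻¹), sq_nonneg (b / (4 * π)),
        sq_nonneg (a / 24 * y⁻¹)]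
    linarith
  obtain ⟨K, hK⟩ := hlow
  have hw : ∀ y : ℝ, 0 < y → HasDerivAt
      (fun y => (eulerQuotient L (axisQ y)).re * Real.exp (2 * π * K * y))
      ((eulerQuotient L (axisQ y)).re * Real.exp (2 * π * K * y) *
        (2 * π * (K - (diskEisensteinSum L (axisQ y)).re))) y := by
    intro y hy
    refine ((hd y hy).mul ((hasDerivAt_id y).const_mul (2 * π * K)).exp).congr_deriv ?_
    simp only [id]
    ring
  -- The upper bound K makes the quotient times exp(2πKy) increasing, so its value at y = 1
  -- dominates.
  have hmono : MonotoneOn (fun y => (eulerQuotient L (axisQ y)).re * Real.exp (2 * π * K * y))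
      (Set.Ioc 0 1) := by
    refine monotoneOn_of_deriv_nonneg (convex_Ioc 0 1)
      (fun y hy => (hw y hy.1).continuousAt.continuousWithinAt) ?_ ?_ <;> rw [interior_Ioc]
    · exact fun y hy => (hw y hy.1).differentiableAt.differentiableWithinAt
    · intro y hy
      rw [(hw y hy.1).deriv]
      have h1 := hK y hy.1 hy.2.le
      have h2 := (hu y hy.1).1
      have := Real.pi_pos
      have h3 : 0 ≤ K - (diskEisensteinSum L (axisQ y)).re := by linarith
      positivity
  refine ⟨(eulerQuotient L (axisQ 1)).re * Real.exp (2 * π * K) * Real.exp (|2 * π * K|),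
    fun y hy hy1 => ?_⟩
  have h1 := hmono ⟨hy, hy1⟩ ⟨one_pos, le_rfl⟩ hy1
  simp only [mul_one] at h1
  rw [(hu y hy).2, Complex.norm_real, Real.norm_eq_abs, abs_of_pos (hu y hy).1]
  have h2 : (eulerQuotient L (axisQ y)).re =
      (eulerQuotient L (axisQ y)).re * Real.exp (2 * π * K * y) * Real.exp (-(2 * π * K * y)) := by
    rw [mul_assoc, ← Real.exp_add, add_neg_cancel, Real.exp_zero, mul_one]
  rw [h2]
  refine mul_le_mul h1 (Real.exp_le_exp.mpr ?_) (Real.exp_pos _).le ?_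
  · refine (neg_le_abs _).trans ?_
    rw [abs_mul, abs_of_pos hy]
    exact mul_le_of_le_one_right (abs_nonneg _) hy1
  · have := (hu 1 one_pos).1
    positivity

/-- The product form shows that it is a limit of nonnegative reals, and it does not vanish. -/
theorem rogersTheta_axis_pos {m : ℕ} (hm : m = 1 ∨ m = 2) {y : ℝ} (hy : 0 < y) :
    ∃ r : ℝ, 0 < r ∧ rogersTheta m (axisQ y) = r := by
  obtain ⟨p, hp, ep⟩ := eulerProd_axis_pos (mul_pos (by norm_num : (0 : ℝ) < (5 : ℕ)) hy)
  rw [← axisQ_pow] at ep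
  have h := tendsto_rogersTheta hm (axisQ_ne_zero y) (norm_axisQ_lt hy)
  have h0 := mul_ne_zero (rogersTheta_ne_zero hm (norm_axisQ_lt hy))
    (inv_ne_zero (ep ▸ (by exact_mod_cast hp.ne' : (p : ℂ) ≠ 0)))
  have hx : Real.exp (-(2 * π * y)) ≤ 1 := by
    rw [← norm_axisQ]; exact (norm_axisQ_lt hy).le
  have hmem : rogersTheta m (axisQ y) * (eulerProd (axisQ y ^ 5))⁻¹ ∈
      Complex.ofReal '' Set.Ici 0 := by
    refine (Complex.isUniformEmbedding_ofReal.isClosedEmbedding.isClosedMap _ isClosed_Ici).mem_of_tendsto h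
      (Eventually.of_forall fun N => ?_)
    refine ⟨∏ i ∈ Finset.range N, (1 - Real.exp (-(2 * π * y)) ^ (5 * i + m)) *
      (1 - Real.exp (-(2 * π * y)) ^ (5 * i + (5 - m))), ?_, ?_⟩
    · have h1 : ∀ n : ℕ, 0 ≤ 1 - Real.exp (-(2 * π * y)) ^ n := fun n =>
        sub_nonneg.mpr (pow_le_one₀ (Real.exp_pos _).le hx)
      exact Finset.prod_nonneg fun i _ => mul_nonneg (h1 _) (h1 _)
    · simp only [axisQ]
      push_cast
      rfl
  obtain ⟨r, hr, er⟩ := hmem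
  have hr0 : r ≠ 0 := by
    rintro rfl
    exact h0 (by rw [← er, Complex.ofReal_zero])
  refine ⟨r * p, mul_pos (lt_of_le_of_ne hr (Ne.symm hr0)) hp, ?_⟩
  rw [ep, eq_mul_inv_iff_mul_eq₀ (by exact_mod_cast hp.ne')] at er
  rw [← er]
  push_cast
  rfl

/-- `q (A / B) ^ 5` as a function of `q`, where `A`, `B` are the two theta series. -/
noncomputable def diskHauptmodulD (q : ℂ) : ℂ := q * (rogersTheta 1 q / rogersTheta 2 q) ^ 5

/-- The square of the modular form in case `D`, as a function of `q`. -/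
noncomputable def diskWeightTwoD (q : ℂ) : ℂ :=
  eulerQuotient [(5, 5), (1, -1)] q * (rogersTheta 2 q / rogersTheta 1 q) ^ 5

theorem differentiableOn_rogersTheta_div {m n : ℕ} (hm : m = 1 ∨ m = 2) (hn : n = 1 ∨ n = 2) :
    DifferentiableOn ℂ (fun q => (rogersTheta m q / rogersTheta n q) ^ 5) (ball 0 1) := by
  obtain ⟨p, hp⟩ := hasDiskSeries_rogersTheta hm
  obtain ⟨r, hr⟩ := hasDiskSeries_rogersTheta hn
  exact (hp.differentiableOn.div hr.differentiableOn
    fun q hq => rogersTheta_ne_zero hn (by simpa using hq)).pow 5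

/-- The logarithmic derivative is the Wronskian expression divided by θ₁θ₂. By
`rogersTheta_wronskian` and `rogersTheta_mul` this is ∏(1 - qⁿ)⁶ / (∏(1 - qⁿ) ∏(1 - q^(5n))). -/
theorem mul_deriv_diskHauptmodulD {q : ℂ} (hq0 : q ≠ 0) (hq : ‖q‖ < 1) :
    q * deriv diskHauptmodulD q = diskHauptmodulD q * eulerQuotient [(1, 5), (5, -1)] q := by
  obtain ⟨p, hp⟩ := hasDiskSeries_rogersTheta (Or.inl rfl : 1 = 1 ∨ 1 = 2)
  obtain ⟨r, hr⟩ := hasDiskSeries_rogersTheta (Or.inr rfl : 2 = 1 ∨ 2 = 2)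
  have h1 := rogersTheta_ne_zero (Or.inl rfl : 1 = 1 ∨ 1 = 2) hq
  have h2 := rogersTheta_ne_zero (Or.inr rfl : 2 = 1 ∨ 2 = 2) hq
  have hd := ((hasDerivAt_id q).mul (((hp.differentiableAt hq).hasDerivAt.div
    (hr.differentiableAt hq).hasDerivAt h2).pow 5)).deriv
  have e : diskHauptmodulD = id * (rogersTheta 1 / rogersTheta 2) ^ 5 := by
    ext q; simp [diskHauptmodulD]
  rw [e, hd]
  have hq5 : ‖q ^ 5‖ < 1 := by
    rw [norm_pow]; exact pow_lt_one₀ (norm_nonneg _) hq (by norm_num)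
  have p5 := eulerProd_ne_zero hq5
  have hw := rogersTheta_wronskian hq0 hq
  have hm := rogersTheta_mul hq0 hq
  have eu : eulerQuotient [(1, 5), (5, -1)] q * (rogersTheta 1 q * rogersTheta 2 q) =
      eulerProd q ^ 6 := by
    rw [hm]
    simp [eulerQuotient, zpow_neg]
    field_simp
  rw [← hw, ← eq_div_iff (mul_ne_zero h1 h2)] at eu
  rw [eu]
  simp
  field_simp

theorem eulerDeriv_C (c : ℂ) : eulerDeriv (C c) = 0 := by
  ext n
  rw [coeff_eulerDeriv, coeff_C]
  split_ifs with h <;> simp [h]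

/-- Two eta quotients are matched first: η₁⁵/η₅ with G(1 - 11T - T²), and η₅⁵/η₁ with GT. The former
is also ϑt/t, which identifies t with T; dividing the latter by t then gives G. -/
theorem isDiskSolution_D : IsDiskSolution 11 (-1) 3 diskHauptmodulD diskWeightTwoD
    fun q => 2⁻¹ * (diskEisensteinSum [(5, 5), (1, -1)] q -
      eulerQuotient [(1, 5), (5, -1)] q) := by
  obtain ⟨T, G, Φ, h⟩ := exists_isSolution 11 (-1) 3
  have h1 := h.natCast_mul_seriesE2At (by norm_num) isCertificate_D_1
  have h5 := h.natCast_mul_seriesE2At (by norm_num) isCertificate_D_5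
  have h24 := twentyFour_mul_C
  simp [map_ofNat] at h1 h5
  have hLU : ∀ x ∈ ([(1, 5), (5, -1)] : List (ℕ × ℤ)), x.1 ≠ 0 := by simp
  have hLW : ∀ x ∈ ([(5, 5), (1, -1)] : List (ℕ × ℤ)), x.1 ≠ 0 := by simp
  have eisU : eisensteinSum [(1, 5), (5, -1)] = 2 * Φ + G * (-11 * T - 2 * T ^ 2) := by
    simp [eisensteinSum, div_eq_mul_inv]
    linear_combination C (24 : ℂ)⁻¹ * (5 * h1 - h5) + (2 * Φ + G * (-11 * T - 2 * T ^ 2)) * h24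
  have eisW : eisensteinSum [(5, 5), (1, -1)] = 2 * Φ + G * (1 - 11 * T - T ^ 2) := by
    simp [eisensteinSum, div_eq_mul_inv]
    linear_combination C (24 : ℂ)⁻¹ * (5 * h5 - h1) + (2 * Φ + G * (1 - 11 * T - T ^ 2)) * h24
  obtain ⟨u, hu, hu'⟩ := exists_series_eulerQuotient _ hLU
  obtain ⟨w, hw, hw'⟩ := exists_series_eulerQuotient _ hLW
  obtain ⟨τ, hτ, hτ0⟩ := h.exists_T
  have hT0 : constantCoeff T = 0 := by simp [hτ]
  have hTne : T ≠ 0 := by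
    rintro rfl
    rcases mul_eq_zero.mp hτ.symm with hX | h0
    · exact X_ne_zero hX
    · simp [h0] at hτ0
  have dT := h.derivT
  have dG := h.derivG
  have hG0 := h.constG
  simp at dT
  have eu : u = G * (1 - 11 * T - T ^ 2) := by
    refine eq_of_eulerDeriv_eq_mul (m := 0) (v := 2 * Φ + G * (-11 * T - 2 * T ^ 2)) ?_ ?_ ?_ ?_
    · rw [hu', eisU]
      simp
    · rw [eulerDeriv_mul, map_sub, map_sub, eulerDeriv_pow, dG, dT, eulerDeriv_mul, dT,
        ← map_one (C (R := ℂ)), ← map_ofNat (C (R := ℂ)), eulerDeriv_C, eulerDeriv_C, map_one,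
        map_ofNat]
      push_cast
      ring
    · simp [h.constΦ, hT0]
    · simp [← hu.apply_zero, eulerQuotient_zero _ hLU, hG0, hT0]
  have ew : X * w = G * T := by
    refine eq_of_eulerDeriv_eq_mul (m := 1) (v := 2 * Φ + G * (1 - 11 * T - T ^ 2)) ?_ ?_ ?_ ?_
    · rw [eulerDeriv_mul, hw', eulerDeriv_X, eisW]
      simp
      ring
    · rw [eulerDeriv_mul, dG, dT]
      ring
    · simp [h.constΦ, hT0, hG0]
    · rw [hτ, mul_left_comm, ← zero_add 1, coeff_succ_X_mul, coeff_succ_X_mul,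
        coeff_zero_eq_constantCoeff_apply, coeff_zero_eq_constantCoeff_apply, map_mul, hτ0, hG0,
        ← hw.apply_zero, eulerQuotient_zero _ hLW, mul_one]
  have sA := HasDiskSeries.of_differentiableOn
    (differentiableOn_rogersTheta_div (Or.inl rfl : 1 = 1 ∨ 1 = 2) (Or.inr rfl : 2 = 1 ∨ 2 = 2))
  have sB := HasDiskSeries.of_differentiableOn
    (differentiableOn_rogersTheta_div (Or.inr rfl : 2 = 1 ∨ 2 = 2) (Or.inl rfl : 1 = 1 ∨ 1 = 2))
  generalize PowerSeries.mk _ = a at sA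
  generalize PowerSeries.mk _ = b at sB
  have st : HasDiskSeries diskHauptmodulD (X * a) := HasDiskSeries.id.mul sA
  have sg : HasDiskSeries diskWeightTwoD (w * b) := hw.mul sB
  have ha0 : constantCoeff a = 1 := by
    rw [← sA.apply_zero, rogersTheta_zero (Or.inl rfl), rogersTheta_zero (Or.inr rfl)]
    norm_num
  have et : X * a = T := by
    refine eq_of_eulerDeriv_eq_mul (m := 1) (v := u) ?_ ?_ ?_ ?_
    · exact st.eulerDeriv.unique (st.mul hu) fun q h0 hq => mul_deriv_diskHauptmodulD h0 hq
    · rw [dT, eu]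
      ring
    · simp [← hu.apply_zero, eulerQuotient_zero _ hLU]
    · rw [hτ, ← zero_add 1, coeff_succ_X_mul, coeff_succ_X_mul, coeff_zero_eq_constantCoeff_apply,
        coeff_zero_eq_constantCoeff_apply, ha0, hτ0]
  have eg : w * b = G := by
    refine mul_right_cancel₀ hTne ?_
    rw [← ew, ← et]
    refine (sg.mul st).unique (HasDiskSeries.id.mul hw) fun q h0 hq => ?_
    have n1 := rogersTheta_ne_zero (Or.inl rfl : 1 = 1 ∨ 1 = 2) hq
    have n2 := rogersTheta_ne_zero (Or.inr rfl : 2 = 1 ∨ 2 = 2) hq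
    rw [diskHauptmodulD, diskWeightTwoD]
    field_simp
  have hW := hasDiskSeries_eisensteinSum _ hLW
  rw [et] at st
  rw [eg] at sg
  have sφ := (hW.sub hu).const_mul 2⁻¹
  -- The logarithmic derivative of GT is 2Φ + G(1 - 11T - T²), so Φ is half its difference with
  -- η₁⁵/η₅.
  have eφ : C (2⁻¹ : ℂ) * (eisensteinSum [(5, 5), (1, -1)] - u) = Φ := by
    have h2 : (2 : ℂ⟦X⟧) * C (2 : ℂ)⁻¹ = 1 := by
      rw [← map_ofNat (C (R := ℂ)), ← map_mul]
      norm_num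
    rw [eisW, eu]
    linear_combination Φ * h2
  rw [eφ] at sφ
  have hP : HasDiskSeries (fun q => diskWeightTwoD q * (1 - 11 * diskHauptmodulD q -
      diskHauptmodulD q ^ 2)) u := by
    have := sg.mul (((HasDiskSeries.constant 1).sub (st.const_mul 11)).sub (st.pow 2))
    rwa [map_one, map_ofNat, ← eu] at this
  -- 24/5 = 5 - 1/5 is positive, so η₁⁵/η₅ vanishes at the cusp 0 and is bounded on the axis. For
  -- η₅⁵/η₁ the y⁻² term is absent, and its y⁻¹ term 1/(πy), halved, is the one wanted.
  obtain ⟨M, hM⟩ := eulerQuotient_axis_bound [(1, 5), (5, -1)] hLU (by simp) (a := 24 / 5)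
    (by norm_num) (by norm_num)
  obtain ⟨N, hN⟩ := diskEisensteinSum_axis_bound [(5, 5), (1, -1)] hLW
  refine h.isDiskSolution st sg sφ (fun y hy => ?_) (fun y hy => ?_)
    ⟨max M (N + M), fun y hy hy1 => ⟨?_, ?_⟩⟩
  · obtain ⟨r, hr, er⟩ := rogersTheta_axis_pos (Or.inl rfl : 1 = 1 ∨ 1 = 2) hy
    obtain ⟨s, hs, es⟩ := rogersTheta_axis_pos (Or.inr rfl : 2 = 1 ∨ 2 = 2) hy
    refine ⟨Real.exp (-(2 * π * y)) * (r / s) ^ 5, by positivity, ?_⟩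
    rw [diskHauptmodulD, er, es, axisQ]
    push_cast
    rfl
  · obtain ⟨r, hr, er⟩ := rogersTheta_axis_pos (Or.inl rfl : 1 = 1 ∨ 1 = 2) hy
    obtain ⟨s, hs, es⟩ := rogersTheta_axis_pos (Or.inr rfl : 2 = 1 ∨ 2 = 2) hy
    obtain ⟨p, hp, ep⟩ := eulerQuotient_axis_pos _ hLW hy
    refine ⟨p * (s / r) ^ 5, by positivity, ?_⟩
    rw [diskWeightTwoD, er, es, ep]
    push_cast
    rfl
  · refine le_of_eq_of_le (congrArg _ ?_) ((hM y hy hy1).trans (le_max_left _ _))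
    rw [← HasDiskSeries.eq hP hu (norm_axisQ_lt hy)]
    push_cast
    ring
  · have h3 := hN y hy hy1
    have h4 := hM y hy hy1
    have hM0 := (norm_nonneg _).trans h4
    norm_num at h3
    refine le_trans ?_ (le_max_right _ _)
    have e : (2⁻¹ * (diskEisensteinSum [(5, 5), (1, -1)] (axisQ y) -
        eulerQuotient [(1, 5), (5, -1)] (axisQ y)) - (2 * π * y : ℂ)⁻¹ : ℂ) =
        2⁻¹ * (diskEisensteinSum [(5, 5), (1, -1)] (axisQ y) - 6⁻¹ * (6 / (π * y))) -
        2⁻¹ * eulerQuotient [(1, 5), (5, -1)] (axisQ y) := by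
      have hy' : (y : ℂ) ≠ 0 := by exact_mod_cast hy.ne'
      have hpi : (π : ℂ) ≠ 0 := by exact_mod_cast Real.pi_ne_zero
      field_simp
      ring
    rw [e]
    refine (norm_sub_le _ _).trans ?_
    rw [norm_mul, norm_mul, norm_inv, RCLike.norm_ofNat, ← one_div (6 : ℂ)]
    linarith [norm_nonneg (diskEisensteinSum [(5, 5), (1, -1)] (axisQ y) - 1 / 6 * (6 / (π * y)))]

/-- The radicand of f is a positive real on the axis, so the principal complex power is the real
square root. -/
theorem satisfiesRecurrence_D : Case.D.SatisfiesRecurrence := by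
  have hexp : ∀ z : ℂ, 0 < z.im → ‖Complex.exp (2 * π * Complex.I * z)‖ < 1 := fun z hz => by
    have := HasQSeries.norm_qParam_lt ⟨z, hz⟩
    simpa [Function.Periodic.qParam] using this
  have ht : ∀ z : ℂ, 0 < z.im →
      hauptmodulD z = diskHauptmodulD (Complex.exp (2 * π * Complex.I * z)) := fun z hz => by
    rw [hauptmodulD, tprod_jacobiSym (Complex.exp_ne_zero _) (hexp z hz), diskHauptmodulD]
  refine recurrence_of_isDiskSolution .D (by decide) isDiskSolution_D ht fun y hy => ?_
  obtain ⟨r, hr, er⟩ := isDiskSolution_D.pos_g y hy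
  have hI : 0 < (Complex.I * y).im := by simpa using hy
  have base : (hauptmodulD (Complex.I * y))⁻¹ *
      (etaAt (Complex.I * y) 5 ^ 5 / etaAt (Complex.I * y) 1) = r := by
    have h1 := prod_etaAt_eq [(5, 5), (1, -1)] (Complex.I * y)
    simp at h1
    rw [← axisQ_eq_exp] at h1
    rw [div_eq_mul_inv, h1, ht _ hI, ← axisQ_eq_exp, ← er, diskHauptmodulD, diskWeightTwoD]
    have h0 := axisQ_ne_zero y
    field_simp
  refine ⟨√r, Real.sqrt_pos.mpr hr, ?_, ?_⟩
  · rw [Case.f, base, Real.sqrt_eq_rpow, Complex.ofReal_cpow hr.le]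
    norm_num
  · rw [← Complex.ofReal_pow, Real.sq_sqrt hr.le, er]

end BeauvilleFamily

theorem proposition2p1 (c : BeauvilleFamily.Case) :
    (∀ s : ℂ, 0 < s.re →
      MeasureTheory.IntegrableOn (c.gammaIntegrand s) (Set.Ioi (0 : ℝ))) ∧
    (∀ s : ℂ, 0 < s.re →
      s ^ 2 * c.Gamma s =
        ((c.coeffA : ℂ) * s * (s + 1) + (c.coeffLambda : ℂ)) * c.Gamma (s + 1) -
          (c.coeffB : ℂ) * (s + 1) ^ 2 * c.Gamma (s + 2)) := by
  cases c
  exacts [BeauvilleFamily.satisfiesRecurrence_A, BeauvilleFamily.satisfiesRecurrence_C,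
    BeauvilleFamily.satisfiesRecurrence_F, BeauvilleFamily.satisfiesRecurrence_E,
    BeauvilleFamily.satisfiesRecurrence_G, BeauvilleFamily.satisfiesRecurrence_D]
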